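/- **Setting.** Let $F$ be a finite field of odd characteristic, $\delta\in F^*$ a non-square, and $t\mapsto\varepsilon^t$ a nontrivial character $(F,+)\to\mathbb C^*$. Consider one of the types $B_n$ ($M=2n+1$), $C_n$ or $D_n$ ($M=2n$). The rows and columns of $M\times M$ matrices are labelled, in decreasing order, by the set $I$ of integers from $n$ to $-n$, where $0$ is omitted for $C_n$, $D_n$. Let $X\mapsto X^\dagger$ be the involutive antiautomorphism $X^\dagger=\Phi X^t\Phi^{-1}$, where $\Phi$ is the antidiagonal matrix with all antidiagonal entries $1$ (types $B_n,D_n$), respectively with antidiagonal entries $1$ in rows $i>0$ and $-1$ in rows $i<0$ (type $C_n$). Let $I=I_\ell\sqcup\dots\sqcup I_0\sqcup\dots\sqcup I_{-\ell}$ be a partition into consecutive segments, symmetric with respect to $0$ ($I_{-k}=-I_k$; only $I_0$ may be empty), let $\mathfrak p$ be the algebra of block upper triangular matrices, and $\mathcal U_\pm$ the spaces of strictly block upper/lower triangular matrices. Let $A=\mathfrak p\oplus\mathcal U_-$ be the associative algebra in which $\mathfrak p$ is multiplied as usual, $\mathcal U_-\cdot\mathcal U_-=0$, and $\mathcal U_-$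 is identified by the trace form with $\mathcal U_+^*$, with $(t\lambda)(x)=\lambda(xt)$, $(\lambda t)(x)=\lambda(tx)$ for $t\in\mathfrak p$, $\lambda \in \mathcal U_-$, $x\in\mathcal U_+$ (so $t\lambda$, $\lambda t$ are the strictly block lower triangular parts of the matrix products). The map $\dagger$ is an involution of the algebra $A$. Let $\mathbf G^a=A^\times$; the parabolic contraction of $\mathrm O(M)$ (types $B_n$, $D_n$) or $\mathrm{Sp}(M)$ (type $C_n$) is $G^a=\{g\in\mathbf G^a: g^\dagger=g^{-1}\}$. It equals $L\ltimes U^a$, where $L$ consists of the block diagonal elements and $U^a$ of the elements with identity diagonal blocks. Let $\mathfrak u^a=\{X\in A: X^\dagger=-X,\ X\text{ has zero diagonal blocks}\}$. The group $\mathbf G^a$ acts on $\mathfrak u^a$ by $g\cdot X=gXg^\dagger$ and on $(\mathfrak u^a)^*$ by $(g\cdot\mu)(X)=\mu(g^\dagger Xg)$. Let $f:U^a\to\mathfrak u^a$, $f(u)=2(u-1)(u+1)^{-1}$, be the Cayley map. **Basic pairs.** To a positive root is attached the pair $(i,j)$ for $\epsilon_i-\epsilon_j$, $(i,-j)$ for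 $\epsilon_i+\epsilon_j$ ($i>j>0$), $(i,0)$ for $\epsilon_i$ (type $B_n$), $(i,-i)$ for $2\epsilon_i$ (type $C_n$), and to a negative root the transposed pair of its opposite; roots are identified with their pairs. Put $(i,j)'=(-j,-i)$. For a root $\alpha$ let $E_\alpha+\eta(\alpha)E_{\alpha'}$ be its root vector ($E_\alpha$ the matrix unit), where $\eta(\alpha)=0$ if $\alpha=\alpha'$ and otherwise $\eta(\alpha)=\pm1$ is such that the vector is skew for $\dagger$. The root vectors of the set $\Delta(\mathfrak u^a)$ of the roots outside the diagonal blocks form a basis of $\mathfrak u^a$. A rook placement is a subset $D\subset\Delta(\mathfrak u^a)$ such that every row and every column contains at most one pair from $D\cup D'$. For $\phi:D\to F^*$ let $X_{D,\phi}\in\mathfrak u^a$ and $\Lambda_{D,\phi}\in(\mathfrak u^a)^*$ be the linear combinations, with coefficients $\phi(\gamma)$, of the root vectors and of the dual basis vectors of the $\gamma\in D$. The pair $(D,\phi)$ is basic if: in types $B_n,D_n$, $\phi\equiv1$; in type $C_n$, $\phi(\gamma)\in\{1,\delta\}$, $\phi(\gamma)=\delta$ only for antidiagonal $\gamma=(i,-i)$,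 and for every $k$ all elements of $D\cap(I_k\times I_{-k})$ are antidiagonal and at most one of them has $\phi(\gamma)=\delta$. **Supercharacters.** Put $\sigma_{D,\phi}(u)=\sum_{\mu\in\mathbf G^a\cdot\Lambda_{D,\phi}}\varepsilon^{\mu(f(u))}$ for $u\in U^a$. For $\gamma\in I_k\times I_m$, $k\ne m$, call the blocks $k,k-1,\dots,m$ (if $k>m$), respectively the blocks $\ell,\dots,m$ and $k,\dots,-\ell$ (if $k<m$), the blocks of $\gamma$. Let $H_\gamma$ be the group of all $h\in L$ whose submatrix on the blocks of $\gamma$ is scalar and whose submatrix on the blocks of $\gamma'$ is scalar, and $H_D=L\cap\bigcap_{\gamma\in D}H_\gamma$. For a triple $\mathfrak a=(D,\phi,\theta)$, where $(D,\phi)$ is a basic pair and $\theta$ is the character of an irreducible complex representation of $H_D$, let $\sigma_{\mathfrak a}$ be the function on $G^a$ induced from the function $hu\mapsto\theta(h)\sigma_{D,\phi}(u)$ on $H_D\ltimes U^a$. **Superclasses.** Let $K_{D,\phi}=f^{-1}(\mathbf G^a\cdot X_{D,\phi})\subset U^a$. For $h\in L$ let $\mathfrak u^a_h$ be the smallest $\mathbf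 G^a$-invariant ideal of the Lie algebra $\mathfrak u^a$ such that $\mathrm{Ad}_h$ is the identity on $\mathfrak u^a/\mathfrak u^a_h$, let $U^a_h=f^{-1}(\mathfrak u^a_h)$, and let $\Pi_h:U^a\to U^a/U^a_h$ be the projection. For a triple $\mathfrak b=(D,\phi,h)$, where $(D,\phi)$ is a basic pair and $h\in H_D$, put $K_{\mathfrak b}=\mathrm{CL}_L(h)\cdot\Pi_h^{-1}\Pi_h(K_{D,\phi})$, where $\mathrm{CL}_L(h)$ is the conjugacy class of $h$ in $L$. **Theorem.** In the orthogonal types $B_n$, $D_n$ assume that $|I_\ell|\ne2$ if $\ell\geq 1$, and that $|I_1|\ne2$ if $I_0=\varnothing$. (No assumption is made in type $C_n$.) Then the set $\{\sigma_{\mathfrak a}\}$ and the set $\{K_{\mathfrak b}\}$ form a supercharacter theory of $G^a$, that is: every $\sigma_{\mathfrak a}$ is a character of $G^a$; distinct members of $\{\sigma_{\mathfrak a}\}$ are disjoint characters; $\{K_{\mathfrak b}\}$ is a partition of $G^a$; the two sets have the same number of members; every $\sigma_{\mathfrak a}$ is constant on every $K_{\mathfrak b}$; and $\{1\}$ is one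 of the sets $K_{\mathfrak b}$. -/

import Mathlib

noncomputable section

namespace ParabolicContraction

/-! ## Characters and supercharacter theories of a finite group -/

section Characters

variable {G : Type*} [Group G]

/-- `χ` is the character of a nonzero finite-dimensional complex representation of `G`. -/
def IsCharacter (χ : G → ℂ) : Prop :=
  ∃ (n : ℕ) (ρ : Representation ℂ G (Fin n → ℂ)), 0 < n ∧ χ = ρ.character

/-- `χ` is the character of an irreducible finite-dimensional complex representation of `G`. -/
def IsIrreducibleCharacter (χ : G → ℂ) : Prop :=
  ∃ (n : ℕ) (ρ : Representation ℂ G (Fin n → ℂ)), ρ.IsIrreducible ∧ χ = ρ.character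

/-- The usual Hermitian form on complex functions on `G`. -/
def charInner [Fintype G] (χ ψ : G → ℂ) : ℂ :=
  (Fintype.card G : ℂ)⁻¹ * ∑ g : G, χ g * star (ψ g)

/-- Two characters are disjoint if they have no irreducible constituent in common. -/
def DisjointCharacters [Fintype G] (χ χ' : G → ℂ) : Prop :=
  ∀ ψ : G → ℂ, IsIrreducibleCharacter ψ → charInner χ ψ = 0 ∨ charInner χ' ψ = 0

/-- A supercharacter theory of `G`: a system `S` of pairwise disjoint characters and a partition
`K` of `G` with as many members, such that the characters are constant on the members of `K`, and
`{1}` is a member of `K`. -/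
structure IsSupercharacterTheory [Fintype G] (S : Set (G → ℂ)) (K : Set (Set G)) : Prop where
  isCharacter : ∀ χ ∈ S, IsCharacter χ
  disjoint : S.Pairwise DisjointCharacters
  isPartition : Setoid.IsPartition K
  encard_eq : S.encard = K.encard
  constant : ∀ χ ∈ S, ∀ k ∈ K, ∀ x ∈ k, ∀ y ∈ k, χ x = χ y
  one_mem : {1} ∈ K

open Classical in
/-- The function on `G` induced from the function `ξ` on the subgroup `A`. -/
def induced [Fintype G] (A : Subgroup G) (ξ : A → ℂ) : G → ℂ := fun g =>
  (Nat.card A : ℂ)⁻¹ * ∑ x : G, if hx : x * g * x⁻¹ ∈ A then ξ ⟨x * g * x⁻¹, hx⟩ else 0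

end Characters

/-! ## Types, labels of rows and columns, symmetric partitions -/

/-- The classical types: `B` is `O(2n+1)`, `C` is `Sp(2n)`, `D` is `O(2n)`. -/
inductive ClassicalType
  | B
  | C
  | D

/-- The labels of rows and columns: the integers from `-n` to `n`, with `0` only for type `B`.
Rows and columns are listed in decreasing order of their labels. -/
def IsLabel (T : ClassicalType) (n : ℕ) (i : ℤ) : Prop :=
  i ∈ Finset.Icc (-(n : ℤ)) n ∧ (i = 0 → T = ClassicalType.B)

/-- The set of labels. -/
abbrev Idx (T : ClassicalType) (n : ℕ) : Type := {i : ℤ // IsLabel T n i}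

variable {T : ClassicalType} {n : ℕ}

instance : Finite (Idx T n) :=
  Finite.of_injective (β := Finset.Icc (-(n : ℤ)) n) (fun i => ⟨i.1, i.2.1⟩)
    (fun i j h => Subtype.ext (by simpa using h))

instance : Fintype (Idx T n) := Fintype.ofFinite _

instance : InvolutiveNeg (Idx T n) where
  neg i := ⟨-i.1, by
    obtain ⟨i, h, h0⟩ := i
    simp only [Finset.mem_Icc] at h
    exact ⟨by simp only [Finset.mem_Icc]; omega, fun hi => h0 (by simpa using hi)⟩⟩
  neg_neg i := Subtype.ext (neg_neg i.1)

/-- A partition of the set of labels into consecutive segments `I_ℓ, …, I_0, …, I_{-ℓ}`, symmetric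
with respect to zero, where only `I_0` may be empty: `block i = k` means `i ∈ I_k`. -/
structure SymPartition (T : ClassicalType) (n : ℕ) where
  /-- the largest number of a segment -/
  len : ℕ
  /-- the number of the segment of a label -/
  block : Idx T n → ℤ
  mono : Monotone block
  block_neg : ∀ i, block (-i) = -block i
  block_le : ∀ i, block i ≤ len
  exists_block : ∀ k : ℕ, 1 ≤ k → k ≤ len → ∃ i, block i = k

/-- The number of labels in the segment `I_k`. -/
def SymPartition.size (P : SymPartition T n) (k : ℤ) : ℕ := Nat.card {i : Idx T n // P.block i = k}

/-! ## The contraction of the parabolic subalgebra of matrices, with its involution -/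

/-- The associative algebra `gl^a = p ⊕ u_-^a`. Its elements are written as matrices, the block
upper triangular part being the component in `p`, and the strictly block lower triangular part the
component in `u_-^a`, which is identified with the dual of `u_+` by the trace form. -/
def ContractionAlgebra (_P : SymPartition T n) (F : Type*) : Type _ := Matrix (Idx T n) (Idx T n) F

variable (P : SymPartition T n) (F : Type*) [Field F]

instance : AddCommGroup (ContractionAlgebra P F) :=
  inferInstanceAs (AddCommGroup (Matrix (Idx T n) (Idx T n) F))

instance : Module F (ContractionAlgebra P F) :=
  inferInstanceAs (Module F (Matrix (Idx T n) (Idx T n) F))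

@[ext]
theorem ContractionAlgebra.ext {P : SymPartition T n} {F : Type*} {X Y : ContractionAlgebra P F}
    (h : ∀ i j, X i j = Y i j) : X = Y := Matrix.ext h

instance [Finite F] : Finite (ContractionAlgebra P F) :=
  inferInstanceAs (Finite (Idx T n → Idx T n → F))

variable {F}

/-- The block upper triangular part of a matrix (diagonal blocks included). -/
def upperPart (X : Matrix (Idx T n) (Idx T n) F) : Matrix (Idx T n) (Idx T n) F :=
  fun i j => if P.block j ≤ P.block i then X i j else 0

/-- The strictly block lower triangular part of a matrix. -/
def lowerPart (X : Matrix (Idx T n) (Idx T n) F) : Matrix (Idx T n) (Idx T n) F :=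
  fun i j => if P.block i < P.block j then X i j else 0

/-- The multiplication of the contraction: matrix multiplication on `p`, zero multiplication on
`u_-^a`, and `(tλ)(x) = λ(xt)`, `(λt)(x) = λ(tx)` for `t ∈ p`, `λ ∈ u_-^a`, `x ∈ u_+`. As
`λ(x) = tr (λ x)`, the products `tλ` and `λt` are the strictly block lower triangular parts of the
matrix products. -/
def contractionMul (X Y : Matrix (Idx T n) (Idx T n) F) : Matrix (Idx T n) (Idx T n) F :=
  upperPart P X * upperPart P Y +
    lowerPart P (upperPart P X * lowerPart P Y + lowerPart P X * upperPart P Y)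

/-- `1` at the positions strictly below the diagonal blocks, `0` elsewhere. -/
def wind (i j : Idx T n) : ℕ := if P.block i < P.block j then 1 else 0

/-- The coefficient of `X i k * Y k j` in an entry of the product. -/
def windCoeff (F : Type*) [Field F] (i k j : Idx T n) : F :=
  if wind P i k + wind P k j = wind P i j then 1 else 0

theorem windCoeff_cocycle (i l k j : Idx T n) :
    windCoeff P F i k j * windCoeff P F i l k = windCoeff P F i l j * windCoeff P F l k j := by
  unfold windCoeff wind
  split_ifs <;> first | omega | contradiction | simp

theorem contractionMul_apply (X Y : Matrix (Idx T n) (Idx T n) F) (i j : Idx T n) :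
    contractionMul P X Y i j = ∑ k, windCoeff P F i k j * (X i k * Y k j) := by
  simp only [contractionMul, Matrix.add_apply, Matrix.mul_apply, lowerPart, upperPart, wind,
    windCoeff]
  by_cases h : P.block i < P.block j
  · simp only [h, if_true, ← Finset.sum_add_distrib]
    refine Finset.sum_congr rfl fun k _ => ?_
    split_ifs <;> first | omega | simp
  · simp only [h, if_false, add_zero]
    refine Finset.sum_congr rfl fun k _ => ?_
    split_ifs <;> first | omega | contradiction | simp

theorem contractionMul_assoc (X Y Z : Matrix (Idx T n) (Idx T n) F) :
    contractionMul P (contractionMul P X Y) Z = contractionMul P X (contractionMul P Y Z) := by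
  ext i j
  simp only [contractionMul_apply, Finset.sum_mul, Finset.mul_sum]
  rw [Finset.sum_comm]
  refine Finset.sum_congr rfl fun l _ => Finset.sum_congr rfl fun k _ => ?_
  linear_combination (X i l * Y l k * Z k j) * windCoeff_cocycle P (F := F) i l k j

theorem windCoeff_left (i j : Idx T n) : windCoeff P F i i j = 1 := by
  simp [windCoeff, wind]

theorem windCoeff_right (i j : Idx T n) : windCoeff P F i j j = 1 := by
  simp [windCoeff, wind]

theorem windCoeff_neg (i k j : Idx T n) :
    windCoeff P F (-j) (-k) (-i) = windCoeff P F i k j := by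
  simp only [windCoeff, wind, P.block_neg, neg_lt_neg_iff]
  split_ifs <;> first | omega | contradiction | rfl

/-- An entry of a product lying in a diagonal block only involves entries in that block. -/
theorem windCoeff_of_block_eq {i j : Idx T n} (h : P.block i = P.block j) (k : Idx T n) :
    windCoeff P F i k j = if P.block i = P.block k then 1 else 0 := by
  simp only [windCoeff, wind]
  split_ifs <;> first | omega | contradiction | rfl

instance : DecidableEq (Idx T n) := fun i j => decidable_of_iff (i.1 = j.1) Subtype.ext_iff.symm

instance : Ring (ContractionAlgebra P F) where
  __ := (inferInstance : AddCommGroup (ContractionAlgebra P F))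
  mul X Y := contractionMul P X Y
  one := (1 : Matrix (Idx T n) (Idx T n) F)
  mul_assoc X Y Z := contractionMul_assoc P X Y Z
  one_mul X := by
    ext i j
    refine (contractionMul_apply P (1 : Matrix (Idx T n) (Idx T n) F) X i j).trans ?_
    simp only [Matrix.one_apply, ite_mul, one_mul, zero_mul, mul_ite, mul_zero,
      Finset.sum_ite_eq, Finset.mem_univ, if_true, windCoeff_left]
  mul_one X := by
    ext i j
    refine (contractionMul_apply P X (1 : Matrix (Idx T n) (Idx T n) F) i j).trans ?_
    simp only [Matrix.one_apply, mul_ite, mul_one, mul_zero, Finset.sum_ite_eq',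
      Finset.mem_univ, if_true, windCoeff_right, one_mul]
  zero_mul X := by
    ext i j
    refine (contractionMul_apply P 0 X i j).trans (Finset.sum_eq_zero fun k _ => ?_)
    exact (congrArg (_ * ·) (zero_mul (X k j))).trans (mul_zero _)
  mul_zero X := by
    ext i j
    refine (contractionMul_apply P X 0 i j).trans (Finset.sum_eq_zero fun k _ => ?_)
    exact (congrArg (_ * ·) (mul_zero (X i k))).trans (mul_zero _)
  left_distrib X Y Z := by
    ext i j
    refine (contractionMul_apply P X (Y + Z) i j).trans ?_
    refine Eq.trans ?_ (congrArg₂ (· + ·) (contractionMul_apply P X Y i j).symm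
      (contractionMul_apply P X Z i j).symm)
    rw [← Finset.sum_add_distrib]
    refine Finset.sum_congr rfl fun k _ => ?_
    rw [← mul_add, ← mul_add]
    rfl
  right_distrib X Y Z := by
    ext i j
    refine (contractionMul_apply P (X + Y) Z i j).trans ?_
    refine Eq.trans ?_ (congrArg₂ (· + ·) (contractionMul_apply P X Z i j).symm
      (contractionMul_apply P Y Z i j).symm)
    rw [← Finset.sum_add_distrib]
    refine Finset.sum_congr rfl fun k _ => ?_
    rw [← mul_add, ← add_mul]
    rfl

theorem mul_entry (X Y : ContractionAlgebra P F) (i j : Idx T n) :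
    (X * Y) i j = ∑ k, windCoeff P F i k j * (X i k * Y k j) :=
  contractionMul_apply P X Y i j

/-- The multiplication of the contraction is bilinear over `F`. -/
instance : Algebra F (ContractionAlgebra P F) :=
  Algebra.ofModule
    (fun c X Y => by
      ext i j
      refine (mul_entry P (c • X) Y i j).trans ?_
      refine Eq.trans ?_ (congrArg (c * ·) (mul_entry P X Y i j).symm)
      rw [Finset.mul_sum]
      refine Finset.sum_congr rfl fun k _ => ?_
      rw [show (c • X) i k = c * X i k from rfl]
      ring)
    (fun c X Y => by
      ext i j
      refine (mul_entry P X (c • Y) i j).trans ?_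
      refine Eq.trans ?_ (congrArg (c * ·) (mul_entry P X Y i j).symm)
      rw [Finset.mul_sum]
      refine Finset.sum_congr rfl fun k _ => ?_
      rw [show (c • Y) k j = c * Y k j from rfl]
      ring)

/-! ### The involution -/

open Classical in
/-- `1` in the orthogonal case; the sign of the label in the symplectic case. -/
def sgn (F : Type*) [Field F] (i : Idx T n) : F :=
  if T = ClassicalType.C ∧ i.1 < 0 then -1 else 1

/-- The antidiagonal matrix of the involution: `1` at all antidiagonal entries in the orthogonal
case, `1` in the upper half and `-1` in the lower half in the symplectic case. -/
def formMatrix (T : ClassicalType) (n : ℕ) (F : Type*) [Field F] : Matrix (Idx T n) (Idx T n) F :=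
  fun i j => if j = -i then sgn F i else 0

/-- The involution `X ↦ X†`. -/
def dagger (X : Matrix (Idx T n) (Idx T n) F) : Matrix (Idx T n) (Idx T n) F :=
  fun i j => sgn F i * sgn F j * X (-j) (-i)

theorem sgn_mul_self (i : Idx T n) : sgn F i * sgn F i = 1 := by
  unfold sgn
  split_ifs <;> simp

theorem sgn_neg_mul_sgn_neg (i j : Idx T n) :
    sgn F (-i) * sgn F (-j) = sgn F i * sgn F j := by
  have hv : ∀ k : Idx T n, (-k).1 = -k.1 := fun _ => rfl
  have hz : ∀ k : Idx T n, T = ClassicalType.C → k.1 ≠ 0 := by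
    rintro k rfl h
    exact absurd (k.2.2 h) (by simp)
  by_cases hT : T = ClassicalType.C
  · have hi := hz i hT
    have hj := hz j hT
    simp only [sgn, hT, true_and, hv]
    split_ifs <;> first | omega | simp
  · simp [sgn, hT]

/-- `X† = Φ Xᵗ Φ⁻¹`, where `Φ` is the matrix of the form. -/
theorem dagger_eq (X : Matrix (Idx T n) (Idx T n) F) :
    dagger X = formMatrix T n F * X.transpose * (formMatrix T n F)⁻¹ := by
  have hinv : formMatrix T n F * (formMatrix T n F).transpose = 1 := by
    ext i j
    rw [Matrix.mul_apply, Finset.sum_eq_single (-i)]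
    · by_cases h : i = j
      · subst h
        simp [formMatrix, sgn_mul_self]
      · simp [formMatrix, h]
    · intro k _ hk
      simp [formMatrix, hk]
    · simp
  rw [Matrix.inv_eq_right_inv hinv]
  ext i j
  rw [Matrix.mul_apply, Finset.sum_eq_single (-j), Matrix.mul_apply, Finset.sum_eq_single (-i)]
  · simp only [formMatrix, dagger, Matrix.transpose_apply, if_true]
    ring
  · intro k _ hk
    simp [formMatrix, hk]
  · simp
  · intro k _ hk
    simp [formMatrix, hk]
  · simp

instance : StarRing (ContractionAlgebra P F) where
  star X := dagger X
  star_involutive X := by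
    ext i j
    change sgn F i * sgn F j * (sgn F (-j) * sgn F (-i) * X (- -i) (- -j)) = X i j
    rw [sgn_neg_mul_sgn_neg, neg_neg, neg_neg]
    linear_combination (sgn F j * sgn F j * X i j) * sgn_mul_self (F := F) i +
      X i j * sgn_mul_self (F := F) j
  star_mul X Y := by
    ext i j
    refine Eq.trans (congrArg (sgn F i * sgn F j * ·) (mul_entry P X Y (-j) (-i))) ?_
    refine Eq.trans ?_ (mul_entry P _ _ i j).symm
    rw [Finset.mul_sum, ← Equiv.sum_comp (Equiv.neg (Idx T n))]
    refine Finset.sum_congr rfl fun k _ => ?_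
    change _ = windCoeff P F i k j *
      ((sgn F i * sgn F k * Y (-k) (-i)) * (sgn F k * sgn F j * X (-j) (-k)))
    rw [Equiv.neg_apply, windCoeff_neg]
    linear_combination (-(windCoeff P F i k j * sgn F i * sgn F j * X (-j) (-k) * Y (-k) (-i))) *
      sgn_mul_self (F := F) k
  star_add X Y := by
    ext i j
    exact mul_add _ _ _

theorem star_entry (X : ContractionAlgebra P F) (i j : Idx T n) :
    (star X) i j = sgn F i * sgn F j * X (-j) (-i) := rfl

theorem star_smul_entry (c : F) (X : ContractionAlgebra P F) : star (c • X) = c • star X := by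
  ext i j
  change sgn F i * sgn F j * (c * X (-j) (-i)) = c * (sgn F i * sgn F j * X (-j) (-i))
  ring

/-! ## The group `G^a`, its subgroups `L` and `U^a`, the Lie algebra `u^a` -/

variable (F)

/-- The parabolic contraction `G^a` of the orthogonal or symplectic group: the units `g` of the
contraction algebra with `g† = g⁻¹`. -/
abbrev ContractionGroup : Type _ := unitary (ContractionAlgebra P F)

instance [Finite F] : Fintype (ContractionGroup P F) := Fintype.ofFinite _

/-- The block diagonal part, as a homomorphism compatible with the involution. -/
def leviPart : ContractionAlgebra P F →⋆* ContractionAlgebra P F where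
  toFun X := fun i j => if P.block i = P.block j then X i j else 0
  map_one' := by
    ext i j
    change (if P.block i = P.block j then (1 : Matrix (Idx T n) (Idx T n) F) i j else 0) =
      (1 : Matrix (Idx T n) (Idx T n) F) i j
    by_cases h : i = j
    · simp [h]
    · simp [h]
  map_mul' X Y := by
    ext i j
    refine Eq.trans ?_ (mul_entry P _ _ i j).symm
    change (if P.block i = P.block j then (X * Y) i j else 0) =
      ∑ k, windCoeff P F i k j * ((if P.block i = P.block k then X i k else 0) *
        (if P.block k = P.block j then Y k j else 0))
    by_cases h : P.block i = P.block j
    · rw [if_pos h, mul_entry]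
      refine Finset.sum_congr rfl fun k _ => ?_
      rw [windCoeff_of_block_eq P h]
      by_cases hk : P.block i = P.block k
      · rw [if_pos hk, if_pos hk, if_pos (hk.symm.trans h)]
      · rw [if_neg hk]
        simp
    · rw [if_neg h]
      refine (Finset.sum_eq_zero fun k _ => ?_).symm
      by_cases hk : P.block i = P.block k
      · rw [if_neg (fun hkj => h (hk.trans hkj))]
        simp
      · rw [if_neg hk]
        simp
  map_star' X := by
    ext i j
    change (if P.block i = P.block j then sgn F i * sgn F j * X (-j) (-i) else 0) =
      sgn F i * sgn F j * (if P.block (-j) = P.block (-i) then X (-j) (-i) else 0)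
    simp only [P.block_neg, neg_inj]
    by_cases h : P.block i = P.block j
    · simp [h]
    · simp [h, Ne.symm h]

/-- The projection of `G^a` to its Levi subgroup. -/
def leviHom : ContractionGroup P F →* ContractionGroup P F :=
  (Unitary.map (leviPart P F)).toMonoidHom

/-- The Levi subgroup `L` of `G^a`: the block diagonal elements. -/
def leviSubgroup : Subgroup (ContractionGroup P F) := (leviHom P F).range

/-- The subgroup `U^a` of `G^a`: the elements all of whose diagonal blocks are identity matrices. -/
def unipotentSubgroup : Subgroup (ContractionGroup P F) := (leviHom P F).ker

/-- The Lie algebra `u^a` of `U^a`: the elements `X` with `X† = -X` and zero diagonal blocks. -/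
def nilradical : Submodule F (ContractionAlgebra P F) where
  carrier := {X | star X = -X ∧ ∀ i j, P.block i = P.block j → X i j = 0}
  add_mem' := by
    rintro X Y ⟨hX, hX'⟩ ⟨hY, hY'⟩
    refine ⟨by rw [star_add, hX, hY, neg_add], fun i j h => ?_⟩
    change X i j + Y i j = 0
    rw [hX' i j h, hY' i j h, add_zero]
  zero_mem' := ⟨by simp, fun _ _ _ => rfl⟩
  smul_mem' := by
    rintro c X ⟨hX, hX'⟩
    refine ⟨by rw [star_smul_entry, hX, smul_neg], fun i j h => ?_⟩
    change c * X i j = 0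
    rw [hX' i j h, mul_zero]

variable {F}

theorem mul_entry_eq_zero_left {X Y : ContractionAlgebra P F}
    (hX : ∀ i j, P.block i = P.block j → X i j = 0) (i j : Idx T n)
    (h : P.block i = P.block j) : (X * Y) i j = 0 := by
  rw [mul_entry]
  refine Finset.sum_eq_zero fun k _ => ?_
  rw [windCoeff_of_block_eq P h]
  split_ifs with hk
  · rw [hX i k hk]
    simp
  · simp

theorem mul_entry_eq_zero_right {X Y : ContractionAlgebra P F}
    (hY : ∀ i j, P.block i = P.block j → Y i j = 0) (i j : Idx T n)
    (h : P.block i = P.block j) : (X * Y) i j = 0 := by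
  rw [mul_entry]
  refine Finset.sum_eq_zero fun k _ => ?_
  rw [windCoeff_of_block_eq P h]
  split_ifs with hk
  · rw [hY k j (hk.symm.trans h)]
    simp
  · simp

/-- The action `X ↦ g X g†` of the units `g` of the contraction algebra on `u^a`. -/
def act (g : (ContractionAlgebra P F)ˣ) : nilradical P F →ₗ[F] nilradical P F where
  toFun X := ⟨g * X.1 * star (g : ContractionAlgebra P F), by
    rw [star_mul, star_mul, star_star, X.2.1]
    simp [mul_assoc], fun i j h =>
      mul_entry_eq_zero_left P (mul_entry_eq_zero_right P X.2.2) i j h⟩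
  map_add' X Y := Subtype.ext (by simp [mul_add, add_mul])
  map_smul' c X := Subtype.ext (by simp)

/-- The orbit of `X ∈ u^a` under the action `X ↦ g X g†`. -/
def orbit (X : nilradical P F) : Set (nilradical P F) := {Y | ∃ g, Y = act P g X}

/-- The orbit of a linear form `μ` on `u^a` under the action `(g μ)(X) = μ(g† X g)`. -/
def dualOrbit (μ : Module.Dual F (nilradical P F)) : Set (Module.Dual F (nilradical P F)) :=
  {ν | ∃ g : (ContractionAlgebra P F)ˣ, ν = μ ∘ₗ act P (star g)}

theorem unipotent_entry (u : unipotentSubgroup P F) (i j : Idx T n) (h : P.block i = P.block j) :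
    (u.1.1 - 1) i j = 0 := by
  have hu : leviHom P F u.1 = 1 := u.2
  have h1 : (leviHom P F u.1).1 i j = (1 : ContractionAlgebra P F) i j := by
    rw [hu]
    rfl
  have h2 : (leviHom P F u.1).1 i j = u.1.1 i j := if_pos h
  exact sub_eq_zero.2 (h2.symm.trans h1)

theorem cayley_mem (u : unipotentSubgroup P F) :
    2 * (u.1.1 - 1) * Ring.inverse (u.1.1 + 1) ∈ nilradical P F := by
  refine ⟨?_, fun i j h => mul_entry_eq_zero_left P
    (mul_entry_eq_zero_right P (unipotent_entry P u)) i j h⟩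
  by_cases hw : IsUnit (u.1.1 + 1)
  · have hsu : star u.1.1 * u.1.1 = 1 := Unitary.star_mul_self_of_mem u.1.2
    have hinv : Ring.inverse (u.1.1 + 1) * (u.1.1 + 1) = 1 := Ring.inverse_mul_cancel _ hw
    have hinv' : (u.1.1 + 1) * Ring.inverse (u.1.1 + 1) = 1 := Ring.mul_inverse_cancel _ hw
    have hcomm : (u.1.1 + 1) * (2 * (u.1.1 - 1)) = 2 * (u.1.1 - 1) * (u.1.1 + 1) := by
      noncomm_ring
    have hstar : star (u.1.1 + 1) = star u.1.1 * (u.1.1 + 1) := by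
      rw [mul_add, hsu, star_add, star_one, mul_one, add_comm]
    refine hw.star.mul_left_cancel ?_
    rw [← star_mul, mul_assoc, hinv, mul_one, mul_neg, hstar, mul_assoc, ← mul_assoc (u.1.1 + 1),
      hcomm, mul_assoc _ (u.1.1 + 1), hinv', mul_one, star_mul, star_sub, star_one,
      star_ofNat]
    have h2 : star u.1.1 * (2 * (u.1.1 - 1)) = 2 * (star u.1.1 * u.1.1 - star u.1.1) := by
      noncomm_ring
    rw [h2, hsu]
    noncomm_ring
  · rw [Ring.inverse_non_unit _ hw]
    simp

/-- The Cayley map `f(u) = 2(u - 1)(u + 1)⁻¹` from `U^a` to `u^a`. In odd characteristic `u + 1` is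
invertible for every `u ∈ U^a`, because `u - 1` is nilpotent. -/
def cayley (u : unipotentSubgroup P F) : nilradical P F :=
  ⟨2 * (u.1.1 - 1) * Ring.inverse (u.1.1 + 1), cayley_mem P u⟩

/-! ## Roots, rook placements, basic pairs -/

/-- The pairs attached to positive roots: `(i, j)` to `ε_i - ε_j`, `(i, -j)` to `ε_i + ε_j` for
`i > j > 0`, `(i, 0)` to `ε_i` in type `B`, and `(i, -i)` to `2ε_i` in type `C`. -/
def IsPositiveRoot (α : Idx T n × Idx T n) : Prop :=
  (-α.1.1 < α.2.1 ∧ α.2.1 < α.1.1) ∨ (T = ClassicalType.C ∧ 0 < α.1.1 ∧ α.2 = -α.1)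

/-- The pairs attached to roots; to `-α` is attached the transpose of the pair of `α`. -/
def IsRoot (α : Idx T n × Idx T n) : Prop := IsPositiveRoot α ∨ IsPositiveRoot α.swap

/-- The pair `α' = (-j, -i)` for `α = (i, j)`. -/
def conjPair (α : Idx T n × Idx T n) : Idx T n × Idx T n := (-α.2, -α.1)

/-- The matrix unit at the position `α`; it lies in `p` or in `u_-^a`. -/
def matrixUnit (α : Idx T n × Idx T n) : ContractionAlgebra P F :=
  Matrix.single α.1 α.2 (1 : F)

/-- The root vector `E_α + η(α) E_{α'}` (or `F_α + η(α) F_{α'}`) in `u^a`, where `η(α) = 0` if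
`α = α'`, and otherwise `η(α) = ±1` is determined by skewness under the involution. -/
def rootVector (α : Idx T n × Idx T n) : ContractionAlgebra P F :=
  matrixUnit P α + (if conjPair α = α then 0 else -(sgn F α.1 * sgn F α.2)) •
    matrixUnit P (conjPair α)

/-- The dual basis of the root vectors: the coefficient of the root vector of `α` in an element of
`u^a` is its entry at the position `α`. -/
def dualRootVector (α : Idx T n × Idx T n) : Module.Dual F (nilradical P F) where
  toFun X := X.1 α.1 α.2
  map_add' _ _ := rfl
  map_smul' _ _ := rfl

/-- Rook placements `D` in the set of roots of `u^a`: in every row and every column there is at most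
one pair from `D ∪ D'`. -/
def IsRookPlacement (D : Finset (Idx T n × Idx T n)) : Prop :=
  (∀ γ ∈ D, IsRoot γ ∧ P.block γ.1 ≠ P.block γ.2) ∧
  ∀ α β : Idx T n × Idx T n, (α ∈ D ∨ conjPair α ∈ D) → (β ∈ D ∨ conjPair β ∈ D) →
    (α.1 = β.1 ∨ α.2 = β.2) → α = β

/-- Basic pairs `(D, φ)`, with respect to a fixed non-square `δ`. -/
def IsBasicPair (δ : F) (D : Finset (Idx T n × Idx T n)) (φ : D → Fˣ) : Prop :=
  IsRookPlacement P D ∧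
  (T ≠ ClassicalType.C → ∀ γ, φ γ = 1) ∧
  (T = ClassicalType.C →
    (∀ γ, (φ γ : F) = 1 ∨ (φ γ : F) = δ) ∧
    (∀ γ, (φ γ : F) = δ → γ.1.2 = -γ.1.1) ∧
    (∀ γ : D, P.block γ.1.2 = -P.block γ.1.1 → γ.1.2 = -γ.1.1) ∧
    (∀ γ γ' : D, P.block γ.1.2 = -P.block γ.1.1 → P.block γ'.1.2 = -P.block γ'.1.1 →
      P.block γ.1.1 = P.block γ'.1.1 → (φ γ : F) = δ → (φ γ' : F) = δ → γ = γ'))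

/-- The element `X_{D,φ}` of `u^a`. -/
def basicElement (D : Finset (Idx T n × Idx T n)) (φ : D → Fˣ) : ContractionAlgebra P F :=
  ∑ γ : D, (φ γ : F) • rootVector P γ.1

/-- The linear form `Λ_{D,φ}` on `u^a`. -/
def basicForm (D : Finset (Idx T n × Idx T n)) (φ : D → Fˣ) : Module.Dual F (nilradical P F) :=
  ∑ γ : D, (φ γ : F) • dualRootVector P γ.1

/-! ## Supercharacters and superclasses of `U^a` -/

/-- The function `σ_{D,φ}(u) = ∑ ε(μ(f(u)))` on `U^a`, summed over the orbit of `Λ_{D,φ}`. -/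
def sigma (ε : AddChar F ℂ) (D : Finset (Idx T n × Idx T n)) (φ : D → Fˣ)
    (u : unipotentSubgroup P F) : ℂ :=
  ∑ᶠ μ ∈ dualOrbit P (basicForm P D φ), ε (μ (cayley P u))

/-- The class `K_{D,φ}` in `U^a`: the preimage under the Cayley map of the orbit of `X_{D,φ}`. -/
def basicClass (D : Finset (Idx T n × Idx T n)) (φ : D → Fˣ) : Set (unipotentSubgroup P F) :=
  {u | ∃ g : (ContractionAlgebra P F)ˣ,
    (cayley P u : ContractionAlgebra P F) = g * basicElement P D φ * star g.1}

/-! ## The subgroups `H_D` of `L` -/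

/-- The numbers of the segments from `I_k` on to `I_m` in the cyclic order `ℓ, …, -ℓ`, where
`γ ∈ I_k × I_m`: these are `k, …, m` for `k > m`, and `ℓ, …, m` together with `k, …, -ℓ` for
`k < m`. -/
def InArc (γ : Idx T n × Idx T n) (r : ℤ) : Prop :=
  (P.block γ.2 < P.block γ.1 ∧ P.block γ.2 ≤ r ∧ r ≤ P.block γ.1) ∨
  (P.block γ.1 < P.block γ.2 ∧ (P.block γ.2 ≤ r ∨ r ≤ P.block γ.1))

/-- The submatrix of `X` on the segments from `I_k` on to `I_m`, `γ ∈ I_k × I_m`, is scalar. -/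
def IsScalarOnArc (γ : Idx T n × Idx T n) (X : ContractionAlgebra P F) : Prop :=
  ∃ c : F, ∀ i j, InArc P γ (P.block i) → InArc P γ (P.block j) → X i j = if i = j then c else 0

theorem levi_entry {g : ContractionGroup P F} (hg : g ∈ leviSubgroup P F) (i j : Idx T n)
    (h : P.block i ≠ P.block j) : g.1 i j = 0 := by
  obtain ⟨x, rfl⟩ := hg
  exact if_neg h

theorem IsScalarOnArc.mul {γ : Idx T n × Idx T n} {g h : ContractionGroup P F}
    (hL : g ∈ leviSubgroup P F) (hg : IsScalarOnArc P γ g.1) (hh : IsScalarOnArc P γ h.1) :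
    IsScalarOnArc P γ (g * h).1 := by
  obtain ⟨c, hc⟩ := hg
  obtain ⟨d, hd⟩ := hh
  refine ⟨c * d, fun i j hi hj => ?_⟩
  refine (mul_entry P g.1 h.1 i j).trans ?_
  rw [Finset.sum_eq_single i]
  · rw [windCoeff_left, hc i i hi hi, hd i j hi hj]
    simp
  · intro k _ hk
    by_cases hb : P.block i = P.block k
    · rw [hc i k hi (hb ▸ hi), if_neg (Ne.symm hk)]
      simp
    · rw [levi_entry P hL i k hb]
      simp
  · simp

theorem inArc_conjPair {γ : Idx T n × Idx T n} {i : Idx T n} :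
    InArc P (conjPair γ) (P.block i) ↔ InArc P γ (P.block (-i)) := by
  simp only [InArc, conjPair, P.block_neg]
  omega

theorem IsScalarOnArc.star {γ : Idx T n × Idx T n} {X : ContractionAlgebra P F}
    (hX : IsScalarOnArc P γ X) : IsScalarOnArc P (conjPair γ) (star X) := by
  obtain ⟨c, hc⟩ := hX
  refine ⟨c, fun i j hi hj => ?_⟩
  rw [star_entry, hc _ _ ((inArc_conjPair P).1 hj) ((inArc_conjPair P).1 hi)]
  by_cases h : i = j
  · subst h
    simp [sgn_mul_self]
  · simp [h, Ne.symm h]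

theorem conjPair_conjPair (γ : Idx T n × Idx T n) : conjPair (conjPair γ) = γ := by
  simp [conjPair]

variable (F)

/-- The subgroup `H_γ` of `L`. -/
def rootSubgroup (γ : Idx T n × Idx T n) : Subgroup (ContractionGroup P F) where
  carrier := {h | h ∈ leviSubgroup P F ∧ IsScalarOnArc P γ h.1 ∧ IsScalarOnArc P (conjPair γ) h.1}
  mul_mem' := by
    rintro g h ⟨hg, hg1, hg2⟩ ⟨hh, hh1, hh2⟩
    exact ⟨mul_mem hg hh, hg1.mul P hg hh1, hg2.mul P hg hh2⟩
  one_mem' := ⟨one_mem _, ⟨1, fun i j _ _ => Matrix.one_apply⟩, ⟨1, fun i j _ _ => Matrix.one_apply⟩⟩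
  inv_mem' := by
    rintro g ⟨hg, hg1, hg2⟩
    refine ⟨inv_mem hg, ?_, hg1.star P⟩
    have := hg2.star P
    rwa [conjPair_conjPair] at this

/-- The subgroup `H_D` of `L`: the intersection of the subgroups `H_γ`, `γ ∈ D`. -/
def rookSubgroup (D : Finset (Idx T n × Idx T n)) : Subgroup (ContractionGroup P F) :=
  leviSubgroup P F ⊓ ⨅ γ ∈ D, rootSubgroup P F γ

/-- The subgroup `H_D ⋉ U^a` of `G^a`. -/
def semidirectSubgroup (D : Finset (Idx T n × Idx T n)) : Subgroup (ContractionGroup P F) :=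
  (rookSubgroup P F D).comap (leviHom P F)

variable {F}

theorem leviHom_leviHom (g : ContractionGroup P F) : leviHom P F (leviHom P F g) = leviHom P F g := by
  apply Subtype.ext
  ext i j
  change (if P.block i = P.block j then (if P.block i = P.block j then g.1 i j else 0) else 0) =
    if P.block i = P.block j then g.1 i j else 0
  split_ifs <;> rfl

/-- The unipotent component `u` in the decomposition `g = hu`, `h ∈ L`, `u ∈ U^a`. -/
def unipotentPart (g : ContractionGroup P F) : unipotentSubgroup P F :=
  ⟨(leviHom P F g)⁻¹ * g, by
    rw [unipotentSubgroup, MonoidHom.mem_ker, map_mul, map_inv, leviHom_leviHom, inv_mul_cancel]⟩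

/-! ## Supercharacters and superclasses of `G^a` -/

/-- The function `hu ↦ θ(h) σ_{D,φ}(u)` on `H_D ⋉ U^a`. -/
def xi (ε : AddChar F ℂ) (D : Finset (Idx T n × Idx T n)) (φ : D → Fˣ)
    (θ : rookSubgroup P F D → ℂ) : semidirectSubgroup P F D → ℂ := fun g =>
  θ ⟨leviHom P F g.1, g.2⟩ * sigma P ε D φ (unipotentPart P g.1)

/-- The character `σ_a` of `G^a`, for a triple `a = (D, φ, θ)`. -/
def supercharacter [Finite F] (ε : AddChar F ℂ) (D : Finset (Idx T n × Idx T n)) (φ : D → Fˣ)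
    (θ : rookSubgroup P F D → ℂ) : ContractionGroup P F → ℂ :=
  induced (semidirectSubgroup P F D) (xi P ε D φ θ)

/-- The smallest ideal of the Lie algebra `u^a` that is invariant under `X ↦ g X g†` for all units
`g` of the contraction algebra, and modulo which `Ad_h` is the identity. -/
def idealOf (h : ContractionGroup P F) : Submodule F (nilradical P F) :=
  sInf {W | (∀ g : (ContractionAlgebra P F)ˣ, ∀ X ∈ W, act P g X ∈ W) ∧
    (∀ X ∈ W, ∀ Y Z : nilradical P F, Z.1 = Y.1 * X.1 - X.1 * Y.1 → Z ∈ W) ∧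
    (∀ X, act P (Unitary.toUnits h) X - X ∈ W)}

/-- The set `Π_h⁻¹(Π_h(S))`, for the projection `Π_h` of `U^a` to `U^a / U_h^a`, where `U_h^a` is the
preimage of `idealOf h` under the Cayley map. -/
def saturation (h : ContractionGroup P F) (S : Set (unipotentSubgroup P F)) :
    Set (unipotentSubgroup P F) :=
  {u | ∃ v ∈ S, cayley P (v⁻¹ * u) ∈ idealOf P h}

/-- The class `K_b` in `G^a`, for a triple `b = (D, φ, h)`. -/
def superclass (D : Finset (Idx T n × Idx T n)) (φ : D → Fˣ) (h : ContractionGroup P F) :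
    Set (ContractionGroup P F) :=
  {g | ∃ l ∈ leviSubgroup P F, ∃ u ∈ saturation P h (basicClass P D φ),
    g = l * h * l⁻¹ * (u : ContractionGroup P F)}

/-- Only in the orthogonal case: `I_ℓ` does not have exactly two elements (if `ℓ > 0`), nor has `I_1`
if `I_0` is empty. -/
def SymPartition.Admissible (P : SymPartition T n) : Prop :=
  T ≠ ClassicalType.C → (0 < P.len → P.size P.len ≠ 2) ∧ (P.size 0 = 0 → P.size 1 ≠ 2)

end ParabolicContraction

end

/-! The group is `G^a = L ⋉ U^a`, and the Cayley map is a bijection from `U^a` to `u^a` that turns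
conjugation by `G^a` into the linear action `X ↦ g X g†`. The units of the contraction algebra form
a larger group acting on `u^a` and on its dual, and the orbits of this larger group carry the
theory.

Orbit sums are characters up to multiples. A linear form on `u^a` extends to a form `l` on the
algebra with `l(X†) = -l(X)`, so `(v, w) ↦ l(v† w)` is alternating, and it has a left ideal `M` in
the radical that is its own orthogonal complement there (`exists_lagrangian`). Averaging over
translations by `M` writes an orbit sum as a positive combination of linear characters of subgroups
of `U^a`, extended by zero. It is therefore of positive type (`posSemidef_orbitSum`). The orbit sums
are pairwise orthogonal and add up to `|U^a|` times the delta function at `1`, so each of them is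
`|U^a|` times a convolution idempotent (`sum_orbitSum_mul_orbitSum`). The idempotent yields
multiplicative matrices whose trace is `θ(h) σ(u)`, and induction preserves such traces.

The twist by `L` is harmless on the subgroup of `L` acting trivially modulo the annihilator of the
orbit. By `rookSubgroup_eq_orbitFixer` this subgroup is `H_D`; this is where the admissibility of
the partition enters. The induced function is then a product of a function of `h` and an orbit sum
in `u` (`formSupercharacter_apply`). Hence two supercharacters are equal or orthogonal: for
different orbits by Fourier analysis on `u^a`, for the same orbit by the orthogonality of
irreducible characters of its fixer.

The superclasses are the classes of the equivalence relation `IsSuperConj` (`superclass_eq`,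
`exists_mem_superclass`). A function that is constant on them and orthogonal to all supercharacters
has zero Fourier coefficients along every coset of `U^a` (`IsSuperInvariant.eq_zero`), so the
supercharacters form a basis of the functions constant on superclasses, and the two numbers agree by
linear algebra.

That basic pairs meet all orbits, in `u^a` and in its dual, is Gauss elimination for `X ↦ g X g†`
with pivots of minimal arc length in the cyclic order of the blocks (`exists_monomial`), followed by
scaling and by replacing two non-squares in a block by ones. The dual is treated by the trace form.
Uniqueness of the normal form is not needed, because only the sets of functions and of classes are
counted. -/

noncomputable section

namespace ParabolicContraction

/-! ## Characters of finite groups -/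

section CharacterTheory

open Representation Module

universe u

variable {G : Type u} [Group G]

/-- `χ` is the trace of a multiplicative, possibly non-unital, map to square matrices. -/
def IsSemigroupTrace (χ : G → ℂ) : Prop :=
  ∃ (ι : Type u) (_ : Fintype ι) (R : G → Matrix ι ι ℂ),
    (∀ g h, R (g * h) = R g * R h) ∧ ∀ g, χ g = (R g).trace

/-- Since `R 1` is idempotent and absorbs every `R g`, its range carries an honest representation
with the same traces, of dimension `χ 1`. -/
theorem IsSemigroupTrace.isCharacter {χ : G → ℂ} (h : IsSemigroupTrace χ) (h1 : χ 1 ≠ 0) :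
    IsCharacter χ := by
  classical
  obtain ⟨ι, _, R, hR, hχ⟩ := h
  set p : Submodule ℂ (ι → ℂ) := LinearMap.range (R 1).toLin' with hp
  have hmul : ∀ g h v, (R g).toLin' ((R h).toLin' v) = (R (g * h)).toLin' v := by
    intro g h v
    rw [hR, Matrix.toLin'_mul]
    rfl
  have hmem : ∀ g v, (R g).toLin' v ∈ p := fun g v => ⟨(R g).toLin' v, by rw [hmul, one_mul]⟩
  let σ : Representation ℂ G p :=
    { toFun := fun g => (R g).toLin'.restrict (fun v _ => hmem g v)
      map_one' := by
        ext ⟨v, w, rfl⟩ : 2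
        simp [LinearMap.restrict_apply, hmul, -Matrix.toLin'_apply]
      map_mul' := fun g h => by
        ext v : 2
        simp [LinearMap.restrict_apply, hmul, -Matrix.toLin'_apply] }
  have htr : ∀ g, LinearMap.trace ℂ p (σ g) = χ g := by
    intro g
    rw [hχ, ← Matrix.trace_toLin'_eq]
    exact LinearMap.trace_restrict_eq_of_forall_mem p _ (hmem g)
  let e := (Module.finBasis ℂ p).equivFun
  refine ⟨finrank ℂ p, (e.conjAlgEquiv ℂ : _ →* _).comp σ, ?_, ?_⟩
  · rw [Nat.pos_iff_ne_zero]
    intro h0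
    apply h1
    rw [← htr, map_one, LinearMap.trace_one, h0, Nat.cast_zero]
  · ext g
    rw [← htr]
    exact (LinearMap.trace_conj' (σ g) e).symm

open Classical in
-- All of `G`, instead of a set of coset representatives, indexes the blocks. The sum over the
-- middle index then counts every product `Nat.card A` times, which one factor `(Nat.card A)⁻¹`
-- absorbs. Only the unit is lost, and a semigroup trace does not need it.
theorem IsSemigroupTrace.induced [Fintype G] {A : Subgroup G} {ξ : A → ℂ}
    (h : IsSemigroupTrace ξ) : IsSemigroupTrace (induced A ξ) := by
  obtain ⟨ι, _, R, hR, hξ⟩ := h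
  set N : G → Matrix ι ι ℂ := fun g => if hg : g ∈ A then R ⟨g, hg⟩ else 0 with hN
  have hA : (Nat.card A : ℂ) ≠ 0 := Nat.cast_ne_zero.2 Nat.card_pos.ne'
  have hNmul : ∀ g h, g ∈ A → N g * N h = N (g * h) := by
    intro g h hg
    by_cases hh : h ∈ A
    · simp only [hN, dif_pos hg, dif_pos hh, dif_pos (mul_mem hg hh), ← hR]
      rfl
    · simp only [hN, dif_neg hh, Matrix.mul_zero]
      rw [dif_neg fun hm => hh ((Subgroup.mul_mem_cancel_left A hg).1 hm)]
  have hN0 : ∀ g h, g ∉ A → N g * N h = 0 := by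
    intro g h hg
    simp only [hN, dif_neg hg, Matrix.zero_mul]
  refine ⟨G × ι, inferInstance,
    fun g => Matrix.of fun x y => (Nat.card A : ℂ)⁻¹ * N (x.1 * g * y.1⁻¹) x.2 y.2, ?_, ?_⟩
  · intro g h
    ext ⟨x, i⟩ ⟨z, j⟩
    simp only [Matrix.mul_apply, Matrix.of_apply, Fintype.sum_prod_type]
    have key : ∀ y, ∑ k, (Nat.card A : ℂ)⁻¹ * N (x * g * y⁻¹) i k *
        ((Nat.card A : ℂ)⁻¹ * N (y * h * z⁻¹) k j) = (Nat.card A : ℂ)⁻¹ * ((Nat.card A : ℂ)⁻¹ *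
        (if x * g * y⁻¹ ∈ A then N (x * (g * h) * z⁻¹) i j else 0)) := by
      intro y
      have h1 : ∑ k, N (x * g * y⁻¹) i k * N (y * h * z⁻¹) k j =
          if x * g * y⁻¹ ∈ A then N (x * (g * h) * z⁻¹) i j else 0 := by
        rw [← Matrix.mul_apply]
        split_ifs with hy
        · rw [hNmul _ _ hy]
          congr 1
          group
        · rw [hN0 _ _ hy]
          rfl
      rw [← h1, Finset.mul_sum, Finset.mul_sum]
      exact Finset.sum_congr rfl fun k _ => by ring
    rw [Finset.sum_congr rfl fun y _ => key y, ← Finset.mul_sum, ← Finset.mul_sum,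
      ← Finset.sum_filter, Finset.sum_const, nsmul_eq_mul]
    have hcard : (Finset.univ.filter fun y : G => x * g * y⁻¹ ∈ A).card = Nat.card A := by
      rw [Nat.card_eq_fintype_card, Fintype.card_subtype]
      refine Finset.card_bij' (fun y _ => x * g * y⁻¹) (fun a _ => a⁻¹ * (x * g)) ?_ ?_ ?_ ?_
      · intro y hy
        simpa using hy
      · intro a ha
        simpa [mul_assoc] using ha
      · intro y _
        group
      · intro a _
        group
    rw [hcard]
    field_simp
  · intro g
    simp only [ParabolicContraction.induced, Matrix.trace, Matrix.diag, Matrix.of_apply,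
      Fintype.sum_prod_type, Finset.mul_sum]
    refine Finset.sum_congr rfl fun x _ => ?_
    rw [← Finset.mul_sum]
    congr 1
    split_ifs with hx
    · rw [hξ]
      simp only [hN, dif_pos hx]
      rfl
    · simp only [hN, dif_neg hx]
      simp

open scoped ComplexOrder in
-- Averaging a Hermitian form over the group gives an invariant positive definite `H`, and `H`
-- conjugates the adjoint of `M g` into `M g⁻¹`.
theorem star_character [Fintype G] {V : Type*} [AddCommGroup V] [Module ℂ V]
    [FiniteDimensional ℂ V] (ρ : Representation ℂ G V) (g : G) :
    star (ρ.character g) = ρ.character g⁻¹ := by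
  classical
  let b := Module.finBasis ℂ V
  let M : G → Matrix _ _ ℂ := fun g => LinearMap.toMatrix b b (ρ g)
  have hM : ∀ g h, M (g * h) = M g * M h := fun g h => by
    simp only [M, map_mul, LinearMap.toMatrix_mul]
  have hM1 : M 1 = 1 := by simp [M]
  have htr : ∀ g, ρ.character g = (M g).trace := fun g => by
    rw [Representation.character, LinearMap.trace_eq_matrix_trace ℂ b]
  set H := ∑ x : G, (M x).conjTranspose * M x with hH
  have hpos : H.PosDef := by
    rw [hH, ← Finset.add_sum_erase _ _ (Finset.mem_univ (1 : G))]
    refine Matrix.PosDef.add_posSemidef ?_ ?_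
    · rw [hM1]
      simpa using Matrix.PosDef.one
    · exact Matrix.posSemidef_sum _ fun x _ => Matrix.posSemidef_conjTranspose_mul_self _
  have hinv : (M g).conjTranspose * H * M g = H := by
    rw [hH, Finset.mul_sum, Finset.sum_mul]
    refine (Finset.sum_congr rfl fun x _ => ?_).trans
      (Equiv.sum_comp (Equiv.mulRight g) fun x => (M x).conjTranspose * M x)
    rw [Equiv.coe_mulRight, hM, Matrix.conjTranspose_mul]
    simp only [Matrix.mul_assoc]
  have hU := hpos.isUnit
  have h1 : (M g).conjTranspose * H = H * M g⁻¹ := by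
    conv_rhs => rw [← hinv]
    rw [Matrix.mul_assoc, ← hM, mul_inv_cancel, hM1, Matrix.mul_one]
  obtain ⟨K, hK⟩ := hU
  rw [htr, htr, ← Matrix.trace_conjTranspose]
  have h2 : M g⁻¹ = (↑K⁻¹ : Matrix _ _ ℂ) * ((M g).conjTranspose * H) := by
    rw [h1, ← hK, ← Matrix.mul_assoc, Units.inv_mul, Matrix.one_mul]
  rw [h2, Matrix.trace_mul_comm, Matrix.mul_assoc, ← hK, Units.mul_inv, Matrix.mul_one]

theorem charInner_character [Fintype G] {V W : Type*} [AddCommGroup V] [Module ℂ V]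
    [FiniteDimensional ℂ V] [AddCommGroup W] [Module ℂ W] [FiniteDimensional ℂ W]
    (σ : Representation ℂ G W) (ρ : Representation ℂ G V) :
    charInner σ.character ρ.character = finrank ℂ (IntertwiningMap ρ σ) := by
  have : Invertible (Nat.card G : ℂ) := invertibleOfNonzero (Nat.cast_ne_zero.2 Nat.card_pos.ne')
  rw [← card_inv_mul_sum_char_mul_char_eq_finrank, charInner, Nat.card_eq_fintype_card]
  simp only [star_character]

/-- A common constituent `τ` gives nonzero intertwining maps `ρ' → τ → ρ`. The second one is
injective by irreducibility, so the composite is nonzero, whereas orthogonality leaves no nonzero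
map from `ρ'` to `ρ`. -/
theorem disjointCharacters_of_charInner_eq_zero [Fintype G] {χ χ' : G → ℂ} (hχ : IsCharacter χ)
    (hχ' : IsCharacter χ') (h : charInner χ χ' = 0) : DisjointCharacters χ χ' := by
  obtain ⟨n, ρ, -, rfl⟩ := hχ
  obtain ⟨n', ρ', -, rfl⟩ := hχ'
  rintro ψ ⟨m, τ, hτ, rfl⟩
  by_contra hne
  push Not at hne
  obtain ⟨h1, h2⟩ := hne
  have h2' : charInner τ.character ρ'.character ≠ 0 := by
    intro h0
    apply h2
    have := congrArg star h0
    simp only [charInner, star_mul', star_sum, star_zero, star_inv₀, star_natCast, star_star] at this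
    rw [← this, charInner]
    simp only [mul_comm]
  rw [charInner_character] at h h1 h2'
  have hsub : ∀ {x : ℕ}, ((x : ℕ) : ℂ) ≠ 0 → 0 < x := fun hx =>
    Nat.pos_of_ne_zero fun h0 => hx (by rw [h0, Nat.cast_zero])
  have := finrank_pos_iff.1 (hsub h1)
  have := finrank_pos_iff.1 (hsub h2')
  obtain ⟨f, hf⟩ := exists_ne (0 : IntertwiningMap τ ρ)
  obtain ⟨f', hf'⟩ := exists_ne (0 : IntertwiningMap ρ' τ)
  have hinj := (IsIrreducible.injective_or_eq_zero f).resolve_right hf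
  have h0 : finrank ℂ (IntertwiningMap ρ' ρ) = 0 := by exact_mod_cast h
  have := finrank_zero_iff.1 h0
  apply hf'
  refine IntertwiningMap.ext (LinearMap.ext fun v => hinj ?_)
  have := congrArg (fun φ : IntertwiningMap ρ' ρ => φ v) (Subsingleton.elim (f.comp f') 0)
  exact this.trans (map_zero f.toLinearMap).symm

/-- The invariant subspaces correspond under `e`, for which surjectivity of `φ` suffices. This
serves both a change of the space and precomposition with an isomorphism of groups. -/
theorem isIrreducible_transport {H : Type*} [Group H] {V W : Type*} [AddCommGroup V] [Module ℂ V]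
    [AddCommGroup W] [Module ℂ W] {ρ : Representation ℂ G V} {σ : Representation ℂ H W}
    (e : V ≃ₗ[ℂ] W) (φ : H → G) (hφ : Function.Surjective φ)
    (h : ∀ x v, σ x (e v) = e (ρ (φ x) v)) (hρ : ρ.IsIrreducible) : σ.IsIrreducible := by
  let f : Subrepresentation σ ≃o Subrepresentation ρ :=
    { toFun := fun p => ⟨p.toSubmodule.comap e.toLinearMap, fun g v hv => by
        obtain ⟨x, rfl⟩ := hφ g
        change e (ρ (φ x) v) ∈ p.toSubmodule
        rw [← h]
        exact p.apply_mem_toSubmodule x hv⟩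
      invFun := fun q => ⟨q.toSubmodule.comap e.symm.toLinearMap, fun x w hw => by
        change e.symm (σ x w) ∈ q.toSubmodule
        have : e.symm (σ x w) = ρ (φ x) (e.symm w) := by
          rw [LinearEquiv.symm_apply_eq, ← h, LinearEquiv.apply_symm_apply]
        rw [this]
        exact q.apply_mem_toSubmodule _ hw⟩
      left_inv := fun p => Subrepresentation.ext (by ext; simp [Submodule.mem_comap])
      right_inv := fun q => Subrepresentation.ext (by ext; simp)
      map_rel_iff' := by
        intro p q
        constructor
        · intro hpq w hw
          have := hpq (x := e.symm w) (by
            change e (e.symm w) ∈ p.toSubmodule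
            rwa [LinearEquiv.apply_symm_apply])
          change e (e.symm w) ∈ q.toSubmodule at this
          rwa [LinearEquiv.apply_symm_apply] at this
        · intro hpq v hv
          exact hpq hv }
  exact f.isSimpleOrder

theorem isIrreducibleCharacter_character {V : Type*} [AddCommGroup V] [Module ℂ V]
    [FiniteDimensional ℂ V] (ρ : Representation ℂ G V) (hρ : ρ.IsIrreducible) :
    IsIrreducibleCharacter ρ.character := by
  let e := (Module.finBasis ℂ V).equivFun
  refine ⟨finrank ℂ V, (e.conjAlgEquiv ℂ : _ →* _).comp ρ, ?_, ?_⟩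
  · refine isIrreducible_transport e id Function.surjective_id (fun x v => ?_) hρ
    change e (ρ x (e.symm (e v))) = e (ρ x v)
    rw [LinearEquiv.symm_apply_apply]
  · ext g
    exact (LinearMap.trace_conj' (ρ g) e).symm

theorem IsIrreducibleCharacter.comp_mulEquiv {H : Type*} [Group H] {θ : G → ℂ}
    (hθ : IsIrreducibleCharacter θ) (φ : H ≃* G) : IsIrreducibleCharacter (θ ∘ φ) := by
  obtain ⟨n, ρ, hρ, rfl⟩ := hθ
  exact ⟨n, ρ.comp φ.toMonoidHom, isIrreducible_transport (LinearEquiv.refl _ _) φ φ.surjective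
    (fun _ _ => rfl) hρ, rfl⟩

theorem IsIrreducibleCharacter.charInner_eq_zero [Fintype G] {θ θ' : G → ℂ}
    (hθ : IsIrreducibleCharacter θ) (hθ' : IsIrreducibleCharacter θ') (hne : θ ≠ θ') :
    charInner θ θ' = 0 := by
  obtain ⟨n, ρ, hρ, rfl⟩ := hθ
  obtain ⟨n', ρ', hρ', rfl⟩ := hθ'
  rw [charInner_character]
  have : IsEmpty (ρ'.Equiv ρ) := ⟨fun φ => hne (char_iso φ).symm⟩
  have : Subsingleton (IntertwiningMap ρ' ρ) := inferInstance
  simp [finrank_zero_of_subsingleton]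

theorem IsIrreducibleCharacter.one_pos {θ : G → ℂ} (hθ : IsIrreducibleCharacter θ) :
    ∃ m : ℕ, 0 < m ∧ θ 1 = m := by
  obtain ⟨n, ρ, hρ, rfl⟩ := hθ
  refine ⟨n, Nat.pos_of_ne_zero ?_, by simp⟩
  rintro rfl
  have : Subsingleton (Subrepresentation ρ) :=
    ⟨fun p q => Subrepresentation.ext (Subsingleton.elim _ _)⟩
  exact not_subsingleton (Subrepresentation ρ) inferInstance

/-- On an irreducible representation the operator is a scalar by Schur's lemma, and its trace
vanishes by hypothesis. On a reducible one Maschke's theorem splits the space and induction on the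
dimension applies. -/
theorem sum_smul_eq_zero_of_orthogonal [Fintype G] {f : G → ℂ} (hf : ∀ g h, f (h * g * h⁻¹) = f g)
    (horth : ∀ θ : G → ℂ, IsIrreducibleCharacter θ → ∑ g, f g * θ g = 0) :
    ∀ (d : ℕ) (V : Type u) [AddCommGroup V] [Module ℂ V] [FiniteDimensional ℂ V]
      (ρ : Representation ℂ G V), finrank ℂ V = d → ∑ g, f g • ρ g = 0 := by
  intro d
  induction d using Nat.strong_induction_on with
  | _ d ih =>
  intro V _ _ _ ρ hd
  rcases subsingleton_or_nontrivial V with hV | hV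
  · ext v
    exact Subsingleton.elim _ _
  have : NeZero (Nat.card G : ℂ) := ⟨Nat.cast_ne_zero.2 Nat.card_pos.ne'⟩
  by_cases hρ : ρ.IsIrreducible
  · have hint : ∀ h : G, (∑ g, f g • ρ g) ∘ₗ ρ h = ρ h ∘ₗ ∑ g, f g • ρ g := by
      intro h
      ext v
      simp only [LinearMap.comp_apply, LinearMap.sum_apply, LinearMap.smul_apply, map_sum, map_smul]
      refine (Equiv.sum_comp (MulAut.conj h).toEquiv _).symm.trans
        (Finset.sum_congr rfl fun g _ => ?_)
      change f (h * g * h⁻¹) • (ρ (h * g * h⁻¹)) (ρ h v) = _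
      rw [hf, ← Module.End.mul_apply, ← map_mul, ← Module.End.mul_apply, ← map_mul,
        inv_mul_cancel_right]
    let φ : IntertwiningMap ρ ρ := ⟨∑ g, f g • ρ g, hint⟩
    obtain ⟨c, hc⟩ :=
      (IsIrreducible.algebraMap_intertwiningMap_bijective_of_isAlgClosed (ρ := ρ)).2 φ
    have hc' : ∑ g, f g • ρ g = c • LinearMap.id := by
      ext v
      exact (congrArg (fun ψ : IntertwiningMap ρ ρ => ψ v) hc).symm
    have ht := congrArg (LinearMap.trace ℂ V) hc'
    rw [map_sum, map_smul, LinearMap.trace_id] at ht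
    have h0 : ∑ g, f g * ρ.character g = 0 := horth _ (isIrreducibleCharacter_character ρ hρ)
    simp only [map_smul, smul_eq_mul] at ht
    rw [show ∑ x, f x * LinearMap.trace ℂ V (ρ x) = 0 from h0] at ht
    have hfin : (finrank ℂ V : ℂ) ≠ 0 := Nat.cast_ne_zero.2 finrank_pos.ne'
    rcases mul_eq_zero.1 ht.symm with h | h
    · rw [hc', h, zero_smul]
    · exact absurd h hfin
  · have hnt : Nontrivial (Subrepresentation ρ) := by
      refine ⟨⊥, ⊤, fun h => ?_⟩
      obtain ⟨v, hv⟩ := exists_ne (0 : V)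
      have : v ∈ (⊤ : Subrepresentation ρ).toSubmodule := trivial
      rw [← h] at this
      exact hv this
    have hex : ∃ p : Subrepresentation ρ, p ≠ ⊥ ∧ p ≠ ⊤ := by
      by_contra hcon
      push Not at hcon
      exact hρ ⟨fun p => or_iff_not_imp_left.2 (hcon p)⟩
    obtain ⟨p, hp0, hp1⟩ := hex
    obtain ⟨q, hq⟩ := exists_isCompl p
    have hq1 : q ≠ ⊤ := by
      rintro rfl
      exact hp0 (by simpa using hq.inf_eq_bot)
    have hlt : ∀ r : Subrepresentation ρ, r ≠ ⊤ → finrank ℂ r.toSubmodule < d := by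
      intro r hr
      rw [← hd]
      refine Submodule.finrank_lt fun h => hr ?_
      exact Subrepresentation.ext h
    have hzero : ∀ r : Subrepresentation ρ, r ≠ ⊤ → ∀ v ∈ r.toSubmodule,
        (∑ g, f g • ρ g) v = 0 := by
      intro r hr v hv
      have := LinearMap.congr_fun (ih _ (hlt r hr) r.toSubmodule r.toRepresentation rfl) ⟨v, hv⟩
      have := congrArg Subtype.val this
      simpa [LinearMap.sum_apply, Subrepresentation.toRepresentation, LinearMap.restrict_apply]
        using this
    ext v
    have hv : v ∈ (p ⊔ q).toSubmodule := by
      rw [hq.sup_eq_top]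
      trivial
    obtain ⟨a, ha, b, hb, rfl⟩ := Submodule.mem_sup.1 (show v ∈ p.toSubmodule ⊔ q.toSubmodule from hv)
    rw [map_add, hzero p hp1 a ha, hzero q hq1 b hb, add_zero, LinearMap.zero_apply]

/-- The irreducible characters separate class functions. -/
theorem eq_zero_of_orthogonal [Fintype G] {f : G → ℂ} (hf : ∀ g h, f (h * g * h⁻¹) = f g)
    (horth : ∀ θ : G → ℂ, IsIrreducibleCharacter θ → ∑ g, f g * θ g = 0) : f = 0 := by
  classical
  let ρ : Representation ℂ G (G → ℂ) :=
    { toFun := fun g => LinearMap.funLeft ℂ ℂ (fun x => g⁻¹ * x)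
      map_one' := by
        ext
        simp [LinearMap.funLeft_apply]
      map_mul' := fun g h => by
        ext
        simp [LinearMap.funLeft_apply, mul_assoc] }
  have h := sum_smul_eq_zero_of_orthogonal hf horth _ (G → ℂ) ρ rfl
  ext g
  have := congrFun (LinearMap.congr_fun h (Pi.single 1 1)) g
  simp only [LinearMap.sum_apply, LinearMap.smul_apply, Finset.sum_apply, Pi.smul_apply,
    LinearMap.zero_apply, Pi.zero_apply, smul_eq_mul] at this
  rw [Finset.sum_eq_single g] at this
  · simpa [ρ, LinearMap.funLeft_apply] using this
  · intro x _ hx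
    have : x⁻¹ * g ≠ 1 := fun h => hx (by rwa [inv_mul_eq_one] at h)
    simp [ρ, LinearMap.funLeft_apply, this]
  · simp

theorem charInner_self_ne_zero [Fintype G] {χ : G → ℂ} (h : χ ≠ 0) : charInner χ χ ≠ 0 := by
  obtain ⟨g, hg⟩ := Function.ne_iff.1 h
  refine mul_ne_zero (inv_ne_zero (Nat.cast_ne_zero.2 Fintype.card_ne_zero)) ?_
  have : ∑ g, χ g * star (χ g) = ((∑ g, Complex.normSq (χ g) : ℝ) : ℂ) := by
    push_cast
    exact Finset.sum_congr rfl fun x _ => Complex.mul_conj _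
  rw [this, Complex.ofReal_ne_zero]
  refine ne_of_gt (Finset.sum_pos' (fun x _ => Complex.normSq_nonneg _) ⟨g, Finset.mem_univ _, ?_⟩)
  exact Complex.normSq_pos.2 hg

omit [Group G] in
theorem charInner_sum_smul [Fintype G] {ι : Type*} (s : Finset ι) (c : ι → ℂ) (f : ι → G → ℂ)
    (χ : G → ℂ) : charInner (∑ i ∈ s, c i • f i) χ = ∑ i ∈ s, c i * charInner (f i) χ := by
  simp only [charInner, Finset.sum_apply, Pi.smul_apply, smul_eq_mul, Finset.sum_mul,
    Finset.mul_sum]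
  rw [Finset.sum_comm]
  exact Finset.sum_congr rfl fun i _ => Finset.sum_congr rfl fun g _ => by ring

omit [Group G] in
theorem charInner_sub [Fintype G] (χ ψ φ : G → ℂ) :
    charInner (χ - ψ) φ = charInner χ φ - charInner ψ φ := by
  simp only [charInner, Pi.sub_apply, sub_mul, Finset.sum_sub_distrib, mul_sub]

/-- A system of pairwise orthogonal functions that are constant on the parts of a partition and
separate such functions has as many members as the partition. -/
theorem encard_eq_of_orthogonal [Fintype G] {S : Set (G → ℂ)} {K : Set (Set G)}
    (hK : Setoid.IsPartition K) (h0 : ∀ χ ∈ S, χ ≠ 0)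
    (horth : S.Pairwise fun χ χ' => charInner χ χ' = 0)
    (hconst : ∀ χ ∈ S, ∀ k ∈ K, ∀ x ∈ k, ∀ y ∈ k, χ x = χ y)
    (hsep : ∀ ψ : G → ℂ, (∀ k ∈ K, ∀ x ∈ k, ∀ y ∈ k, ψ x = ψ y) →
      (∀ χ ∈ S, charInner ψ χ = 0) → ψ = 0) : S.encard = K.encard := by
  classical
  have hli : LinearIndependent ℂ (Subtype.val : S → G → ℂ) := by
    rw [linearIndependent_iff']
    intro s c hc i hi
    have h1 := charInner_sum_smul s c Subtype.val i.1
    rw [hc, Finset.sum_eq_single i] at h1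
    · have h2 : charInner (0 : G → ℂ) i.1 = 0 := by simp [charInner]
      rw [h2] at h1
      exact (mul_eq_zero.1 h1.symm).resolve_right (charInner_self_ne_zero (h0 i.1 i.2))
    · intro j _ hj
      rw [horth j.2 i.2 (fun h => hj (Subtype.ext h)), mul_zero]
    · exact fun h => absurd hi h
  have hSfin : S.Finite := hli.setFinite
  have hclass : ∀ g : G, ∃ k : K, g ∈ k.1 := fun g => by
    obtain ⟨k, ⟨hk, hg⟩, -⟩ := hK.2 g
    exact ⟨⟨k, hk⟩, hg⟩
  choose cl hcl using hclass
  have hcl_eq : ∀ (k : K) (g : G), g ∈ k.1 → cl g = k := fun k g hg =>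
    Subtype.ext ((hK.2 g).unique ⟨(cl g).2, hcl g⟩ ⟨k.2, hg⟩)
  have hsurj : Function.Surjective cl := by
    intro k
    obtain ⟨g, hg⟩ := Set.nonempty_iff_ne_empty.2 (fun h => hK.1 (h ▸ k.2) : k.1 ≠ ∅)
    exact ⟨g, hcl_eq k g hg⟩
  let Φ : (K → ℂ) →ₗ[ℂ] (G → ℂ) := LinearMap.funLeft ℂ ℂ cl
  have hΦ : Function.Injective Φ := LinearMap.funLeft_injective_of_surjective ℂ ℂ cl hsurj
  -- The range of `Φ` consists of the functions constant on the parts, so its dimension is the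
  -- number of parts.
  have hrange : LinearMap.range Φ = Submodule.span ℂ S := by
    refine le_antisymm ?_ (Submodule.span_le.2 ?_)
    · rintro _ ⟨φ, rfl⟩
      set ψ := Φ φ with hψ
      have : Fintype S := hSfin.fintype
      -- Subtracting the orthogonal projection to the span of `S` leaves a function orthogonal to
      -- `S`, which the separation hypothesis forces to vanish.
      have hz : ψ - ∑ χ : S, (charInner ψ χ.1 / charInner χ.1 χ.1) • χ.1 = 0 := by
        refine hsep _ ?_ ?_
        · intro k hk x hx y hy
          simp only [Pi.sub_apply, Finset.sum_apply, Pi.smul_apply]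
          have hψk : ψ x = ψ y := by
            change φ (cl x) = φ (cl y)
            rw [hcl_eq ⟨k, hk⟩ x hx, hcl_eq ⟨k, hk⟩ y hy]
          rw [hψk]
          congr 1
          exact Finset.sum_congr rfl fun χ _ => by rw [hconst χ.1 χ.2 k hk x hx y hy]
        · intro χ hχ
          rw [charInner_sub, charInner_sum_smul, Finset.sum_eq_single ⟨χ, hχ⟩,
            div_mul_cancel₀ _ (charInner_self_ne_zero (h0 χ hχ)), sub_self]
          · intro χ' _ hne
            rw [horth χ'.2 hχ (fun h => hne (Subtype.ext h)), mul_zero]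
          · exact fun h => absurd (Finset.mem_univ _) h
      rw [sub_eq_zero] at hz
      rw [hz]
      exact Submodule.sum_mem _ fun χ _ => Submodule.smul_mem _ _ (Submodule.subset_span χ.2)
    · intro χ hχ
      choose rep hrep using hsurj
      refine ⟨fun k => χ (rep k), funext fun g => ?_⟩
      change χ (rep (cl g)) = χ g
      refine hconst χ hχ (cl g).1 (cl g).2 _ ?_ _ (hcl g)
      have := hcl (rep (cl g))
      rwa [hrep] at this
  have : Fintype S := hSfin.fintype
  have h1 : finrank ℂ (Submodule.span ℂ S) = Fintype.card S := by
    rw [finrank_span_set_eq_card hli, Set.toFinset_card]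
  have h2 : finrank ℂ (LinearMap.range Φ) = Fintype.card K := by
    rw [LinearMap.finrank_range_of_inj hΦ, finrank_fintype_fun_eq_card]
  rw [hrange, h1] at h2
  rw [Set.encard_eq_coe_toFinset_card, Set.encard_eq_coe_toFinset_card, Set.toFinset_card,
    Set.toFinset_card, h2]

end CharacterTheory

end ParabolicContraction

end

noncomputable section

namespace ParabolicContraction

variable {T : ClassicalType} {n : ℕ} (P : SymPartition T n) {F : Type*} [Field F]

/-! ## Arcs and products in the contraction algebra -/

section Arcs

theorem neg_len_le_block (i : Idx T n) : -(P.len : ℤ) ≤ P.block i := by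
  have := P.block_le (-i)
  rw [P.block_neg] at this
  omega

/-- The number of steps from the segment of `i` on to the segment of `j` in the cyclic order. -/
def arcLength (i j : Idx T n) : ℤ := P.block i - P.block j + wind P i j * (2 * P.len + 1)

theorem arcLength_nonneg (i j : Idx T n) : 0 ≤ arcLength P i j := by
  have h1 := neg_len_le_block P i
  have h2 := P.block_le j
  unfold arcLength wind
  split_ifs <;> push_cast <;> omega

theorem arcLength_lt (i j : Idx T n) : arcLength P i j < 2 * P.len + 1 := by
  have h1 := neg_len_le_block P j
  have h2 := P.block_le i
  unfold arcLength wind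
  split_ifs <;> push_cast <;> omega

theorem arcLength_eq_zero_iff (i j : Idx T n) : arcLength P i j = 0 ↔ P.block i = P.block j := by
  have h1 := neg_len_le_block P i
  have h2 := P.block_le j
  unfold arcLength wind
  split_ifs <;> push_cast <;> omega

theorem arcLength_neg (i j : Idx T n) : arcLength P (-j) (-i) = arcLength P i j := by
  unfold arcLength wind
  rw [P.block_neg, P.block_neg]
  split_ifs <;> push_cast <;> omega

/-- The two sides of the arc equation differ by a multiple of a full turn `2 * P.len + 1`, and
`wind` counts the turns. A term of a product thus survives exactly when the two arcs join without
overrunning. -/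
theorem windCoeff_eq_one_iff (i k j : Idx T n) :
    windCoeff P F i k j = 1 ↔ arcLength P i j = arcLength P i k + arcLength P k j := by
  have h : windCoeff P F i k j = 1 ↔ wind P i k + wind P k j = wind P i j := by
    unfold windCoeff
    split_ifs with h <;> simp [h]
  rw [h]
  clear h
  simp only [arcLength, wind]
  split_ifs <;> push_cast <;> simp only [true_iff, false_iff] <;> omega

theorem windCoeff_eq_zero_or_one (i k j : Idx T n) :
    windCoeff P F i k j = 0 ∨ windCoeff P F i k j = 1 := by
  unfold windCoeff
  split_ifs <;> simp

/-- Of two arcs with a common end the shorter one is contained in the longer one. -/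
theorem windCoeff_eq_one_of_le {a i j : Idx T n} (h : arcLength P i j ≤ arcLength P a j) :
    windCoeff P F a i j = 1 := by
  rw [windCoeff_eq_one_iff]
  have h1 := neg_len_le_block P i
  have h2 := P.block_le i
  have h3 := neg_len_le_block P j
  have h4 := P.block_le j
  have h5 := neg_len_le_block P a
  have h6 := P.block_le a
  revert h
  unfold arcLength wind
  split_ifs <;> push_cast <;> omega

end Arcs

section Entries

variable {P}

theorem add_entry (X Y : ContractionAlgebra P F) (i j : Idx T n) :
    (X + Y) i j = X i j + Y i j := rfl

theorem sub_entry (X Y : ContractionAlgebra P F) (i j : Idx T n) :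
    (X - Y) i j = X i j - Y i j := rfl

theorem smul_entry (c : F) (X : ContractionAlgebra P F) (i j : Idx T n) :
    (c • X) i j = c * X i j := rfl

theorem one_entry (i j : Idx T n) : (1 : ContractionAlgebra P F) i j = if i = j then 1 else 0 := by
  change (1 : Matrix (Idx T n) (Idx T n) F) i j = _
  rw [Matrix.one_apply]

theorem matrixUnit_entry (a b i j : Idx T n) :
    matrixUnit P (F := F) (a, b) i j = if i = a ∧ j = b then 1 else 0 := by
  change Matrix.single a b (1 : F) i j = _
  rw [Matrix.single_apply]
  exact if_congr (by rw [eq_comm, @eq_comm _ b]) rfl rfl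

theorem matrixUnit_mul_entry (a b : Idx T n) (X : ContractionAlgebra P F) (i j : Idx T n) :
    (matrixUnit P (a, b) * X : ContractionAlgebra P F) i j = if i = a then windCoeff P F a b j * X b j else 0 := by
  rw [mul_entry, Finset.sum_eq_single b]
  · rw [matrixUnit_entry]
    split_ifs with h1 h2 h2
    · rw [h2, one_mul]
    · exact absurd h1.1 h2
    · exact absurd ⟨h2, rfl⟩ h1
    · ring
  · intro k _ hk
    rw [matrixUnit_entry, if_neg fun h => hk h.2]
    ring
  · simp

theorem mul_matrixUnit_entry (a b : Idx T n) (X : ContractionAlgebra P F) (i j : Idx T n) :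
    (X * matrixUnit P (a, b) : ContractionAlgebra P F) i j = if j = b then windCoeff P F i a b * X i a else 0 := by
  rw [mul_entry, Finset.sum_eq_single a]
  · rw [matrixUnit_entry]
    split_ifs with h1 h2 h2
    · rw [h2]
      ring
    · exact absurd h1.2 h2
    · exact absurd ⟨rfl, h2⟩ h1
    · ring
  · intro k _ hk
    rw [matrixUnit_entry, if_neg fun h => hk h.1]
    ring
  · simp

theorem star_matrixUnit (a b : Idx T n) :
    star (matrixUnit P (F := F) (a, b)) =
      (sgn F (-a) * sgn F (-b)) • matrixUnit P (-b, -a) := by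
  ext i j
  rw [star_entry, smul_entry, matrixUnit_entry, matrixUnit_entry]
  by_cases h : i = -b ∧ j = -a
  · obtain ⟨rfl, rfl⟩ := h
    simp [mul_comm]
  · rw [if_neg h, if_neg]
    · ring
    · rintro ⟨h1, h2⟩
      exact h ⟨by rw [← h2, neg_neg], by rw [← h1, neg_neg]⟩

theorem nilradical_entry {X : ContractionAlgebra P F} (hX : star X = -X) (i j : Idx T n) :
    X (-j) (-i) = -(sgn F i * sgn F j * X i j) := by
  have h := congrArg (fun Y : ContractionAlgebra P F => Y i j) hX
  change sgn F i * sgn F j * X (-j) (-i) = -X i j at h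
  linear_combination (sgn F i * sgn F j) * h - X (-j) (-i) * sgn F i * sgn F i *
    sgn_mul_self (F := F) j - X (-j) (-i) * sgn_mul_self (F := F) i

end Entries

/-! ## The radical and the Cayley map -/

section Radical

variable (F)

/-- The radical of the contraction algebra: the elements with zero diagonal blocks. -/
def radical : Submodule F (ContractionAlgebra P F) where
  carrier := {X | ∀ i j, P.block i = P.block j → X i j = 0}
  add_mem' hX hY i j h := by rw [add_entry, hX i j h, hY i j h, add_zero]
  zero_mem' _ _ _ := rfl
  smul_mem' c X hX i j h := by rw [smul_entry, hX i j h, mul_zero]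

variable {F} {P}

theorem mul_mem_radical_left {X : ContractionAlgebra P F} (hX : X ∈ radical P F)
    (Y : ContractionAlgebra P F) : X * Y ∈ radical P F :=
  fun i j h => mul_entry_eq_zero_left P hX i j h

theorem mul_mem_radical_right {Y : ContractionAlgebra P F} (X : ContractionAlgebra P F)
    (hY : Y ∈ radical P F) : X * Y ∈ radical P F :=
  fun i j h => mul_entry_eq_zero_right P hY i j h

theorem star_mem_radical {X : ContractionAlgebra P F} (hX : X ∈ radical P F) :
    star X ∈ radical P F := fun i j h => by
  rw [star_entry, hX _ _ (by rw [P.block_neg, P.block_neg, h]), mul_zero]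

/-- Every factor from the radical advances at least one block in the cyclic order. As arcs are
shorter than a full turn, the radical is nil. -/
theorem arcLength_ge_of_pow_entry_ne_zero {X : ContractionAlgebra P F} (hX : X ∈ radical P F) :
    ∀ (k : ℕ) (i j : Idx T n), (X ^ k) i j ≠ 0 → (k : ℤ) ≤ arcLength P i j := by
  intro k
  induction k with
  | zero =>
    intro i j _
    exact_mod_cast arcLength_nonneg P i j
  | succ k ih =>
    intro i j h
    rw [pow_succ, mul_entry] at h
    obtain ⟨m, -, hm⟩ := Finset.exists_ne_zero_of_sum_ne_zero h
    have h1 := ih i m (right_ne_zero_of_mul hm |> left_ne_zero_of_mul)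
    have h2 : arcLength P m j ≠ 0 := fun h0 =>
      (right_ne_zero_of_mul (right_ne_zero_of_mul hm)) (hX m j ((arcLength_eq_zero_iff P m j).1 h0))
    have h3 := arcLength_nonneg P m j
    have h4 : arcLength P i j = arcLength P i m + arcLength P m j :=
      (windCoeff_eq_one_iff P (F := F) _ _ _).1
        ((windCoeff_eq_zero_or_one P _ _ _).resolve_left (left_ne_zero_of_mul hm))
    push_cast
    omega

theorem isNilpotent_of_mem_radical {X : ContractionAlgebra P F} (hX : X ∈ radical P F) :
    IsNilpotent X := by
  refine ⟨2 * P.len + 1, ?_⟩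
  ext i j
  by_contra h
  have h1 := arcLength_ge_of_pow_entry_ne_zero hX _ i j h
  have h2 := arcLength_lt P i j
  push_cast at h1
  omega

theorem isUnit_one_add {X : ContractionAlgebra P F} (hX : X ∈ radical P F) : IsUnit (1 + X) :=
  (isNilpotent_of_mem_radical hX).isUnit_one_add

theorem isUnit_one_sub {X : ContractionAlgebra P F} (hX : X ∈ radical P F) : IsUnit (1 - X) :=
  (isNilpotent_of_mem_radical hX).isUnit_one_sub

theorem isUnit_add_iff {X : ContractionAlgebra P F} (hX : X ∈ radical P F)
    (a : ContractionAlgebra P F) : IsUnit (a + X) ↔ IsUnit a := by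
  have key : ∀ (b Y : ContractionAlgebra P F), Y ∈ radical P F → IsUnit b → IsUnit (b + Y) := by
    rintro _ Y hY ⟨b, rfl⟩
    have : (b : ContractionAlgebra P F) + Y = b * (1 + ↑b⁻¹ * Y) := by
      rw [mul_add, mul_one, Units.mul_inv_cancel_left]
    rw [this]
    exact b.isUnit.mul (isUnit_one_add (mul_mem_radical_right _ hY))
  refine ⟨fun h => ?_, key a X hX⟩
  simpa using key _ _ (Submodule.neg_mem _ hX) h

theorem unipotent_sub_one_mem (u : unipotentSubgroup P F) :
    (u.1.1 - 1 : ContractionAlgebra P F) ∈ radical P F :=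
  fun i j h => unipotent_entry P u i j h

variable (h2 : (2 : F) ≠ 0)

include h2 in
theorem isUnit_two : IsUnit (2 : ContractionAlgebra P F) := by
  have : (2 : ContractionAlgebra P F) = algebraMap F _ 2 := (map_ofNat _ 2).symm
  rw [this]
  exact (IsUnit.mk0 _ h2).map _

end Radical

end ParabolicContraction

end

noncomputable section

namespace ParabolicContraction

variable {T : ClassicalType} {n : ℕ} {P : SymPartition T n} {F : Type*} [Field F]

/-! ### Invariant subspaces of `u^a` and their preimages under the Cayley map. -/

section Cayley

variable (P F) in
/-- The subspaces of `u^a` that are invariant under `X ↦ g X g†` for all units `g`. -/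
structure IsInvariant (V : Submodule F (ContractionAlgebra P F)) : Prop where
  le : V ≤ nilradical P F
  conj_mem : ∀ g : ContractionAlgebra P F, IsUnit g → ∀ X ∈ V, g * X * star g ∈ V

variable (h2 : (2 : F) ≠ 0)

include h2 in
theorem mem_of_two_mul_mem {V : Submodule F (ContractionAlgebra P F)} {X : ContractionAlgebra P F}
    (h : 2 * X ∈ V) : X ∈ V := by
  have : X = (2⁻¹ : F) • (2 * X) := by
    rw [two_mul, ← two_smul F X, smul_smul, inv_mul_cancel₀ h2, one_smul]
  rw [this]
  exact V.smul_mem _ h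

theorem IsInvariant.conj_mem_iff {V : Submodule F (ContractionAlgebra P F)} (hV : IsInvariant P F V)
    {g : ContractionAlgebra P F} (hg : IsUnit g) (X : ContractionAlgebra P F) :
    g * X * star g ∈ V ↔ X ∈ V := by
  refine ⟨fun h => ?_, hV.conj_mem g hg X⟩
  obtain ⟨g, rfl⟩ := hg
  have := hV.conj_mem _ (g⁻¹).isUnit _ h
  have h1 : star (g : ContractionAlgebra P F) * star (↑g⁻¹ : ContractionAlgebra P F) = 1 := by
    rw [← star_mul, Units.inv_mul, star_one]
  rwa [mul_assoc, mul_assoc (_ * X), h1, mul_one, Units.inv_mul_cancel_left] at this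

include h2 in
-- The sum of the conjugates by `1 + y` and `1 - y` isolates the part quadratic in `y`.
theorem IsInvariant.sandwich_mem {V : Submodule F (ContractionAlgebra P F)}
    (hV : IsInvariant P F V) {y X : ContractionAlgebra P F} (hy : IsUnit (1 + y))
    (hy' : IsUnit (1 - y)) (hX : X ∈ V) : y * X * star y ∈ V := by
  refine mem_of_two_mul_mem h2 ?_
  have : 2 * (y * X * star y) = (1 + y) * X * star (1 + y) + (1 - y) * X * star (1 - y) - 2 * X := by
    rw [star_add, star_sub, star_one]
    noncomm_ring
  rw [this, two_mul]
  exact V.sub_mem (V.add_mem (hV.conj_mem _ hy _ hX) (hV.conj_mem _ hy' _ hX)) (V.add_mem hX hX)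

include h2 in
-- The difference of the conjugates by `1 + y` and `1 - y` isolates the part linear in `y`.
theorem IsInvariant.derivation_mem {V : Submodule F (ContractionAlgebra P F)}
    (hV : IsInvariant P F V) {y X : ContractionAlgebra P F} (hy : IsUnit (1 + y))
    (hy' : IsUnit (1 - y)) (hX : X ∈ V) : y * X + X * star y ∈ V := by
  refine mem_of_two_mul_mem h2 ?_
  have : 2 * (y * X + X * star y) = (1 + y) * X * star (1 + y) - (1 - y) * X * star (1 - y) := by
    rw [star_add, star_sub, star_one]
    noncomm_ring
  rw [this]
  exact V.sub_mem (hV.conj_mem _ hy _ hX) (hV.conj_mem _ hy' _ hX)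

include h2 in
/-- An invariant subspace of `u^a` is an ideal. -/
theorem IsInvariant.lie_mem {V : Submodule F (ContractionAlgebra P F)} (hV : IsInvariant P F V)
    {X Y : ContractionAlgebra P F} (hX : X ∈ V) (hY : Y ∈ nilradical P F) : Y * X - X * Y ∈ V := by
  have := hV.derivation_mem h2 (isUnit_one_add hY.2) (isUnit_one_sub hY.2) hX
  rwa [hY.1, mul_neg, ← sub_eq_add_neg] at this

include h2 in
-- The derivation of `y = b * a` applied to `b` equals `2 b a b`, because `(b a)† = a b`.
theorem IsInvariant.mul_mul_mem {V : Submodule F (ContractionAlgebra P F)} (hV : IsInvariant P F V)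
    {a b : ContractionAlgebra P F} (hb : b ∈ V) (ha : a ∈ nilradical P F) : b * a * b ∈ V := by
  refine mem_of_two_mul_mem h2 ?_
  have hba : b * a ∈ radical P F := mul_mem_radical_left (hV.le hb).2 a
  have := hV.derivation_mem h2 (isUnit_one_add hba) (isUnit_one_sub hba) hb
  rw [star_mul, ha.1, (hV.le hb).1] at this
  convert this using 1
  noncomm_ring

/-- Half of the Cayley transform. -/
def halfCayley (u : unipotentSubgroup P F) : ContractionAlgebra P F :=
  (2⁻¹ : F) • (cayley P u).1

theorem halfCayley_mem (u : unipotentSubgroup P F) : halfCayley u ∈ nilradical P F :=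
  Submodule.smul_mem _ _ (cayley P u).2

include h2 in
theorem cayley_eq_two_mul (u : unipotentSubgroup P F) :
    (cayley P u : ContractionAlgebra P F) = 2 * halfCayley u := by
  rw [two_mul, ← two_smul F, halfCayley, smul_smul, mul_inv_cancel₀ h2, one_smul]

include h2 in
theorem isUnit_add_one (u : unipotentSubgroup P F) :
    IsUnit (u.1.1 + 1 : ContractionAlgebra P F) := by
  have h : (u.1.1 + 1 : ContractionAlgebra P F) = 2 + (u.1.1 - 1) := by
    rw [← one_add_one_eq_two]
    abel
  rw [h, isUnit_add_iff (unipotent_sub_one_mem u)]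
  exact isUnit_two h2

include h2 in
theorem halfCayley_mul (u : unipotentSubgroup P F) :
    halfCayley u * (u.1.1 + 1) = u.1.1 - 1 := by
  have h1 := Ring.inverse_mul_cancel _ (isUnit_add_one h2 u)
  have : (cayley P u).1 * (u.1.1 + 1) = 2 * (u.1.1 - 1) := by
    change 2 * (u.1.1 - 1) * Ring.inverse (u.1.1 + 1) * (u.1.1 + 1) = _
    rw [mul_assoc, h1, mul_one]
  rw [halfCayley, smul_mul_assoc, this, two_mul, ← two_smul F, smul_smul, inv_mul_cancel₀ h2,
    one_smul]

include h2 in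
-- With `a = halfCayley u` this is `u = (1 - a)⁻¹ (1 + a)`, the form in which the Cayley map is
-- inverted.
theorem one_sub_halfCayley_mul (u : unipotentSubgroup P F) :
    (1 - halfCayley u) * u.1.1 = 1 + halfCayley u := by
  have h := halfCayley_mul h2 u
  rw [mul_add, mul_one] at h
  rw [sub_mul, one_mul, sub_eq_iff_eq_add]
  rw [eq_comm, add_assoc, add_comm (halfCayley u), h]
  abel

include h2 in
theorem mul_one_sub_halfCayley (u : unipotentSubgroup P F) :
    u.1.1 * (1 - halfCayley u) = 1 + halfCayley u := by
  have h := halfCayley_mul h2 u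
  obtain ⟨w, hw⟩ := isUnit_add_one h2 u
  have hc : (u.1.1 + 1) * halfCayley u = u.1.1 - 1 := by
    have h3 : halfCayley u = (u.1.1 - 1) * ↑w⁻¹ := by
      rw [← h, ← hw, Units.mul_inv_cancel_right]
    have h4 : (u.1.1 + 1) * (u.1.1 - 1) = (u.1.1 - 1) * (u.1.1 + 1) := by noncomm_ring
    rw [h3, ← mul_assoc, h4, ← hw, Units.mul_inv_cancel_right]
  rw [add_mul, one_mul] at hc
  rw [mul_sub, mul_one, sub_eq_iff_eq_add, eq_comm, add_assoc, add_comm (halfCayley u), hc]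
  abel

include h2 in
theorem cayley_injective : Function.Injective (cayley P (F := F)) := by
  intro u v h
  have hh : halfCayley u = halfCayley v := by rw [halfCayley, halfCayley, h]
  have h1 := one_sub_halfCayley_mul h2 u
  rw [hh, ← one_sub_halfCayley_mul h2 v] at h1
  exact Subtype.ext (Subtype.ext ((isUnit_one_sub (halfCayley_mem v).2).mul_left_cancel h1))

theorem mem_unipotentSubgroup_iff (g : ContractionGroup P F) :
    g ∈ unipotentSubgroup P F ↔ g.1 - 1 ∈ radical P F := by
  constructor
  · intro h i j hij
    exact unipotent_entry P ⟨g, h⟩ i j hij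
  · intro h
    refine Subtype.ext ?_
    ext i j
    change (if P.block i = P.block j then g.1 i j else 0) = (1 : ContractionAlgebra P F) i j
    split_ifs with hij
    · exact sub_eq_zero.1 (h i j hij)
    · rw [one_entry, if_neg fun hc => hij (by rw [hc])]

include h2 in
-- The preimage is `(1 - a)⁻¹ (1 + a)` with `a` half of `x`. The involution exchanges the two
-- commuting factors `1 - a` and `1 + a`, so this element is unitary.
theorem cayley_surjective : Function.Surjective (cayley P (F := F)) := by
  intro x
  set a : ContractionAlgebra P F := (2⁻¹ : F) • x.1 with ha
  have ham : a ∈ nilradical P F := Submodule.smul_mem _ _ x.2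
  obtain ⟨p, hp⟩ := isUnit_one_sub ham.2
  obtain ⟨q, hq⟩ := isUnit_one_add ham.2
  have hcomm : p * q = q * p := by
    ext1
    rw [Units.val_mul, Units.val_mul, hp, hq]
    noncomm_ring
  have hsp : star (p : ContractionAlgebra P F) = q := by
    rw [hp, hq, star_sub, star_one, ham.1, sub_neg_eq_add]
  have hsq : star (q : ContractionAlgebra P F) = p := by rw [← hsp, star_star]
  have hspi : star p = q := Units.ext hsp
  have hsqi : star q = p := Units.ext hsq
  have hstar : star (p⁻¹ * q) = (p⁻¹ * q)⁻¹ := by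
    rw [star_mul, star_inv, hspi, hsqi, mul_inv_rev, inv_inv]
    rw [eq_inv_mul_iff_mul_eq, ← mul_assoc, ← hcomm, mul_inv_cancel_right]
  set w : (ContractionAlgebra P F)ˣ := p⁻¹ * q with hw
  have hwu : (w : ContractionAlgebra P F) ∈ unitary (ContractionAlgebra P F) := by
    have hs : star (w : ContractionAlgebra P F) = ↑w⁻¹ := congrArg Units.val hstar
    rw [Unitary.mem_iff, hs]
    exact ⟨w.inv_mul, w.mul_inv⟩
  have hpw : (1 - a) * (w : ContractionAlgebra P F) = 1 + a := by
    rw [← hp, ← hq, hw, Units.val_mul, Units.mul_inv_cancel_left]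
  have hmem : (⟨w, hwu⟩ : ContractionGroup P F) ∈ unipotentSubgroup P F := by
    rw [mem_unipotentSubgroup_iff]
    have h3 : (w : ContractionAlgebra P F) - 1 = ↑p⁻¹ * (2 * a) := by
      have : (2 * a : ContractionAlgebra P F) = p * ((w : ContractionAlgebra P F) - 1) := by
        rw [mul_sub, hp, hpw, mul_one]
        noncomm_ring
      rw [this, Units.inv_mul_cancel_left]
    rw [h3]
    exact mul_mem_radical_right _ (mul_mem_radical_right _ ham.2)
  refine ⟨⟨⟨w, hwu⟩, hmem⟩, Subtype.ext ?_⟩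
  set u : unipotentSubgroup P F := ⟨⟨w, hwu⟩, hmem⟩ with hu
  have h4 := halfCayley_mul h2 u
  have h5 : a * (u.1.1 + 1) = u.1.1 - 1 := by
    have : (1 - a) * u.1.1 = 1 + a := hpw
    rw [sub_mul, one_mul, sub_eq_iff_eq_add] at this
    rw [mul_add, mul_one, eq_sub_iff_add_eq, eq_comm]
    exact this.trans (by abel)
  have h6 : halfCayley u = a := (isUnit_add_one h2 u).mul_right_cancel (h4.trans h5.symm)
  rw [cayley_eq_two_mul h2, h6, ha, two_mul, ← two_smul F, smul_smul, mul_inv_cancel₀ h2, one_smul]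

include h2 in
theorem cayley_bijective : Function.Bijective (cayley P (F := F)) :=
  ⟨cayley_injective h2, cayley_surjective h2⟩

include h2 in
-- Conjugation by `1 + b a`, whose image under the involution is `1 + a b = s⁻¹`, carries `b s` to
-- `b + b a b`.
theorem mul_star_cayley_mem {V : Submodule F (ContractionAlgebra P F)} (hV : IsInvariant P F V)
    {a b s : ContractionAlgebra P F} (ha : a ∈ nilradical P F) (hb : b ∈ V)
    (hs : s * (1 + a * b) = 1) : b * s ∈ V := by
  have hbn := hV.le hb
  have hu : IsUnit (1 + b * a) := isUnit_one_add (mul_mem_radical_left hbn.2 a)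
  have hstar : star (1 + b * a) = 1 + a * b := by
    rw [star_add, star_one, star_mul, ha.1, hbn.1, neg_mul_neg]
  rw [← hV.conj_mem_iff hu, hstar, mul_assoc, mul_assoc b, hs, mul_one, add_mul, one_mul]
  exact V.add_mem hb (hV.mul_mul_mem h2 hb ha)

include h2 in
-- If `a`, `b`, `c` are half the Cayley transforms of `u`, `k`, `u k`, then `(1 - a)(c - a)(1 + a) =
-- (1 - a²) b (1 + a b)⁻¹ (1 - a²)`, and both sides are conjugates in the sense of the action on
-- `u^a`. Multiplicative cosets of the preimage of an invariant subspace therefore correspond to its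
-- additive cosets.
theorem cayley_mul_sub_mem_iff {V : Submodule F (ContractionAlgebra P F)} (hV : IsInvariant P F V)
    (u k : unipotentSubgroup P F) :
    (cayley P (u * k)).1 - (cayley P u).1 ∈ V ↔ (cayley P k).1 ∈ V := by
  have htwo : ∀ X : ContractionAlgebra P F, 2 * X ∈ V ↔ X ∈ V := fun X =>
    ⟨mem_of_two_mul_mem h2, fun h => by rw [two_mul]; exact V.add_mem h h⟩
  rw [cayley_eq_two_mul h2, cayley_eq_two_mul h2, cayley_eq_two_mul h2, ← mul_sub, htwo, htwo]
  set a := halfCayley u with ha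
  set b := halfCayley k with hb
  set c := halfCayley (u * k) with hc
  have ham : a ∈ nilradical P F := halfCayley_mem u
  have hbm : b ∈ nilradical P F := halfCayley_mem k
  obtain ⟨p, hp⟩ := isUnit_one_sub ham.2
  obtain ⟨q, hq⟩ := isUnit_one_sub hbm.2
  obtain ⟨t, ht⟩ := isUnit_one_add (mul_mem_radical_left ham.2 b)
  set s : ContractionAlgebra P F := ↑t⁻¹ with hs
  have hs1 : (1 + a * b) * s = 1 := by rw [← ht, hs, Units.mul_inv]
  have hs2 : s * (1 + a * b) = 1 := by rw [← ht, hs, Units.inv_mul]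
  have hcs : 1 - c = q * s * p := by
    have h1 : (1 - c) * ((u * k).1.1 + 1) = 2 := by
      rw [sub_mul, halfCayley_mul h2, one_mul, ← one_add_one_eq_two]
      abel
    -- The identity `(1 + a)(1 + b) + (1 - a)(1 - b) = 2 (1 + a b)` inverts `u k + 1`.
    have h3 : (p : ContractionAlgebra P F) * ((u * k).1.1 + 1) * q = 2 * (1 + a * b) := by
      have h4 : (p : ContractionAlgebra P F) * u.1.1 = 1 + a := by
        rw [hp, one_sub_halfCayley_mul h2]
      have h5 : k.1.1 * (q : ContractionAlgebra P F) = 1 + b := by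
        rw [hq, mul_one_sub_halfCayley h2]
      calc (p : ContractionAlgebra P F) * ((u * k).1.1 + 1) * q
          = (p * u.1.1) * (k.1.1 * q) + p * q := by
            change (p : ContractionAlgebra P F) * (u.1.1 * k.1.1 + 1) * q = _
            noncomm_ring
        _ = 2 * (1 + a * b) := by
            rw [h4, h5, hp, hq]
            noncomm_ring
    have h6 : ((u * k).1.1 + 1) = ↑p⁻¹ * (2 * (1 + a * b)) * (↑q⁻¹ : ContractionAlgebra P F) := by
      rw [← h3, mul_assoc (p : ContractionAlgebra P F), Units.inv_mul_cancel_left,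
        Units.mul_inv_cancel_right]
    rw [h6] at h1
    have h7 : (1 - c) * ↑p⁻¹ * (1 + a * b) * (↑q⁻¹ : ContractionAlgebra P F) = 1 := by
      refine (isUnit_two h2).mul_left_cancel ?_
      refine Eq.trans ?_ (h1.trans (mul_one _).symm)
      noncomm_ring
    have h8 : (1 - c) * ↑p⁻¹ * (1 + a * b) = (q : ContractionAlgebra P F) := by
      have := congrArg (· * (q : ContractionAlgebra P F)) h7
      simpa only [Units.inv_mul_cancel_right, one_mul] using this
    rw [← h8, mul_assoc _ (1 + a * b), hs1, mul_one, Units.inv_mul_cancel_right]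
  have hps : star (p : ContractionAlgebra P F) = 1 + a := by
    rw [hp, star_sub, star_one, ham.1, sub_neg_eq_add]
  have hr : IsUnit ((1 - a) * (1 + a)) := (isUnit_one_sub ham.2).mul (isUnit_one_add ham.2)
  have hrs : star ((1 - a) * (1 + a)) = (1 - a) * (1 + a) := by
    rw [star_mul, star_add, star_sub, star_one, ham.1]
    noncomm_ring
  have key : p * (c - a) * star (p : ContractionAlgebra P F) =
      (1 - a) * (1 + a) * (b * s) * star ((1 - a) * (1 + a)) := by
    have hc' : c = 1 - (1 - b) * s * (1 - a) := by
      rw [← hp, ← hq, ← hcs]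
      abel
    rw [hps, hrs, hp, hc', ← sub_eq_zero]
    have : (1 - a) * (1 - (1 - b) * s * (1 - a) - a) * (1 + a) -
        (1 - a) * (1 + a) * (b * s) * ((1 - a) * (1 + a)) =
        (1 - a) * (1 - (1 + a * b) * s) * ((1 - a) * (1 + a)) := by noncomm_ring
    rw [this, hs1, sub_self, mul_zero, zero_mul]
  rw [← hV.conj_mem_iff p.isUnit, key, hV.conj_mem_iff hr]
  refine ⟨fun h => ?_, fun h => mul_star_cayley_mem h2 hV ham h hs2⟩
  -- The converse is the same lemma with `-a` and `b s` in place of `a` and `b`: the inverse of `1 -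
  -- a b s = s` is `1 + a b`.
  have h9 : 1 + -a * (b * s) = s := by
    have : (1 + -a * (b * s)) - s = 1 - (1 + a * b) * s := by noncomm_ring
    rw [← sub_eq_zero, this, hs1, sub_self]
  have := mul_star_cayley_mem h2 hV (Submodule.neg_mem _ ham) h (s := 1 + a * b)
    (by rw [h9, hs1])
  rwa [mul_assoc, hs2, mul_one] at this

/-- The Cayley map is equivariant under conjugation. -/
theorem cayley_conj (g : ContractionGroup P F) (u v : unipotentSubgroup P F)
    (h : (v : ContractionGroup P F) = g * u * g⁻¹) (h2 : (2 : F) ≠ 0) :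
    (cayley P v).1 = g.1 * (cayley P u).1 * star g.1 := by
  have hg : star g.1 * g.1 = 1 := Unitary.star_mul_self_of_mem g.2
  have hg' : g.1 * star g.1 = 1 := Unitary.mul_star_self_of_mem g.2
  have hv : v.1.1 = g.1 * u.1.1 * star g.1 := congrArg Subtype.val h
  have h3 : halfCayley v = g.1 * halfCayley u * star g.1 := by
    refine (isUnit_add_one h2 v).mul_right_cancel ?_
    rw [halfCayley_mul h2]
    calc v.1.1 - 1 = g.1 * (u.1.1 - 1) * star g.1 := by
          rw [hv, mul_sub, sub_mul, mul_one, hg']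
      _ = g.1 * (halfCayley u * (u.1.1 + 1)) * star g.1 := by rw [halfCayley_mul h2]
      _ = g.1 * halfCayley u * (star g.1 * g.1) * u.1.1 * star g.1 +
          g.1 * halfCayley u * star g.1 := by
          rw [hg, mul_one]
          noncomm_ring
      _ = g.1 * halfCayley u * star g.1 * (v.1.1 + 1) := by
          rw [hv]
          noncomm_ring
  rw [cayley_eq_two_mul h2, cayley_eq_two_mul h2, h3]
  noncomm_ring

end Cayley

end ParabolicContraction

end

noncomputable section

namespace ParabolicContraction

/-! ### Functions of positive type on a finite group. -/

section PositiveDefinite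

variable {U : Type*} [Group U] [Fintype U]

open scoped ComplexOrder in
/-- A linear character of a subgroup, extended by zero, is of positive type. -/
theorem posSemidef_of_linearCharacter (H : Subgroup U) {k : U → ℂ} (h0 : ∀ u, u ∉ H → k u = 0)
    (hmul : ∀ u ∈ H, ∀ v ∈ H, k (u * v) = k u * k v) (hinv : ∀ u ∈ H, k u⁻¹ = star (k u)) :
    (Matrix.of fun u v : U => k (u⁻¹ * v)).PosSemidef := by
  classical
  set K : Matrix U U ℂ := Matrix.of fun u v : U => k (u⁻¹ * v) with hK
  have hcard : (Nat.card H : ℂ) ≠ 0 := Nat.cast_ne_zero.2 Nat.card_pos.ne'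
  -- A linear character of `H` is `|H|` times a Hermitian convolution idempotent, which exhibits `K`
  -- as a Gram matrix.
  have hKK : K = (Nat.card H : ℂ)⁻¹ • (K * K.conjTranspose) := by
    ext u v
    rw [Matrix.smul_apply, Matrix.mul_apply, smul_eq_mul]
    have hterm : ∀ w, K u w * K.conjTranspose w v =
        if u⁻¹ * w ∈ H then k (u⁻¹ * v) else 0 := by
      intro w
      rw [Matrix.conjTranspose_apply, hK, Matrix.of_apply, Matrix.of_apply]
      split_ifs with hw
      · by_cases hv : v⁻¹ * w ∈ H
        · rw [← hinv _ hv, ← hmul _ hw _ (inv_mem hv)]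
          congr 1
          group
        · rw [h0 _ hv, star_zero, mul_zero, h0]
          intro huv
          apply hv
          have := mul_mem (inv_mem huv) hw
          rwa [mul_inv_rev, inv_inv, mul_assoc, mul_inv_cancel_left] at this
      · rw [h0 _ hw, zero_mul]
    rw [Finset.sum_congr rfl fun w _ => hterm w, ← Finset.sum_filter, Finset.sum_const,
      nsmul_eq_mul]
    have hc : (Finset.univ.filter fun w : U => u⁻¹ * w ∈ H).card = Nat.card H := by
      rw [Nat.card_eq_fintype_card, Fintype.card_subtype]
      refine Finset.card_bij' (fun y _ => u⁻¹ * y) (fun a _ => u * a) ?_ ?_ ?_ ?_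
      · intro y hy
        simpa using hy
      · intro a ha
        simpa using ha
      · intro y _
        group
      · intro a _
        group
    rw [hc, inv_mul_cancel_left₀ hcard]
    rfl
  rw [hKK]
  refine (Matrix.posSemidef_self_mul_conjTranspose K).smul ?_
  rw [inv_nonneg]
  exact_mod_cast Nat.zero_le _

omit [Group U] in
open scoped ComplexOrder MatrixOrder Matrix.Norms.L2Operator in
-- With `A = B* B` and `C = D* D` the trace of `A C` is the squared norm of `B D*`.
theorem mul_eq_zero_of_trace_eq_zero {A C : Matrix U U ℂ} (hA : A.PosSemidef) (hC : C.PosSemidef)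
    (h : (A * C).trace = 0) : A * C = 0 := by
  classical
  obtain ⟨B, rfl⟩ := CStarAlgebra.nonneg_iff_eq_star_mul_self.mp hA.nonneg
  obtain ⟨D, rfl⟩ := CStarAlgebra.nonneg_iff_eq_star_mul_self.mp hC.nonneg
  rw [Matrix.star_eq_conjTranspose, Matrix.star_eq_conjTranspose] at *
  have h1 : B * D.conjTranspose = 0 := by
    rw [← Matrix.trace_conjTranspose_mul_self_eq_zero_iff, ← h, Matrix.conjTranspose_mul,
      Matrix.conjTranspose_conjTranspose, Matrix.mul_assoc, ← Matrix.trace_mul_comm]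
    simp only [Matrix.mul_assoc]
  have h2 : B.conjTranspose * B * (D.conjTranspose * D) =
      B.conjTranspose * (B * D.conjTranspose) * D := by simp only [Matrix.mul_assoc]
  rw [h2, h1, Matrix.mul_zero, Matrix.zero_mul]

open scoped ComplexOrder in
/-- Pairwise orthogonal functions of positive type adding up to a multiple of the delta function are
multiples of convolution idempotents. -/
theorem sum_mul_eq_of_posSemidef {ι : Type*} [Fintype ι] {f : ι → U → ℂ} {N : ℂ}
    (hpos : ∀ i, (Matrix.of fun u v : U => f i (u⁻¹ * v)).PosSemidef)
    (hone : ∑ i, f i 1 = N) (hsum : ∀ u, u ≠ 1 → ∑ i, f i u = 0)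
    (horth : ∀ i j, i ≠ j → ∑ u, f i u * star (f j u) = 0) (i : ι) (x z : U) :
    ∑ y, f i (x⁻¹ * y) * f i (y⁻¹ * z) = N * f i (x⁻¹ * z) := by
  classical
  set M : ι → Matrix U U ℂ := fun i => Matrix.of fun u v : U => f i (u⁻¹ * v) with hM
  -- All diagonal entries of `M i * M j` are the Hermitian product of `f i` and `f j`, which is
  -- zero. Multiplying the identity `∑ M j = N` by `M i` then gives the claim.
  have hzero : ∀ j, i ≠ j → M i * M j = 0 := by
    intro j hij
    refine mul_eq_zero_of_trace_eq_zero (hpos i) (hpos j) ?_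
    rw [Matrix.trace]
    refine Finset.sum_eq_zero fun u _ => ?_
    rw [Matrix.diag_apply, Matrix.mul_apply, ← horth i j hij]
    refine (Equiv.sum_comp (Equiv.mulLeft u⁻¹) fun w => f i w * star (f j w)).symm.trans ?_ |>.symm
    refine Finset.sum_congr rfl fun v _ => ?_
    have h := congrFun (congrFun (hpos j).1 v) u
    rw [Matrix.conjTranspose_apply] at h
    exact congrArg (f i (u⁻¹ * v) * ·) h
  have hid : ∑ j, M j = N • (1 : Matrix U U ℂ) := by
    ext u v
    rw [Matrix.sum_apply, Matrix.smul_apply, Matrix.one_apply]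
    simp only [hM, Matrix.of_apply]
    split_ifs with huv
    · subst huv
      simp [hone]
    · rw [hsum _ fun h => huv (inv_mul_eq_one.1 h), smul_zero]
  have h : M i * M i = N • M i := by
    have h1 : M i * ∑ j, M j = M i * M i := by
      rw [Finset.mul_sum, Finset.sum_eq_single i]
      · exact fun j _ hj => hzero j (Ne.symm hj)
      · exact fun h => absurd (Finset.mem_univ _) h
    rw [← h1, hid, Matrix.mul_smul, Matrix.mul_one]
  have := congrFun (congrFun h x) z
  rwa [Matrix.mul_apply] at this

end PositiveDefinite

/-! ### Sums of additive characters over a space and over its dual. -/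

section FourierSums

variable {F : Type*} [Field F] [Finite F] {ε : AddChar F ℂ} (hε : ε ≠ 1)

omit [Finite F] in
include hε in
open Classical in
theorem sum_addChar_linear {M : Type*} [AddCommGroup M] [Module F M] [Fintype M]
    (l : Module.Dual F M) : ∑ x, ε (l x) = if l = 0 then (Fintype.card M : ℂ) else 0 := by
  split_ifs with h
  · simp [h]
  · obtain ⟨c, hc⟩ := AddChar.ne_one_iff.1 hε
    have hl : ∃ x, l x ≠ 0 := by
      by_contra hcon
      push Not at hcon
      exact h (LinearMap.ext hcon)
    obtain ⟨x, hx⟩ := hl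
    have hy : l ((c / l x) • x) = c := by
      rw [map_smul, smul_eq_mul, div_mul_cancel₀ _ hx]
    set y := (c / l x) • x
    have h1 : ∑ x, ε (l x) = ε c * ∑ x, ε (l x) := by
      rw [Finset.mul_sum, ← Equiv.sum_comp (Equiv.addLeft y)]
      refine Finset.sum_congr rfl fun x _ => ?_
      rw [Equiv.coe_addLeft, map_add, AddChar.map_add_eq_mul, hy]
    have h2 : (1 - ε c) * ∑ x, ε (l x) = 0 := by
      rw [sub_mul, one_mul, ← h1, sub_self]
    exact (mul_eq_zero.1 h2).resolve_left (sub_ne_zero.2 (Ne.symm hc))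

omit [Finite F] in
include hε in
open Classical in
theorem sum_addChar_dual {M : Type*} [AddCommGroup M] [Module F M] [Fintype (Module.Dual F M)]
    (x : M) :
    ∑ l : Module.Dual F M, ε (l x) =
      if x = 0 then (Fintype.card (Module.Dual F M) : ℂ) else 0 := by
  have h := sum_addChar_linear hε (Module.Dual.eval F M x)
  simp only [Module.Dual.eval_apply] at h
  rw [h]
  refine if_congr ?_ rfl rfl
  rw [← Module.forall_dual_apply_eq_zero_iff F x]
  exact ⟨fun h l => LinearMap.congr_fun h l, fun h => LinearMap.ext h⟩

theorem star_addChar (ε : AddChar F ℂ) (x : F) : star (ε x) = ε (-x) :=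
  (AddChar.map_neg_eq_conj ε x).symm

end FourierSums

variable {T : ClassicalType} {n : ℕ} {P : SymPartition T n} {F : Type*} [Field F]

/-! ## Lagrangian left ideals -/

section Lagrangian

variable [Finite F]

/-- A maximal isotropic left ideal in the radical is its own orthogonal complement. -/
theorem exists_lagrangian (l : Module.Dual F (ContractionAlgebra P F))
    (hl : ∀ X, l (star X) = -l X) (h2 : (2 : F) ≠ 0) :
    ∃ M : Submodule F (ContractionAlgebra P F), M ≤ radical P F ∧
      (∀ y ∈ radical P F, ∀ m ∈ M, y * m ∈ M) ∧ (∀ m ∈ M, ∀ m' ∈ M, l (star m * m') = 0) ∧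
      ∀ w ∈ radical P F, (∀ m ∈ M, l (star m * w) = 0) → w ∈ M := by
  set S : Set (Submodule F (ContractionAlgebra P F)) := {M | M ≤ radical P F ∧
      (∀ y ∈ radical P F, ∀ m ∈ M, y * m ∈ M) ∧ (∀ m ∈ M, ∀ m' ∈ M, l (star m * m') = 0)} with hS
  have hbot : (⊥ : Submodule F (ContractionAlgebra P F)) ∈ S := by
    refine ⟨bot_le, ?_, ?_⟩
    · rintro y - m hm
      rw [(Submodule.mem_bot F).1 hm, mul_zero]
      exact Submodule.zero_mem _
    · rintro m - m' hm'
      rw [(Submodule.mem_bot F).1 hm', mul_zero, map_zero]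
  obtain ⟨M, hM⟩ := (Set.toFinite S).exists_maximal ⟨⊥, hbot⟩
  obtain ⟨hMJ, hMl, hMi⟩ := hM.1
  refine ⟨M, hMJ, hMl, hMi, ?_⟩
  have hsymm : ∀ v w, l (star v * w) = 0 → l (star w * v) = 0 := by
    intro v w h
    have := hl (star v * w)
    rwa [star_mul, star_star, h, neg_zero] at this
  -- The form `(v, w) ↦ l (star v * w)` is alternating, so adding one vector orthogonal to `M` keeps
  -- `M` isotropic.
  have halt : ∀ v, l (star v * v) = 0 := by
    intro v
    have := hl (star v * v)
    rw [star_mul, star_star] at this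
    have h3 : (2 : F) * l (star v * v) = 0 := by linear_combination this
    exact (mul_eq_zero.1 h3).resolve_left h2
  have hstable : ∀ y ∈ radical P F, ∀ w, (∀ m ∈ M, l (star m * w) = 0) →
      ∀ m ∈ M, l (star m * (y * w)) = 0 := by
    intro y hy w hw m hm
    have := hw _ (hMl _ (star_mem_radical hy) m hm)
    rwa [star_mul, star_star, mul_assoc] at this
  -- A vector orthogonal to `M` that the radical multiplies into `M` can be adjoined to `M`, so by
  -- maximality it already lies there.
  have hext : ∀ w ∈ radical P F, (∀ m ∈ M, l (star m * w) = 0) →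
      (∀ y ∈ radical P F, y * w ∈ M) → w ∈ M := by
    intro w hwJ hw hyw
    have hmem : M ⊔ Submodule.span F {w} ∈ S := by
      refine ⟨sup_le hMJ ((Submodule.span_singleton_le_iff_mem _ _).2 hwJ), ?_, ?_⟩
      · intro y hy m hm
        obtain ⟨a, ha, b, hb, rfl⟩ := Submodule.mem_sup.1 hm
        obtain ⟨c, rfl⟩ := Submodule.mem_span_singleton.1 hb
        rw [mul_add, mul_smul_comm]
        exact Submodule.mem_sup_left (M.add_mem (hMl y hy a ha) (M.smul_mem c (hyw y hy)))
      · intro m hm m' hm'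
        obtain ⟨a, ha, b, hb, rfl⟩ := Submodule.mem_sup.1 hm
        obtain ⟨c, rfl⟩ := Submodule.mem_span_singleton.1 hb
        obtain ⟨a', ha', b', hb', rfl⟩ := Submodule.mem_sup.1 hm'
        obtain ⟨c', rfl⟩ := Submodule.mem_span_singleton.1 hb'
        rw [star_add, star_smul_entry, mul_add, add_mul, add_mul]
        simp only [smul_mul_assoc, mul_smul_comm, map_add, map_smul, hMi a ha a' ha', hw a ha,
          hsymm _ _ (hw a' ha'), halt, smul_zero, add_zero]
    exact hM.2 hmem le_sup_left (Submodule.mem_sup_right (Submodule.mem_span_singleton_self w))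
  intro w hwJ hw
  by_contra hwM
  -- A vector in the orthogonal complement but outside `M` can be multiplied by the radical again
  -- and again without entering `M`. The arc lengths of its entries grow beyond the maximum, so it
  -- becomes zero, which is absurd.
  have hchain : ∀ k : ℕ, ∃ v ∈ radical P F, (∀ m ∈ M, l (star m * v) = 0) ∧ v ∉ M ∧
      ∀ i j, v i j ≠ 0 → (k : ℤ) ≤ arcLength P i j := by
    intro k
    induction k with
    | zero => exact ⟨w, hwJ, hw, hwM, fun i j _ => by exact_mod_cast arcLength_nonneg P i j⟩
    | succ k ih =>
      obtain ⟨v, hvJ, hv, hvM, hvk⟩ := ih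
      have : ∃ y ∈ radical P F, y * v ∉ M := by
        by_contra hcon
        push Not at hcon
        exact hvM (hext v hvJ hv hcon)
      obtain ⟨y, hy, hyv⟩ := this
      refine ⟨y * v, mul_mem_radical_left hy v, hstable y hy v hv, hyv, fun i j hij => ?_⟩
      rw [mul_entry] at hij
      obtain ⟨m, -, hm⟩ := Finset.exists_ne_zero_of_sum_ne_zero hij
      have h1 := hvk m j (right_ne_zero_of_mul (right_ne_zero_of_mul hm))
      have h3 : arcLength P i m ≠ 0 := fun h0 => (left_ne_zero_of_mul (right_ne_zero_of_mul hm))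
        (hy i m ((arcLength_eq_zero_iff P i m).1 h0))
      have h4 := arcLength_nonneg P i m
      have h5 : arcLength P i j = arcLength P i m + arcLength P m j :=
        (windCoeff_eq_one_iff P (F := F) _ _ _).1
          ((windCoeff_eq_zero_or_one P _ _ _).resolve_left (left_ne_zero_of_mul hm))
      push_cast
      omega
  obtain ⟨v, -, -, hvM, hv⟩ := hchain (2 * P.len + 1)
  apply hvM
  have : v = 0 := by
    ext i j
    by_contra h
    have h1 := hv i j h
    have h3 := arcLength_lt P i j
    push_cast at h1
    omega
  rw [this]
  exact M.zero_mem

end Lagrangian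

end ParabolicContraction

end

noncomputable section

namespace ParabolicContraction

variable {T : ClassicalType} {n : ℕ} {P : SymPartition T n} {F : Type*} [Field F]

/-! ## Orbit sums -/

section Orbits

theorem act_mul (g h : (ContractionAlgebra P F)ˣ) (X : nilradical P F) :
    act P (g * h) X = act P g (act P h X) := by
  refine Subtype.ext ?_
  change (g * h : (ContractionAlgebra P F)ˣ).1 * X.1 * star (g * h : (ContractionAlgebra P F)ˣ).1 =
    g.1 * (h.1 * X.1 * star h.1) * star g.1
  rw [Units.val_mul, star_mul]
  simp only [mul_assoc]

theorem act_one (X : nilradical P F) : act P 1 X = X := by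
  refine Subtype.ext ?_
  change (1 : (ContractionAlgebra P F)ˣ).1 * X.1 * star (1 : (ContractionAlgebra P F)ˣ).1 = X.1
  simp

/-- The action of a unit on the linear forms on `u^a`. -/
def dualAct (g : (ContractionAlgebra P F)ˣ) :
    Module.Dual F (nilradical P F) ≃ Module.Dual F (nilradical P F) where
  toFun μ := μ ∘ₗ act P (star g)
  invFun μ := μ ∘ₗ act P (star g⁻¹)
  left_inv μ := LinearMap.ext fun X => by
    change μ (act P (star g) (act P (star g⁻¹) X)) = μ X
    rw [← act_mul, ← star_mul, inv_mul_cancel, star_one, act_one]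
  right_inv μ := LinearMap.ext fun X => by
    change μ (act P (star g⁻¹) (act P (star g) X)) = μ X
    rw [← act_mul, ← star_mul, mul_inv_cancel, star_one, act_one]

theorem dualAct_apply (g : (ContractionAlgebra P F)ˣ) (μ : Module.Dual F (nilradical P F))
    (X : nilradical P F) : dualAct g μ X = μ (act P (star g) X) := rfl

theorem dualAct_mul (g h : (ContractionAlgebra P F)ˣ) (μ : Module.Dual F (nilradical P F)) :
    dualAct (g * h) μ = dualAct g (dualAct h μ) := by
  ext1 X
  rw [dualAct_apply, dualAct_apply, dualAct_apply, star_mul, act_mul]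

theorem mem_dualOrbit_self (μ : Module.Dual F (nilradical P F)) : μ ∈ dualOrbit P μ :=
  ⟨(1 : (ContractionAlgebra P F)ˣ), LinearMap.ext fun X => by
    change μ X = μ (act P (star (1 : (ContractionAlgebra P F)ˣ)) X)
    rw [star_one, act_one]⟩

theorem dualAct_mem_dualOrbit_iff {μ ν : Module.Dual F (nilradical P F)}
    (g : (ContractionAlgebra P F)ˣ) : dualAct g ν ∈ dualOrbit P μ ↔ ν ∈ dualOrbit P μ := by
  constructor
  · rintro ⟨h, hh⟩
    refine ⟨g⁻¹ * h, ?_⟩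
    change ν = dualAct (g⁻¹ * h) μ
    rw [dualAct_mul, show dualAct h μ = dualAct g ν from hh.symm]
    exact ((dualAct g).left_inv ν).symm
  · rintro ⟨h, rfl⟩
    exact ⟨g * h, (dualAct_mul g h μ).symm⟩

theorem dualOrbit_eq_of_mem {μ ν : Module.Dual F (nilradical P F)} (h : ν ∈ dualOrbit P μ) :
    dualOrbit P ν = dualOrbit P μ := by
  obtain ⟨g, rfl⟩ := h
  ext κ
  constructor
  · rintro ⟨k, rfl⟩
    exact ⟨k * g, (dualAct_mul k g μ).symm⟩
  · rintro ⟨k, rfl⟩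
    refine ⟨k * g⁻¹, ?_⟩
    change dualAct k μ = dualAct (k * g⁻¹) (dualAct g μ)
    rw [← dualAct_mul, inv_mul_cancel_right]

theorem dualOrbit_eq_or_disjoint (μ ν : Module.Dual F (nilradical P F)) :
    dualOrbit P μ = dualOrbit P ν ∨ Disjoint (dualOrbit P μ) (dualOrbit P ν) := by
  by_cases h : Disjoint (dualOrbit P μ) (dualOrbit P ν)
  · exact Or.inr h
  · obtain ⟨κ, h1, h2⟩ := Set.not_disjoint_iff.1 h
    exact Or.inl ((dualOrbit_eq_of_mem h1).symm.trans (dualOrbit_eq_of_mem h2))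

end Orbits

section SkewExtension

/-- The skew part of the component outside the diagonal blocks. -/
def skewPart : ContractionAlgebra P F →ₗ[F] nilradical P F where
  toFun X := ⟨fun i j => if P.block i = P.block j then 0 else
      2⁻¹ * (X i j - sgn F i * sgn F j * X (-j) (-i)), by
    constructor
    · ext i j
      change sgn F i * sgn F j * (if P.block (-j) = P.block (-i) then 0 else
        2⁻¹ * (X (-j) (-i) - sgn F (-j) * sgn F (-i) * X (- -i) (- -j))) =
        -(if P.block i = P.block j then 0 else 2⁻¹ * (X i j - sgn F i * sgn F j * X (-j) (-i)))
      simp only [P.block_neg, neg_inj, neg_neg, @eq_comm _ (P.block j)]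
      split_ifs with h
      · simp
      · rw [mul_comm (sgn F (-j)), sgn_neg_mul_sgn_neg]
        linear_combination (-2⁻¹ * X i j * sgn F j * sgn F j) * sgn_mul_self (F := F) i -
          2⁻¹ * X i j * sgn_mul_self (F := F) j
    · intro i j h
      exact if_pos h⟩
  map_add' X Y := by
    refine Subtype.ext ?_
    ext i j
    change (if P.block i = P.block j then (0 : F) else _) =
      (if P.block i = P.block j then (0 : F) else _) + (if P.block i = P.block j then (0 : F) else _)
    split_ifs
    · simp
    · rw [add_entry, add_entry]
      ring
  map_smul' c X := by
    refine Subtype.ext ?_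
    ext i j
    change (if P.block i = P.block j then (0 : F) else _) =
      c * (if P.block i = P.block j then (0 : F) else _)
    split_ifs
    · simp
    · rw [smul_entry, smul_entry]
      ring

theorem skewPart_entry (X : ContractionAlgebra P F) (i j : Idx T n) :
    (skewPart X).1 i j = if P.block i = P.block j then 0 else
      2⁻¹ * (X i j - sgn F i * sgn F j * X (-j) (-i)) := rfl

theorem skewPart_of_mem (h2 : (2 : F) ≠ 0) (X : nilradical P F) : skewPart X.1 = X := by
  refine Subtype.ext ?_
  ext i j
  rw [skewPart_entry]
  split_ifs with h
  · exact (X.2.2 i j h).symm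
  · rw [nilradical_entry X.2.1]
    field_simp
    linear_combination (X.1 i j * sgn F j * sgn F j) * sgn_mul_self (F := F) i +
      X.1 i j * sgn_mul_self (F := F) j

/-- Composing a form on `u^a` with `skewPart` gives an extension to the whole algebra that changes
sign under the involution, as `exists_lagrangian` requires. -/
theorem skewPart_star (X : ContractionAlgebra P F) :
    skewPart (star X) = -skewPart X := by
  refine Subtype.ext ?_
  ext i j
  change (skewPart (star X)).1 i j = -(skewPart X).1 i j
  rw [skewPart_entry, skewPart_entry]
  split_ifs
  · simp
  · rw [star_entry, star_entry, neg_neg, neg_neg, mul_comm (sgn F (-j)), sgn_neg_mul_sgn_neg]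
    linear_combination (-2⁻¹ * X i j * sgn F j * sgn F j) * sgn_mul_self (F := F) i -
      2⁻¹ * X i j * sgn_mul_self (F := F) j

end SkewExtension

/-! ### Orbit sums and their Fourier transforms. -/

section OrbitSums

instance [Finite F] : Fintype (nilradical P F) := Fintype.ofFinite _

instance [Finite F] : Fintype (unipotentSubgroup P F) := Fintype.ofFinite _

instance [Finite F] : Fintype (ContractionAlgebra P F) := Fintype.ofFinite _

instance [Finite F] : Fintype (Module.Dual F (nilradical P F)) :=
  have : Finite (Module.Dual F (nilradical P F)) :=
    Finite.of_injective (fun l => (l : nilradical P F → F)) DFunLike.coe_injective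
  Fintype.ofFinite _

instance [Finite F] : Fintype (ContractionAlgebra P F)ˣ := Fintype.ofFinite _

/-- The sum of the additive characters attached to a set of linear forms. -/
def orbitSum (ε : AddChar F ℂ) (O : Set (Module.Dual F (nilradical P F))) (X : nilradical P F) :
    ℂ := ∑ᶠ μ ∈ O, ε (μ X)

variable [Finite F] {ε : AddChar F ℂ}

open Classical in
theorem orbitSum_eq (O : Set (Module.Dual F (nilradical P F))) (X : nilradical P F) :
    orbitSum ε O X = ∑ μ : Module.Dual F (nilradical P F), if μ ∈ O then ε (μ X) else 0 := by
  rw [orbitSum, finsum_mem_def, finsum_eq_sum_of_fintype]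
  rfl

theorem orbitSum_act (μ : Module.Dual F (nilradical P F)) (g : (ContractionAlgebra P F)ˣ)
    (X : nilradical P F) :
    orbitSum ε (dualOrbit P μ) (act P g X) = orbitSum ε (dualOrbit P μ) X := by
  classical
  rw [orbitSum_eq, orbitSum_eq, ← Equiv.sum_comp (dualAct (star g))
    (fun ν : Module.Dual F (nilradical P F) => if ν ∈ dualOrbit P μ then ε (ν X) else 0)]
  refine Finset.sum_congr rfl fun ν _ => ?_
  rw [dualAct_mem_dualOrbit_iff, dualAct_apply, star_star]

theorem orbitSum_add_of_annihilated {O : Set (Module.Dual F (nilradical P F))}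
    (X : nilradical P F) {Y : nilradical P F} (hY : ∀ μ ∈ O, μ Y = 0) :
    orbitSum ε O (X + Y) = orbitSum ε O X := by
  classical
  rw [orbitSum_eq, orbitSum_eq]
  refine Finset.sum_congr rfl fun μ _ => ?_
  split_ifs with h
  · rw [map_add, hY μ h, add_zero]
  · rfl

variable (hε : ε ≠ 1)

include hε in
/-- The Fourier transform of an orbit sum. -/
theorem sum_orbitSum_mul (O : Set (Module.Dual F (nilradical P F)))
    (ν : Module.Dual F (nilradical P F)) [Decidable (ν ∈ O)] :
    ∑ X, orbitSum ε O X * star (ε (ν X)) =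
      if ν ∈ O then (Fintype.card (nilradical P F) : ℂ) else 0 := by
  classical
  simp only [orbitSum_eq, Finset.sum_mul]
  rw [Finset.sum_comm, Finset.sum_eq_single ν]
  · split_ifs with h
    · have : ∀ X : nilradical P F, ε (ν X) * star (ε (ν X)) = 1 := fun X => by
        rw [star_addChar, ← AddChar.map_add_eq_mul, add_neg_cancel, AddChar.map_zero_eq_one]
      rw [Finset.sum_congr rfl fun X _ => this X]
      simp
    · simp
  · intro μ _ hμ
    split_ifs with h
    · have h1 := sum_addChar_linear hε (μ - ν)
      rw [if_neg (sub_ne_zero.2 hμ)] at h1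
      rw [← h1]
      refine Finset.sum_congr rfl fun X _ => ?_
      rw [star_addChar, ← AddChar.map_add_eq_mul, LinearMap.sub_apply, sub_eq_add_neg]
    · simp
  · simp

include hε in
-- The Fourier transform of an orbit sum is supported on the orbit, and the orbits are disjoint.
theorem sum_orbitSum_mul_star_eq_zero {O O' : Set (Module.Dual F (nilradical P F))}
    (h : Disjoint O O') : ∑ X, orbitSum ε O X * star (orbitSum ε O' X) = 0 := by
  classical
  have : ∀ X : nilradical P F, orbitSum ε O X * star (orbitSum ε O' X) =
      ∑ ν : Module.Dual F (nilradical P F),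
        if ν ∈ O' then orbitSum ε O X * star (ε (ν X)) else 0 := by
    intro X
    rw [orbitSum_eq O', star_sum, Finset.mul_sum]
    refine Finset.sum_congr rfl fun ν _ => ?_
    split_ifs
    · rfl
    · rw [star_zero, mul_zero]
  rw [Finset.sum_congr rfl fun X _ => this X, Finset.sum_comm]
  refine Finset.sum_eq_zero fun ν _ => ?_
  split_ifs with hν
  · rw [sum_orbitSum_mul hε, if_neg (Set.disjoint_right.1 h hν)]
  · simp

theorem orbitSum_zero_pos (μ : Module.Dual F (nilradical P F)) :
    ∃ m : ℕ, 0 < m ∧ orbitSum ε (dualOrbit P μ) (0 : nilradical P F) = m := by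
  classical
  refine ⟨(Finset.univ.filter (· ∈ dualOrbit P μ)).card,
    Finset.card_pos.2 ⟨μ, by simpa using mem_dualOrbit_self μ⟩, ?_⟩
  rw [orbitSum_eq]
  simp

/-- A sum over the whole algebra with an indicator can be translated by elements of the radical,
which preserve invertibility. -/
theorem sum_units_eq {f : ContractionAlgebra P F → ℂ} [DecidablePred (IsUnit (M := ContractionAlgebra P F))] :
    ∑ g : (ContractionAlgebra P F)ˣ, f g = ∑ a, if IsUnit a then f a else 0 := by
  classical
  rw [← Finset.sum_filter]
  refine Finset.sum_bij (fun g _ => (g : ContractionAlgebra P F)) ?_ ?_ ?_ ?_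
  · intro g _
    simp
  · intro g _ h _ hgh
    exact Units.ext hgh
  · intro a ha
    obtain ⟨g, rfl⟩ := (Finset.mem_filter.1 ha).2
    exact ⟨g, Finset.mem_univ _, rfl⟩
  · intro g _
    rfl

/-- The sum over the group is a multiple of the sum over the orbit. -/
theorem exists_sum_dualAct_eq (μ : Module.Dual F (nilradical P F)) :
    ∃ m : ℕ, 0 < m ∧ ∀ X : nilradical P F,
      ∑ g : (ContractionAlgebra P F)ˣ, ε (dualAct g μ X) = m * orbitSum ε (dualOrbit P μ) X := by
  classical
  refine ⟨(Finset.univ.filter fun g : (ContractionAlgebra P F)ˣ => dualAct g μ = μ).card,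
    Finset.card_pos.2 ⟨1, ?_⟩, fun X => ?_⟩
  · rw [Finset.mem_filter]
    refine ⟨Finset.mem_univ _, LinearMap.ext fun X => ?_⟩
    rw [dualAct_apply, star_one, act_one]
  · rw [orbitSum_eq, Finset.mul_sum, ← Finset.sum_fiberwise Finset.univ
      (fun g : (ContractionAlgebra P F)ˣ => dualAct g μ)]
    refine Finset.sum_congr rfl fun ν _ => ?_
    have h1 : ∑ g ∈ Finset.univ.filter (fun g : (ContractionAlgebra P F)ˣ => dualAct g μ = ν),
        ε (dualAct g μ X) =
        (Finset.univ.filter fun g : (ContractionAlgebra P F)ˣ => dualAct g μ = ν).card *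
          ε (ν X) := by
      rw [Finset.sum_congr rfl (g := fun _ => ε (ν X)), Finset.sum_const, nsmul_eq_mul]
      intro g hg
      rw [(Finset.mem_filter.1 hg).2]
    rw [h1]
    split_ifs with hν
    · obtain ⟨k, rfl⟩ := hν
      congr 2
      refine Finset.card_bij' (fun g _ => k⁻¹ * g) (fun g _ => k * g) ?_ ?_ ?_ ?_
      · intro g hg
        rw [Finset.mem_filter] at hg ⊢
        refine ⟨Finset.mem_univ _, ?_⟩
        rw [dualAct_mul, hg.2]
        exact (dualAct k).left_inv μ
      · intro g hg
        rw [Finset.mem_filter] at hg ⊢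
        refine ⟨Finset.mem_univ _, ?_⟩
        rw [dualAct_mul, hg.2]
        rfl
      · intro g _
        simp
      · intro g _
        simp
    · have : Finset.univ.filter (fun g : (ContractionAlgebra P F)ˣ => dualAct g μ = ν) = ∅ := by
        rw [Finset.filter_eq_empty_iff]
        exact fun g _ hg => hν ⟨g, hg.symm⟩
      rw [this]
      simp

end OrbitSums

/-! ### Orbit sums are of positive type. -/

section Positivity

variable [Finite F] {ε : AddChar F ℂ} (hε : ε ≠ 1) (h2 : (2 : F) ≠ 0)

include hε h2 in
-- The translation `a ↦ a + m` with `m ∈ M` permutes the units and changes the exponent only by `2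
-- l(a† x m)`, since `x m ∈ M` and `M` is isotropic. Averaging over `m` kills the terms for which
-- this functional of `m` is nonzero, and it is zero exactly if `x a` is orthogonal to `M`, that is,
-- if `x a ∈ M`.
theorem sum_units_eq_sum_lagrangian {l : Module.Dual F (ContractionAlgebra P F)}
    (hl : ∀ X, l (star X) = -l X) {M : Submodule F (ContractionAlgebra P F)}
    (hMJ : M ≤ radical P F) (hMl : ∀ y ∈ radical P F, ∀ m ∈ M, y * m ∈ M)
    (hMi : ∀ m ∈ M, ∀ m' ∈ M, l (star m * m') = 0)
    (hMm : ∀ w ∈ radical P F, (∀ m ∈ M, l (star m * w) = 0) → w ∈ M)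
    {x : ContractionAlgebra P F} (hx : x ∈ nilradical P F)
    [DecidablePred (IsUnit (M := ContractionAlgebra P F))] [DecidablePred (· ∈ M)] :
    ∑ a, (if IsUnit a then ε (l (star a * x * a)) else 0) =
      ∑ a, if IsUnit a ∧ x * a ∈ M then ε (l (star a * x * a)) else 0 := by
  classical
  have : Fintype M := Fintype.ofFinite M
  have hcard : (Fintype.card M : ℂ) ≠ 0 := Nat.cast_ne_zero.2 Fintype.card_ne_zero
  refine mul_left_cancel₀ hcard ?_
  have hexp : ∀ a : ContractionAlgebra P F, ∀ m : M, l (star (a + m) * x * (a + m)) =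
      l (star a * x * a) + 2 * l (star a * x * m.1) := by
    intro a m
    have e1 : star (a + m.1) * x * (a + m) = star a * x * a + star a * x * m.1 +
        star m.1 * x * a + star m.1 * (x * m.1) := by
      rw [star_add]
      noncomm_ring
    have e2 : l (star m.1 * x * a) = l (star a * x * m.1) := by
      have h3 := hl (star m.1 * x * a)
      rw [star_mul, star_mul, star_star, hx.1, ← mul_assoc, mul_neg, neg_mul, map_neg] at h3
      exact (neg_injective h3).symm
    rw [e1, map_add, map_add, map_add, e2, hMi _ m.2 _ (hMl x hx.2 m m.2)]
    ring
  have hshift : ∀ m : M, ∑ a, (if IsUnit a then ε (l (star a * x * a)) else 0) =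
      ∑ a, if IsUnit a then ε (l (star a * x * a)) * ε (2 * l (star a * x * m.1)) else 0 := by
    intro m
    rw [← Equiv.sum_comp (Equiv.addRight m.1)]
    refine Finset.sum_congr rfl fun a _ => ?_
    rw [Equiv.coe_addRight, hexp, AddChar.map_add_eq_mul]
    exact if_congr (isUnit_add_iff (hMJ m.2) a) rfl rfl
  have h3 : (Fintype.card M : ℂ) * ∑ a, (if IsUnit a then ε (l (star a * x * a)) else 0) =
      ∑ m : M, ∑ a, if IsUnit a then ε (l (star a * x * a)) * ε (2 * l (star a * x * m.1)) else 0 := by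
    rw [← Finset.sum_congr rfl fun m _ => hshift m, Finset.sum_const, nsmul_eq_mul,
      Finset.card_univ]
  rw [h3, Finset.sum_comm, Finset.mul_sum]
  refine Finset.sum_congr rfl fun a _ => ?_
  by_cases ha : IsUnit a
  · simp only [ha, if_true, true_and]
    rw [← Finset.mul_sum]
    let f : Module.Dual F M := (2 : F) • ((l ∘ₗ LinearMap.mulLeft F (star a * x)) ∘ₗ M.subtype)
    have h4 : ∑ m : M, ε (2 * l (star a * x * m.1)) = ∑ m : M, ε (f m) := rfl
    rw [h4, sum_addChar_linear hε f]
    have hsw : ∀ m : M, l (star m.1 * (x * a)) = l (star a * x * m.1) := by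
      intro m
      have h5 := hl (star m.1 * (x * a))
      rw [star_mul, star_mul, star_star, hx.1, mul_neg, neg_mul, map_neg] at h5
      exact (neg_injective h5).symm
    have hf : f = 0 ↔ x * a ∈ M := by
      constructor
      · intro hf
        refine hMm _ (mul_mem_radical_left hx.2 a) fun m hm => ?_
        have h6 : (2 : F) * l (star a * x * m) = 0 := LinearMap.congr_fun hf ⟨m, hm⟩
        rw [hsw ⟨m, hm⟩]
        exact (mul_eq_zero.1 h6).resolve_left h2
      · intro hxa
        refine LinearMap.ext fun m => ?_
        change (2 : F) * l (star a * x * m.1) = 0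
        rw [← hsw m, hMi _ m.2 _ hxa, mul_zero]
    by_cases hxa : x * a ∈ M
    · rw [if_pos (hf.2 hxa), if_pos hxa, mul_comm]
    · rw [if_neg fun h => hxa (hf.1 h), if_neg hxa, mul_zero, mul_zero]
  · simp [ha]

open scoped ComplexOrder in
include hε h2 in
/-- The orbit sums are functions of positive type on `U^a`. -/
theorem posSemidef_orbitSum (μ : Module.Dual F (nilradical P F)) :
    (Matrix.of fun u v : unipotentSubgroup P F =>
      orbitSum ε (dualOrbit P μ) (cayley P (u⁻¹ * v))).PosSemidef := by
  classical
  obtain ⟨m, hm, hsum⟩ := exists_sum_dualAct_eq (ε := ε) μ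
  set l : Module.Dual F (ContractionAlgebra P F) := μ ∘ₗ skewPart with hl_def
  have hl : ∀ X, l (star X) = -l X := fun X => by
    rw [hl_def, LinearMap.comp_apply, skewPart_star, map_neg, LinearMap.comp_apply]
  obtain ⟨M, hMJ, hMl, hMi, hMm⟩ := exists_lagrangian l hl h2
  have hMl' : ∀ (u : unipotentSubgroup P F), ∀ m ∈ M, u.1.1 * m ∈ M := by
    intro u m hm
    have : u.1.1 * m = (u.1.1 - 1) * m + m := by noncomm_ring
    rw [this]
    exact M.add_mem (hMl _ (unipotent_sub_one_mem u) m hm) hm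
  have hcomm : ∀ u : unipotentSubgroup P F, u.1.1 * halfCayley u = halfCayley u * u.1.1 := by
    intro u
    have h4 := one_sub_halfCayley_mul h2 u
    have h5 := mul_one_sub_halfCayley h2 u
    rw [sub_mul, one_mul] at h4
    rw [mul_sub, mul_one] at h5
    exact sub_right_injective (h5.trans h4.symm)
  have hcay : ∀ (u : unipotentSubgroup P F) (a : ContractionAlgebra P F),
      (cayley P u).1 * a = (u.1.1 - 1) * a - halfCayley u * ((u.1.1 - 1) * a) := by
    intro u a
    have h3 : (cayley P u).1 = (u.1.1 - 1) - halfCayley u * (u.1.1 - 1) := by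
      have h4 := halfCayley_mul h2 u
      rw [mul_add, mul_one] at h4
      rw [cayley_eq_two_mul h2, mul_sub, mul_one]
      rw [← h4]
      noncomm_ring
    rw [h3]
    noncomm_ring
  -- The condition on the Cayley transform becomes a condition on `u - 1`, which visibly defines a
  -- subgroup `H a`.
  have hsub : ∀ (u : unipotentSubgroup P F) (a : ContractionAlgebra P F),
      (cayley P u).1 * a ∈ M ↔ (u.1.1 - 1) * a ∈ M := by
    intro u a
    have h3 : 2 * ((u.1.1 - 1) * a) = (u.1.1 + 1) * ((cayley P u).1 * a) := by
      rw [cayley_eq_two_mul h2, ← halfCayley_mul h2 u, mul_add, ← hcomm u]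
      noncomm_ring
    constructor
    · intro h
      refine mem_of_two_mul_mem h2 ?_
      rw [h3, add_mul, one_mul]
      exact M.add_mem (hMl' u _ h) h
    · intro h
      rw [hcay]
      exact M.sub_mem h (hMl _ (halfCayley_mem u).2 _ h)
  -- On that subgroup the correction term pairs `halfCayley u * a` with `(u - 1) a`. Both lie in the
  -- isotropic `M`, so the exponent also depends on `u - 1` only.
  have hval : ∀ (u : unipotentSubgroup P F) (a : ContractionAlgebra P F), (u.1.1 - 1) * a ∈ M →
      l (star a * (cayley P u).1 * a) = l (star a * ((u.1.1 - 1) * a)) := by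
    intro u a h
    have h3 := (hsub u a).2 h
    rw [mul_assoc, hcay, mul_sub, map_sub]
    have h4 : halfCayley u * a ∈ M := by
      refine mem_of_two_mul_mem h2 ?_
      rwa [← mul_assoc, ← cayley_eq_two_mul h2]
    have h5 := hMi _ h4 _ h
    rw [star_mul, (halfCayley_mem u).1, mul_neg, neg_mul, map_neg, neg_eq_zero, mul_assoc] at h5
    rw [h5, sub_zero]
  let H : ContractionAlgebra P F → Subgroup (unipotentSubgroup P F) := fun a =>
    { carrier := {u | (u.1.1 - 1) * a ∈ M}
      mul_mem' := by
        intro u v hu hv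
        have : ((u * v).1.1 - 1) * a = u.1.1 * ((v.1.1 - 1) * a) + (u.1.1 - 1) * a := by
          change (u.1.1 * v.1.1 - 1) * a = _
          noncomm_ring
        change ((u * v).1.1 - 1) * a ∈ M
        rw [this]
        exact M.add_mem (hMl' u _ hv) hu
      one_mem' := by
        change ((1 : ContractionAlgebra P F) - 1) * a ∈ M
        rw [sub_self, zero_mul]
        exact M.zero_mem
      inv_mem' := by
        intro u hu
        have h1 : u⁻¹.1.1 * u.1.1 = 1 := congrArg (fun x : unipotentSubgroup P F => x.1.1)
          (inv_mul_cancel u)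
        have : (u⁻¹.1.1 - 1) * a = -(u⁻¹.1.1 * ((u.1.1 - 1) * a)) := by
          rw [sub_mul, sub_mul, mul_sub, ← mul_assoc, h1]
          noncomm_ring
        change (u⁻¹.1.1 - 1) * a ∈ M
        rw [this]
        exact M.neg_mem (hMl' _ _ hu) }
  let k : ContractionAlgebra P F → unipotentSubgroup P F → ℂ := fun a u =>
    if u ∈ H a then ε (l (star a * ((u.1.1 - 1) * a))) else 0
  -- The cross term is the pairing of `(u⁻¹ - 1) a` with `(v - 1) a`, two elements of `M`. So the
  -- exponent is additive and `k a` restricts to a linear character.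
  have hadd : ∀ a, ∀ u ∈ H a, ∀ v ∈ H a, l (star a * (((u * v).1.1 - 1) * a)) =
      l (star a * ((u.1.1 - 1) * a)) + l (star a * ((v.1.1 - 1) * a)) := by
    intro a u hu v hv
    have h1 := hMi _ ((H a).inv_mem hu) _ hv
    have h3 : star (u⁻¹.1.1) = u.1.1 := by
      change star (star u.1.1) = u.1.1
      rw [star_star]
    rw [star_mul, star_sub, star_one, h3] at h1
    have h4 : star a * (((u * v).1.1 - 1) * a) = star a * ((u.1.1 - 1) * a) +
        star a * ((v.1.1 - 1) * a) + star a * (u.1.1 - 1) * ((v.1.1 - 1) * a) := by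
      change star a * ((u.1.1 * v.1.1 - 1) * a) = _
      noncomm_ring
    rw [h4, map_add, map_add, h1, add_zero]
  have hk : ∀ a, (Matrix.of fun u v : unipotentSubgroup P F => k a (u⁻¹ * v)).PosSemidef := by
    intro a
    refine posSemidef_of_linearCharacter (H a) (fun u hu => if_neg hu) ?_ ?_
    · intro u hu v hv
      simp only [k, if_pos hu, if_pos hv, if_pos (mul_mem hu hv), hadd a u hu v hv,
        AddChar.map_add_eq_mul]
    · intro u hu
      simp only [k, if_pos hu, if_pos (inv_mem hu), star_addChar]
      congr 1
      have h1 := hadd a u hu u⁻¹ (inv_mem hu)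
      rw [mul_inv_cancel] at h1
      have h3 : l (star a * (((1 : unipotentSubgroup P F).1.1 - 1) * a)) = 0 := by
        change l (star a * (((1 : ContractionAlgebra P F) - 1) * a)) = 0
        rw [sub_self, zero_mul, mul_zero, map_zero]
      rw [h3] at h1
      linear_combination -h1
  have hmain : ∀ u : unipotentSubgroup P F,
      (m : ℂ) * orbitSum ε (dualOrbit P μ) (cayley P u) = ∑ a, if IsUnit a then k a u else 0 := by
    intro u
    rw [← hsum]
    have h3 : ∀ g : (ContractionAlgebra P F)ˣ, ε (dualAct g μ (cayley P u)) =
        ε (l (star g.1 * (cayley P u).1 * g.1)) := by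
      intro g
      rw [dualAct_apply, hl_def, LinearMap.comp_apply, ← skewPart_of_mem h2 (act P (star g) _)]
      change ε (μ (skewPart (star g.1 * (cayley P u).1 * star (star g.1)))) = _
      rw [star_star]
    rw [Finset.sum_congr rfl fun g _ => h3 g,
      sum_units_eq (f := fun a => ε (l (star a * (cayley P u).1 * a))),
      sum_units_eq_sum_lagrangian hε h2 hl hMJ hMl hMi hMm (cayley P u).2]
    refine Finset.sum_congr rfl fun a _ => ?_
    rw [ite_and]
    refine if_congr Iff.rfl ?_ rfl
    change _ = if (u.1.1 - 1) * a ∈ M then _ else _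
    rw [if_congr (hsub u a) rfl rfl]
    split_ifs with h
    · rw [hval u a h]
    · rfl
  have hm0 : (m : ℂ) ≠ 0 := Nat.cast_ne_zero.2 hm.ne'
  have hmat : (Matrix.of fun u v : unipotentSubgroup P F =>
      orbitSum ε (dualOrbit P μ) (cayley P (u⁻¹ * v))) =
      (m : ℂ)⁻¹ • ∑ a ∈ Finset.univ.filter (IsUnit (M := ContractionAlgebra P F)),
        Matrix.of fun u v : unipotentSubgroup P F => k a (u⁻¹ * v) := by
    ext u v
    rw [Matrix.smul_apply, Matrix.sum_apply, smul_eq_mul, Finset.sum_filter]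
    simp only [Matrix.of_apply]
    rw [← hmain, inv_mul_cancel_left₀ hm0]
  rw [hmat]
  refine (Matrix.posSemidef_sum _ fun a _ => hk a).smul ?_
  rw [inv_nonneg]
  exact_mod_cast Nat.zero_le _

end Positivity

end ParabolicContraction

end

noncomputable section

namespace ParabolicContraction

variable {T : ClassicalType} {n : ℕ} {P : SymPartition T n} {F : Type*} [Field F]

/-! ### Orbit sums are multiples of convolution idempotents. -/

section Convolution

variable [Finite F] {ε : AddChar F ℂ} (hε : ε ≠ 1) (h2 : (2 : F) ≠ 0)

theorem card_dual_nilradical :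
    Fintype.card (Module.Dual F (nilradical P F)) = Fintype.card (nilradical P F) := by
  have : Module.Finite F (ContractionAlgebra P F) := Module.Finite.of_finite
  have : Module.Finite F (nilradical P F) := Module.Finite.of_finite
  rw [← Nat.card_eq_fintype_card, ← Nat.card_eq_fintype_card,
    Module.natCard_eq_pow_finrank (K := F) (V := Module.Dual F (nilradical P F)),
    Module.natCard_eq_pow_finrank (K := F) (V := nilradical P F), Subspace.dual_finrank_eq]

include h2 in
theorem card_unipotentSubgroup :
    Fintype.card (unipotentSubgroup P F) = Fintype.card (nilradical P F) :=
  Fintype.card_of_bijective (cayley_bijective h2)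

omit [Finite F] in
theorem cayley_one : cayley P (1 : unipotentSubgroup P F) = 0 := by
  refine Subtype.ext ?_
  change 2 * ((1 : ContractionAlgebra P F) - 1) * _ = 0
  rw [sub_self, mul_zero, zero_mul]

include hε h2 in
-- The orbits partition the dual space, so all orbit sums together give the full sum of characters,
-- which is `|U^a|` at `1` and zero elsewhere. With positivity and pairwise orthogonality
-- `sum_mul_eq_of_posSemidef` applies.
theorem sum_orbitSum_mul_orbitSum (μ : Module.Dual F (nilradical P F))
    (x z : unipotentSubgroup P F) :
    ∑ y, orbitSum ε (dualOrbit P μ) (cayley P (x⁻¹ * y)) *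
      orbitSum ε (dualOrbit P μ) (cayley P (y⁻¹ * z)) =
      Fintype.card (unipotentSubgroup P F) * orbitSum ε (dualOrbit P μ) (cayley P (x⁻¹ * z)) := by
  classical
  let ι := {O : Set (Module.Dual F (nilradical P F)) // ∃ μ, O = dualOrbit P μ}
  have : Fintype ι := Fintype.ofFinite ι
  have hsum : ∀ X : nilradical P F, ∑ O : ι, orbitSum ε O.1 X =
      ∑ ν : Module.Dual F (nilradical P F), ε (ν X) := by
    intro X
    simp only [orbitSum_eq]
    rw [Finset.sum_comm]
    refine Finset.sum_congr rfl fun ν _ => ?_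
    rw [Finset.sum_eq_single (⟨dualOrbit P ν, ν, rfl⟩ : ι)]
    · exact if_pos (mem_dualOrbit_self ν)
    · rintro ⟨_, κ, rfl⟩ _ hne
      refine if_neg fun hν => hne (Subtype.ext ?_)
      exact (dualOrbit_eq_of_mem hν).symm
    · exact fun h => absurd (Finset.mem_univ _) h
  refine sum_mul_eq_of_posSemidef
    (f := fun (O : ι) (u : unipotentSubgroup P F) => orbitSum ε O.1 (cayley P u)) ?_ ?_ ?_ ?_
    ⟨dualOrbit P μ, μ, rfl⟩ x z
  · rintro ⟨_, κ, rfl⟩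
    exact posSemidef_orbitSum hε h2 κ
  · rw [hsum, sum_addChar_dual hε, cayley_one, if_pos rfl, card_dual_nilradical,
      card_unipotentSubgroup h2]
  · intro u hu
    rw [hsum, sum_addChar_dual hε, if_neg]
    rw [← cayley_one]
    exact fun h => hu (cayley_injective h2 h)
  · rintro ⟨_, κ, rfl⟩ ⟨_, κ', rfl⟩ hne
    have := sum_orbitSum_mul_star_eq_zero hε
      ((dualOrbit_eq_or_disjoint κ κ').resolve_left fun h => hne (Subtype.ext h))
    rw [← this]
    exact Function.Bijective.sum_comp (cayley_bijective h2)
      (fun X => orbitSum ε (dualOrbit P κ) X * star (orbitSum ε (dualOrbit P κ') X))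

end Convolution

/-! ### The fixer of an orbit, and orbit sums under conjugation. -/

section Fixer

/-- The elements of `u^a` annihilated by the orbit of a linear form. -/
def orbitAnnihilator (μ : Module.Dual F (nilradical P F)) : Submodule F (nilradical P F) where
  carrier := {X | ∀ ν ∈ dualOrbit P μ, ν X = 0}
  add_mem' hX hY ν hν := by rw [map_add, hX ν hν, hY ν hν, add_zero]
  zero_mem' ν _ := map_zero ν
  smul_mem' c X hX ν hν := by rw [map_smul, hX ν hν, smul_zero]

theorem act_mem_orbitAnnihilator {μ : Module.Dual F (nilradical P F)}
    (g : (ContractionAlgebra P F)ˣ) {X : nilradical P F} (hX : X ∈ orbitAnnihilator μ) :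
    act P g X ∈ orbitAnnihilator μ := by
  intro ν hν
  have := hX _ ((dualAct_mem_dualOrbit_iff (star g)).2 hν)
  rwa [dualAct_apply, star_star] at this

theorem isInvariant_map {W : Submodule F (nilradical P F)}
    (hW : ∀ g : (ContractionAlgebra P F)ˣ, ∀ X ∈ W, act P g X ∈ W) :
    IsInvariant P F (W.map (nilradical P F).subtype) where
  le := by
    rintro _ ⟨X, -, rfl⟩
    exact X.2
  conj_mem := by
    rintro _ ⟨g, rfl⟩ _ ⟨X, hX, rfl⟩
    exact ⟨_, hW g X hX, rfl⟩

theorem coe_mem_map_subtype {W : Submodule F (nilradical P F)} {X : nilradical P F} :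
    (X : ContractionAlgebra P F) ∈ W.map (nilradical P F).subtype ↔ X ∈ W := by
  constructor
  · rintro ⟨Y, hY, h⟩
    rwa [← Subtype.ext h]
  · exact fun h => ⟨X, h, rfl⟩

theorem act_toUnits_mul (g h : ContractionGroup P F) (X : nilradical P F) :
    act P (Unitary.toUnits (g * h)) X = act P (Unitary.toUnits g) (act P (Unitary.toUnits h) X) := by
  rw [map_mul, act_mul]

theorem act_toUnits_inv_act (g : ContractionGroup P F) (X : nilradical P F) :
    act P (Unitary.toUnits g⁻¹) (act P (Unitary.toUnits g) X) = X := by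
  rw [← act_toUnits_mul, inv_mul_cancel, map_one, act_one]

theorem act_toUnits_act_inv (g : ContractionGroup P F) (X : nilradical P F) :
    act P (Unitary.toUnits g) (act P (Unitary.toUnits g⁻¹) X) = X := by
  rw [← act_toUnits_mul, mul_inv_cancel, map_one, act_one]

/-- The elements of `L` acting trivially on the orbit of a linear form. -/
def orbitFixer (μ : Module.Dual F (nilradical P F)) : Subgroup (ContractionGroup P F) where
  carrier := {h | h ∈ leviSubgroup P F ∧
    ∀ X, act P (Unitary.toUnits h) X - X ∈ orbitAnnihilator μ}
  mul_mem' := by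
    rintro g h ⟨hg, hg'⟩ ⟨hh, hh'⟩
    refine ⟨mul_mem hg hh, fun X => ?_⟩
    have : act P (Unitary.toUnits (g * h)) X - X =
        act P (Unitary.toUnits g) (act P (Unitary.toUnits h) X - X) +
          (act P (Unitary.toUnits g) X - X) := by
      rw [act_toUnits_mul, map_sub]
      abel
    rw [this]
    exact Submodule.add_mem _ (act_mem_orbitAnnihilator _ (hh' X)) (hg' X)
  one_mem' := ⟨one_mem _, fun X => by
    rw [map_one, act_one, sub_self]
    exact Submodule.zero_mem _⟩
  inv_mem' := by
    rintro g ⟨hg, hg'⟩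
    refine ⟨inv_mem hg, fun X => ?_⟩
    have : act P (Unitary.toUnits g⁻¹) X - X =
        -act P (Unitary.toUnits g⁻¹) (act P (Unitary.toUnits g) X - X) := by
      rw [map_sub, act_toUnits_inv_act]
      abel
    rw [this]
    exact Submodule.neg_mem _ (act_mem_orbitAnnihilator _ (hg' X))

theorem conj_mem_orbitFixer {μ : Module.Dual F (nilradical P F)} {l h : ContractionGroup P F}
    (hl : l ∈ leviSubgroup P F) (hh : h ∈ orbitFixer μ) : l * h * l⁻¹ ∈ orbitFixer μ := by
  refine ⟨mul_mem (mul_mem hl hh.1) (inv_mem hl), fun X => ?_⟩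
  have : act P (Unitary.toUnits (l * h * l⁻¹)) X - X =
      act P (Unitary.toUnits l) (act P (Unitary.toUnits h) (act P (Unitary.toUnits l⁻¹) X) -
        act P (Unitary.toUnits l⁻¹) X) := by
    rw [map_sub, act_toUnits_act_inv, act_toUnits_mul, act_toUnits_mul]
  rw [this]
  exact act_mem_orbitAnnihilator _ (hh.2 _)

theorem conj_mem_orbitFixer_iff {μ : Module.Dual F (nilradical P F)} {l h : ContractionGroup P F}
    (hl : l ∈ leviSubgroup P F) : l * h * l⁻¹ ∈ orbitFixer μ ↔ h ∈ orbitFixer μ := by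
  refine ⟨fun hh => ?_, conj_mem_orbitFixer hl⟩
  have := conj_mem_orbitFixer (inv_mem hl) hh
  have e : l⁻¹ * (l * h * l⁻¹) * l⁻¹⁻¹ = h := by group
  rwa [e] at this

theorem leviHom_mem (g : ContractionGroup P F) : leviHom P F g ∈ leviSubgroup P F := ⟨g, rfl⟩

theorem leviHom_of_mem {l : ContractionGroup P F} (hl : l ∈ leviSubgroup P F) :
    leviHom P F l = l := by
  obtain ⟨g, rfl⟩ := hl
  exact leviHom_leviHom P g

theorem leviHom_unipotent (u : unipotentSubgroup P F) : leviHom P F u.1 = 1 := u.2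

/-- Conjugation of elements of `U^a`. -/
def conjUnipotent (g : ContractionGroup P F) (u : unipotentSubgroup P F) : unipotentSubgroup P F :=
  ⟨g * u * g⁻¹, by
    change leviHom P F (g * u * g⁻¹) = 1
    rw [map_mul, map_mul, leviHom_unipotent, mul_one,
      ← map_mul, mul_inv_cancel, map_one]⟩

theorem cayley_conjUnipotent (h2 : (2 : F) ≠ 0) (g : ContractionGroup P F)
    (u : unipotentSubgroup P F) :
    cayley P (conjUnipotent g u) = act P (Unitary.toUnits g) (cayley P u) :=
  Subtype.ext (cayley_conj g u _ rfl h2)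

theorem mul_unipotentPart (g : ContractionGroup P F) :
    leviHom P F g * (unipotentPart P g : ContractionGroup P F) = g := mul_inv_cancel_left _ _

theorem unipotentPart_mul (g g' : ContractionGroup P F) :
    unipotentPart P (g * g') =
      conjUnipotent (leviHom P F g')⁻¹ (unipotentPart P g) * unipotentPart P g' := by
  refine Subtype.ext ?_
  change (leviHom P F (g * g'))⁻¹ * (g * g') =
    (leviHom P F g')⁻¹ * ((leviHom P F g)⁻¹ * g) * (leviHom P F g')⁻¹⁻¹ * ((leviHom P F g')⁻¹ * g')
  rw [map_mul]
  group

theorem unipotentPart_levi_mul {l : ContractionGroup P F} (hl : l ∈ leviSubgroup P F)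
    (u : unipotentSubgroup P F) : unipotentPart P (l * u.1) = u := by
  refine Subtype.ext ?_
  change (leviHom P F (l * u.1))⁻¹ * (l * u.1) = u.1
  rw [map_mul, leviHom_unipotent, leviHom_of_mem hl]
  group

theorem leviHom_levi_mul {l : ContractionGroup P F} (hl : l ∈ leviSubgroup P F)
    (u : unipotentSubgroup P F) : leviHom P F (l * u.1) = l := by
  rw [map_mul, leviHom_unipotent, leviHom_of_mem hl, mul_one]

variable {ε : AddChar F ℂ} [Finite F] (h2 : (2 : F) ≠ 0)

include h2 in
theorem orbitSum_conj (μ : Module.Dual F (nilradical P F)) (g : ContractionGroup P F)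
    (u : unipotentSubgroup P F) :
    orbitSum ε (dualOrbit P μ) (cayley P (conjUnipotent g u)) =
      orbitSum ε (dualOrbit P μ) (cayley P u) := by
  rw [cayley_conjUnipotent h2, orbitSum_act]

include h2 in
theorem orbitSum_mul_comm (μ : Module.Dual F (nilradical P F)) (u v : unipotentSubgroup P F) :
    orbitSum ε (dualOrbit P μ) (cayley P (u * v)) =
      orbitSum ε (dualOrbit P μ) (cayley P (v * u)) := by
  rw [← orbitSum_conj h2 μ v.1 (u * v)]
  congr 2
  refine Subtype.ext ?_
  change v.1 * (u.1 * v.1) * v.1⁻¹ = v.1 * u.1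
  group

include h2 in
theorem orbitSum_mul_of_mem (μ : Module.Dual F (nilradical P F)) (u k : unipotentSubgroup P F)
    (hk : cayley P k ∈ orbitAnnihilator μ) :
    orbitSum ε (dualOrbit P μ) (cayley P (u * k)) = orbitSum ε (dualOrbit P μ) (cayley P u) := by
  have hV := isInvariant_map (W := orbitAnnihilator μ) fun g X hX => act_mem_orbitAnnihilator g hX
  have h3 := (cayley_mul_sub_mem_iff h2 hV u k).2 (coe_mem_map_subtype.2 hk)
  have h4 : cayley P (u * k) - cayley P u ∈ orbitAnnihilator μ := coe_mem_map_subtype.1 h3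
  have h5 : cayley P (u * k) = cayley P u + (cayley P (u * k) - cayley P u) := by abel
  rw [h5]
  exact orbitSum_add_of_annihilated _ h4

include h2 in
-- For `h` in the fixer, `h u h⁻¹ = u k` with the Cayley transform of `k` annihilated by the orbit.
-- An orbit sum therefore ignores a conjugation by `h` that affects only one factor of a product.
theorem orbitSum_mul_conj (μ : Module.Dual F (nilradical P F)) {h : ContractionGroup P F}
    (hh : h ∈ orbitFixer μ) (c u : unipotentSubgroup P F) :
    orbitSum ε (dualOrbit P μ) (cayley P (c * conjUnipotent h u)) =
      orbitSum ε (dualOrbit P μ) (cayley P (c * u)) := by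
  have hV := isInvariant_map (W := orbitAnnihilator μ) fun g X hX => act_mem_orbitAnnihilator g hX
  set k := u⁻¹ * conjUnipotent h u with hk
  have huk : conjUnipotent h u = u * k := (mul_inv_cancel_left _ _).symm
  have hkm : cayley P k ∈ orbitAnnihilator μ := by
    have h3 := (cayley_mul_sub_mem_iff h2 hV u k).1 (by
      rw [← huk, cayley_conjUnipotent h2]
      exact coe_mem_map_subtype.2 (hh.2 (cayley P u)))
    exact coe_mem_map_subtype.1 h3
  rw [huk, ← mul_assoc, orbitSum_mul_of_mem h2 μ _ k hkm]

include h2 in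
-- Up to conjugation by `L`, the unipotent part of `x g x⁻¹` is a product of that of `g` with the
-- unipotent part of `x`, twisted by the Levi part of `g`, and its inverse. After a cyclic
-- permutation the twist may be dropped and the last two factors cancel.
theorem orbitSum_unipotentPart_conj (μ : Module.Dual F (nilradical P F))
    {g : ContractionGroup P F} (hg : leviHom P F g ∈ orbitFixer μ) (x : ContractionGroup P F) :
    orbitSum ε (dualOrbit P μ) (cayley P (unipotentPart P (x * g * x⁻¹))) =
      orbitSum ε (dualOrbit P μ) (cayley P (unipotentPart P g)) := by
  have h3 : unipotentPart P (x * g * x⁻¹) = conjUnipotent (leviHom P F x)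
      (conjUnipotent (leviHom P F g)⁻¹ (unipotentPart P x) *
        (unipotentPart P g * (unipotentPart P x)⁻¹)) := by
    refine Subtype.ext ?_
    change (leviHom P F (x * g * x⁻¹))⁻¹ * (x * g * x⁻¹) =
      leviHom P F x * ((leviHom P F g)⁻¹ * ((leviHom P F x)⁻¹ * x) * (leviHom P F g)⁻¹⁻¹ *
        ((leviHom P F g)⁻¹ * g * ((leviHom P F x)⁻¹ * x)⁻¹)) * (leviHom P F x)⁻¹
    rw [map_mul, map_mul, map_inv]
    group
  rw [h3, orbitSum_conj h2, orbitSum_mul_comm h2, orbitSum_mul_conj h2 μ (inv_mem hg),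
    inv_mul_cancel_right]

end Fixer

/-! ## Supercharacters attached to linear forms -/

section Supercharacters

variable [Finite F] {ε : AddChar F ℂ}

/-- The function on `H ⋉ U^a` attached to a function on `H` and a linear form. -/
def formXi (ε : AddChar F ℂ) (μ : Module.Dual F (nilradical P F))
    (H : Subgroup (ContractionGroup P F)) (θ : H → ℂ) : H.comap (leviHom P F) → ℂ := fun g =>
  θ ⟨leviHom P F g.1, g.2⟩ * orbitSum ε (dualOrbit P μ) (cayley P (unipotentPart P g.1))

/-- The function on `G^a` induced from `formXi`. -/
def formSupercharacter (ε : AddChar F ℂ) (μ : Module.Dual F (nilradical P F))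
    (H : Subgroup (ContractionGroup P F)) (θ : H → ℂ) : ContractionGroup P F → ℂ :=
  induced (H.comap (leviHom P F)) (formXi ε μ H θ)

open Classical in
/-- The sum of the conjugates of a function on `H` under `L`, suitably normalised. -/
def conjugateSum (H : Subgroup (ContractionGroup P F)) (θ : H → ℂ) (h : ContractionGroup P F) : ℂ :=
  (Nat.card (H.comap (leviHom P F)) : ℂ)⁻¹ * ∑ x : ContractionGroup P F,
    if hx : leviHom P F x * h * (leviHom P F x)⁻¹ ∈ H then
      θ ⟨leviHom P F x * h * (leviHom P F x)⁻¹, hx⟩ else 0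

variable (hε : ε ≠ 1) (h2 : (2 : F) ≠ 0)

include h2 in
-- The fixer is normalised by `L` and the orbit sum is invariant under all conjugations that
-- contribute, so it factors out of the induced sum. The fixer enters through the equation `hH`
-- because the type of `θ` depends on `H`, which is later `rookSubgroup`.
theorem formSupercharacter_apply {μ : Module.Dual F (nilradical P F)}
    {H : Subgroup (ContractionGroup P F)} (hH : H = orbitFixer μ) (θ : H → ℂ)
    (g : ContractionGroup P F) :
    formSupercharacter ε μ H θ g = conjugateSum H θ (leviHom P F g) *
      orbitSum ε (dualOrbit P μ) (cayley P (unipotentPart P g)) := by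
  classical
  rw [formSupercharacter, induced, conjugateSum, mul_assoc, Finset.sum_mul]
  congr 1
  refine Finset.sum_congr rfl fun x _ => ?_
  have e : leviHom P F (x * g * x⁻¹) =
      leviHom P F x * leviHom P F g * (leviHom P F x)⁻¹ := by rw [map_mul, map_mul, map_inv]
  by_cases hx : x * g * x⁻¹ ∈ H.comap (leviHom P F)
  · have hx' : leviHom P F x * leviHom P F g * (leviHom P F x)⁻¹ ∈ H := by
      rw [← e]
      exact hx
    have hg : leviHom P F g ∈ orbitFixer μ := by
      rw [hH] at hx'
      exact (conj_mem_orbitFixer_iff (leviHom_mem x)).1 hx'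
    rw [dif_pos hx, dif_pos hx', formXi, orbitSum_unipotentPart_conj h2 μ hg]
    congr 2
    exact Subtype.ext e
  · have hx' : ¬leviHom P F x * leviHom P F g * (leviHom P F x)⁻¹ ∈ H := by
      rw [← e]
      exact hx
    rw [dif_neg hx, dif_neg hx', zero_mul]

include hε h2 in
-- The matrices are tensor products of a representation of `H` with the kernel `|U^a|⁻¹ s(x⁻¹ u y)`.
-- They are multiplicative by the convolution identity; the twist of `u` by `h` in the semidirect
-- product is invisible to `s`, because `h` lies in the fixer.
theorem isSemigroupTrace_formXi {μ : Module.Dual F (nilradical P F)}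
    {H : Subgroup (ContractionGroup P F)} (hH : H = orbitFixer μ) {θ : H → ℂ}
    (hθ : IsIrreducibleCharacter θ) : IsSemigroupTrace (formXi ε μ H θ) := by
  obtain ⟨m, ρ, -, rfl⟩ := hθ
  set N : ℂ := ((Fintype.card (unipotentSubgroup P F) : ℕ) : ℂ) with hN
  have hN0 : N ≠ 0 := Nat.cast_ne_zero.2 Fintype.card_ne_zero
  let R : H → Matrix (Fin m) (Fin m) ℂ := fun h => LinearMap.toMatrix' (ρ h)
  have hR : ∀ g h, R (g * h) = R g * R h := fun g h => by
    simp only [R, map_mul, LinearMap.toMatrix'_mul]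
  set s : unipotentSubgroup P F → ℂ := fun u => orbitSum ε (dualOrbit P μ) (cayley P u) with hs
  refine ⟨unipotentSubgroup P F × Fin m, inferInstance, fun q => Matrix.of fun x y =>
    R ⟨leviHom P F q.1, q.2⟩ x.2 y.2 * (N⁻¹ * s (x.1⁻¹ * unipotentPart P q.1 * y.1)), ?_, ?_⟩
  · intro q q'
    ext ⟨x, i⟩ ⟨z, j⟩
    simp only [Matrix.mul_apply, Matrix.of_apply, Fintype.sum_prod_type]
    have h1 : (⟨leviHom P F (q * q').1, (q * q').2⟩ : H) =
        ⟨leviHom P F q.1, q.2⟩ * ⟨leviHom P F q'.1, q'.2⟩ :=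
      Subtype.ext (map_mul (leviHom P F) q.1 q'.1)
    have h3 : ∀ y, ∑ k, R ⟨leviHom P F q.1, q.2⟩ i k *
          (N⁻¹ * s (x⁻¹ * unipotentPart P q.1 * y)) *
        (R ⟨leviHom P F q'.1, q'.2⟩ k j * (N⁻¹ * s (y⁻¹ * unipotentPart P q'.1 * z))) =
        (R ⟨leviHom P F (q * q').1, (q * q').2⟩ i j * N⁻¹ * N⁻¹) *
          (s (((unipotentPart P q.1)⁻¹ * x)⁻¹ * y) * s (y⁻¹ * (unipotentPart P q'.1 * z))) := by
      intro y
      rw [h1, hR, Matrix.mul_apply, Finset.sum_mul, Finset.sum_mul, Finset.sum_mul]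
      refine Finset.sum_congr rfl fun k _ => ?_
      rw [mul_inv_rev, inv_inv, mul_assoc y⁻¹]
      ring
    rw [Finset.sum_congr rfl fun y _ => h3 y, ← Finset.mul_sum,
      sum_orbitSum_mul_orbitSum hε h2 μ]
    have hq' : leviHom P F q'.1 ∈ orbitFixer μ := hH ▸ q'.2
    have h4 : s (x⁻¹ * unipotentPart P (q * q').1 * z) =
        s (((unipotentPart P q.1)⁻¹ * x)⁻¹ * (unipotentPart P q'.1 * z)) := by
      have h5 : unipotentPart P (q * q').1 = _ := unipotentPart_mul q.1 q'.1
      simp only [hs]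
      rw [h5, mul_assoc, mul_assoc, orbitSum_mul_comm h2, mul_assoc, orbitSum_mul_comm h2,
        orbitSum_mul_conj h2 μ (inv_mem hq'), mul_assoc, orbitSum_mul_comm h2]
      congr 2
      group
    rw [h4]
    field_simp
    rfl
  · intro q
    simp only [Matrix.trace, Matrix.diag, Matrix.of_apply, Fintype.sum_prod_type]
    have h6 : ∀ x : unipotentSubgroup P F, s (x⁻¹ * unipotentPart P q.1 * x) =
        s (unipotentPart P q.1) := by
      intro x
      simp only [hs]
      rw [mul_assoc, orbitSum_mul_comm h2, mul_inv_cancel_right]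
    simp only [h6, ← Finset.sum_mul, Finset.sum_const, Finset.card_univ, nsmul_eq_mul, formXi]
    have h7 : ∑ i, R ⟨leviHom P F q.1, q.2⟩ i i = ρ.character ⟨leviHom P F q.1, q.2⟩ :=
      (LinearMap.trace_eq_matrix_trace ℂ (Pi.basisFun ℂ (Fin m)) _).symm
    rw [h7, ← hN]
    field_simp
    rfl

end Supercharacters

end ParabolicContraction

end

noncomputable section

namespace ParabolicContraction

variable {T : ClassicalType} {n : ℕ} {P : SymPartition T n} {F : Type*} [Field F]

instance [Finite F] (H : Subgroup (ContractionGroup P F)) : Fintype H := Fintype.ofFinite _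

/-! ### Sums over `G^a` split along `L` and `U^a`. -/

section LeviSums

theorem leviHom_mul_unipotent (g : ContractionGroup P F) (u : unipotentSubgroup P F) :
    leviHom P F (g * u.1) = leviHom P F g := by
  rw [map_mul, leviHom_unipotent, mul_one]

theorem unipotentPart_mul_unipotent (g : ContractionGroup P F) (u : unipotentSubgroup P F) :
    unipotentPart P (g * u.1) = unipotentPart P g * u := by
  refine Subtype.ext ?_
  change (leviHom P F (g * u.1))⁻¹ * (g * u.1) = (leviHom P F g)⁻¹ * g * u.1
  rw [leviHom_mul_unipotent, mul_assoc]

theorem leviHom_mul_unipotentPart_mul (g : ContractionGroup P F) (u : unipotentSubgroup P F) :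
    leviHom P F g * (unipotentPart P g * u : unipotentSubgroup P F).1 = g * u.1 := by
  rw [Subgroup.coe_mul, ← mul_assoc, mul_unipotentPart]

variable [Finite F]

/-- Averaging over right translations by `U^a` replaces a bijection of `G^a` with `L × U^a`; this is
the origin of the factor `|U^a|`. -/
theorem sum_mul_leviHom_mul_unipotentPart (ψ f : ContractionGroup P F → ℂ)
    (s : unipotentSubgroup P F → ℂ) :
    (Fintype.card (unipotentSubgroup P F) : ℂ) *
      ∑ g, ψ g * (f (leviHom P F g) * s (unipotentPart P g)) =
      ∑ g, f (leviHom P F g) * ∑ u : unipotentSubgroup P F, ψ (leviHom P F g * u.1) * s u := by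
  have h1 : ∀ u : unipotentSubgroup P F,
      ∑ g, ψ g * (f (leviHom P F g) * s (unipotentPart P g)) =
        ∑ g, ψ (g * u.1) * (f (leviHom P F g) * s (unipotentPart P g * u)) := by
    intro u
    rw [← Equiv.sum_comp (Equiv.mulRight u.1)]
    refine Finset.sum_congr rfl fun g _ => ?_
    rw [Equiv.coe_mulRight, leviHom_mul_unipotent, unipotentPart_mul_unipotent]
  have h2 : (Fintype.card (unipotentSubgroup P F) : ℂ) *
      ∑ g, ψ g * (f (leviHom P F g) * s (unipotentPart P g)) =
      ∑ _u : unipotentSubgroup P F, ∑ g, ψ g * (f (leviHom P F g) * s (unipotentPart P g)) := by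
    rw [Finset.sum_const, Finset.card_univ, nsmul_eq_mul]
  rw [h2, Finset.sum_congr rfl fun u _ => h1 u, Finset.sum_comm]
  refine Finset.sum_congr rfl fun g _ => ?_
  rw [Finset.mul_sum, ← Equiv.sum_comp (Equiv.mulLeft (unipotentPart P g)) fun u =>
    f (leviHom P F g) * (ψ (leviHom P F g * u.1) * s u)]
  refine Finset.sum_congr rfl fun u _ => ?_
  rw [Equiv.coe_mulLeft, leviHom_mul_unipotentPart_mul]
  ring

/-- Averaging over left translations by `H` reduces a sum over `G^a` to one over `H`, for functions
of the Levi part supported on `H`. -/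
theorem card_mul_sum_leviHom {H : Subgroup (ContractionGroup P F)} (hH : H ≤ leviSubgroup P F)
    {f : ContractionGroup P F → ℂ} (hf : ∀ g, g ∉ H → f g = 0) :
    (Fintype.card H : ℂ) * ∑ g, f (leviHom P F g) =
      Fintype.card (H.comap (leviHom P F)) * ∑ h : H, f h.1 := by
  classical
  have h1 : ∀ h : H, ∑ g, f (leviHom P F g) = ∑ g, f (h.1 * leviHom P F g) := by
    intro h
    rw [← Equiv.sum_comp (Equiv.mulLeft h.1)]
    refine Finset.sum_congr rfl fun g _ => ?_
    rw [Equiv.coe_mulLeft, map_mul, leviHom_of_mem (hH h.2)]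
  have h2 : (Fintype.card H : ℂ) * ∑ g, f (leviHom P F g) =
      ∑ _h : H, ∑ g, f (leviHom P F g) := by
    rw [Finset.sum_const, Finset.card_univ, nsmul_eq_mul]
  rw [h2, Finset.sum_congr rfl fun h _ => h1 h, Finset.sum_comm]
  have h3 : ∀ g, ∑ h : H, f (h.1 * leviHom P F g) =
      if g ∈ H.comap (leviHom P F) then ∑ h : H, f h.1 else 0 := by
    intro g
    split_ifs with hg
    · exact Equiv.sum_comp (Equiv.mulRight (⟨leviHom P F g, hg⟩ : H)) fun h : H => f h.1
    · refine Finset.sum_eq_zero fun h _ => hf _ fun hm => hg ?_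
      exact (H.mul_mem_cancel_left h.2).1 hm
  rw [Finset.sum_congr rfl fun g _ => h3 g, ← Finset.sum_filter, Finset.sum_const, nsmul_eq_mul,
    Fintype.card_subtype]

end LeviSums

/-! ### Two supercharacters are equal or orthogonal. -/

section Orthogonality

variable {μ μ' : Module.Dual F (nilradical P F)}

theorem orbitFixer_le : orbitFixer μ ≤ leviSubgroup P F := fun _ h => h.1

/-- Conjugation by an element of `L`, as an automorphism of the fixer of an orbit. -/
def conjOrbitFixer (μ : Module.Dual F (nilradical P F)) (x : ContractionGroup P F) :
    orbitFixer μ ≃* orbitFixer μ where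
  toFun h := ⟨leviHom P F x * h * (leviHom P F x)⁻¹, conj_mem_orbitFixer (leviHom_mem x) h.2⟩
  invFun h := ⟨leviHom P F x⁻¹ * h * (leviHom P F x⁻¹)⁻¹,
    conj_mem_orbitFixer (leviHom_mem x⁻¹) h.2⟩
  left_inv h := Subtype.ext (by simp only [map_inv]; group)
  right_inv h := Subtype.ext (by simp only [map_inv]; group)
  map_mul' h k := Subtype.ext (by simp only [Subgroup.coe_mul]; group)

theorem orbitFixer_congr (h : dualOrbit P μ = dualOrbit P μ') : orbitFixer μ = orbitFixer μ' := by
  have : orbitAnnihilator μ = orbitAnnihilator μ' := by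
    ext X
    change (∀ ν ∈ dualOrbit P μ, ν X = 0) ↔ ∀ ν ∈ dualOrbit P μ', ν X = 0
    rw [h]
  ext g
  change _ ∧ (∀ X, _ ∈ orbitAnnihilator μ) ↔ _ ∧ ∀ X, _ ∈ orbitAnnihilator μ'
  rw [this]

variable [Finite F] {ε : AddChar F ℂ}

theorem formSupercharacter_congr (h : dualOrbit P μ = dualOrbit P μ')
    (H : Subgroup (ContractionGroup P F)) (θ : H → ℂ) :
    formSupercharacter ε μ H θ = formSupercharacter ε μ' H θ := by
  have : formXi ε μ H θ = formXi ε μ' H θ := by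
    funext g
    rw [formXi, formXi, h]
  rw [formSupercharacter, formSupercharacter, this]

theorem conjugateSum_eq_zero (θ : orbitFixer μ → ℂ) {h : ContractionGroup P F}
    (hh : h ∉ orbitFixer μ) : conjugateSum (orbitFixer μ) θ h = 0 := by
  rw [conjugateSum, Finset.sum_eq_zero, mul_zero]
  intro x _
  exact dif_neg fun hx => hh ((conj_mem_orbitFixer_iff (leviHom_mem x)).1 hx)

theorem conjugateSum_eq (θ : orbitFixer μ → ℂ) (h : orbitFixer μ) :
    conjugateSum (orbitFixer μ) θ h = (Nat.card ((orbitFixer μ).comap (leviHom P F)) : ℂ)⁻¹ *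
      ∑ x : ContractionGroup P F, θ (conjOrbitFixer μ x h) := by
  rw [conjugateSum]
  congr 1
  refine Finset.sum_congr rfl fun x _ => ?_
  exact dif_pos (conj_mem_orbitFixer (leviHom_mem x) h.2)

theorem conjugateSum_comp_conjOrbitFixer (θ : orbitFixer μ → ℂ) (y : ContractionGroup P F) :
    conjugateSum (orbitFixer μ) (θ ∘ conjOrbitFixer μ y) = conjugateSum (orbitFixer μ) θ := by
  funext h
  by_cases hh : h ∈ orbitFixer μ
  · have h1 := conjugateSum_eq (θ ∘ conjOrbitFixer μ y) ⟨h, hh⟩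
    have h2 := conjugateSum_eq θ ⟨h, hh⟩
    refine h1.trans (Eq.trans ?_ h2.symm)
    congr 1
    rw [← Equiv.sum_comp (Equiv.mulLeft y) fun x => θ (conjOrbitFixer μ x ⟨h, hh⟩)]
    refine Finset.sum_congr rfl fun x _ => congrArg θ (Subtype.ext ?_)
    change leviHom P F y * (leviHom P F x * h * (leviHom P F x)⁻¹) * (leviHom P F y)⁻¹ =
      leviHom P F (y * x) * h * (leviHom P F (y * x))⁻¹
    rw [map_mul]
    group
  · rw [conjugateSum_eq_zero _ hh, conjugateSum_eq_zero _ hh]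

theorem conjugateSum_one {θ : orbitFixer μ → ℂ} (hθ : θ 1 ≠ 0) :
    conjugateSum (orbitFixer μ) θ 1 ≠ 0 := by
  have h1 := conjugateSum_eq θ 1
  rw [OneMemClass.coe_one] at h1
  rw [h1]
  simp only [map_one, Finset.sum_const, Finset.card_univ, nsmul_eq_mul]
  exact mul_ne_zero (inv_ne_zero (Nat.cast_ne_zero.2 Nat.card_pos.ne'))
    (mul_ne_zero (Nat.cast_ne_zero.2 Fintype.card_ne_zero) hθ)

variable (hε : ε ≠ 1) (h2 : (2 : F) ≠ 0)

include h2 in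
theorem formSupercharacter_one_ne_zero {H : Subgroup (ContractionGroup P F)}
    (hH : H = orbitFixer μ) {θ : H → ℂ} (hθ : IsIrreducibleCharacter θ) :
    formSupercharacter ε μ H θ 1 ≠ 0 := by
  subst hH
  obtain ⟨m, hm, hm'⟩ := hθ.one_pos
  obtain ⟨k, hk, hk'⟩ := orbitSum_zero_pos (ε := ε) μ
  have h1 : unipotentPart P (1 : ContractionGroup P F) = 1 := by
    refine Subtype.ext ?_
    change (leviHom P F 1)⁻¹ * 1 = 1
    rw [map_one, inv_one, mul_one]
  rw [formSupercharacter_apply h2 rfl, h1, cayley_one, hk', map_one]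
  refine mul_ne_zero (conjugateSum_one ?_) (Nat.cast_ne_zero.2 hk.ne')
  rw [hm']
  exact Nat.cast_ne_zero.2 hm.ne'

include hε h2 in
theorem isCharacter_formSupercharacter {H : Subgroup (ContractionGroup P F)}
    (hH : H = orbitFixer μ) {θ : H → ℂ} (hθ : IsIrreducibleCharacter θ) :
    IsCharacter (formSupercharacter ε μ H θ) :=
  (isSemigroupTrace_formXi hε h2 hH hθ).induced.isCharacter
    (formSupercharacter_one_ne_zero h2 hH hθ)

include hε h2 in
theorem charInner_formSupercharacter_of_disjoint {H H' : Subgroup (ContractionGroup P F)}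
    (hH : H = orbitFixer μ) (hH' : H' = orbitFixer μ')
    (hd : Disjoint (dualOrbit P μ) (dualOrbit P μ')) (θ : H → ℂ) (θ' : H' → ℂ) :
    charInner (formSupercharacter ε μ H θ) (formSupercharacter ε μ' H' θ') = 0 := by
  have h0 := sum_orbitSum_mul_star_eq_zero hε hd
  rw [← Function.Bijective.sum_comp (cayley_bijective h2)
    (fun X => orbitSum ε (dualOrbit P μ) X * star (orbitSum ε (dualOrbit P μ') X))] at h0
  have h1 := sum_mul_leviHom_mul_unipotentPart (P := P) (F := F) (fun _ => 1)
    (fun h => conjugateSum H θ h * star (conjugateSum H' θ' h))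
    (fun u => orbitSum ε (dualOrbit P μ) (cayley P u) *
      star (orbitSum ε (dualOrbit P μ') (cayley P u)))
  simp only [one_mul, h0, mul_zero, Finset.sum_const_zero] at h1
  rw [charInner]
  refine mul_eq_zero_of_right _ (Eq.trans (Finset.sum_congr rfl fun g _ => ?_)
    ((mul_eq_zero.1 h1).resolve_left (Nat.cast_ne_zero.2 Fintype.card_ne_zero)))
  rw [formSupercharacter_apply h2 hH, formSupercharacter_apply h2 hH', star_mul']
  ring

/-- If a conjugate of `θ` under `L` were equal to a conjugate of `θ'`, the conjugate sums would
coincide. So all conjugates of `θ` are orthogonal to all conjugates of `θ'`. -/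
theorem sum_conjugateSum_mul_star_eq_zero {θ θ' : orbitFixer μ → ℂ}
    (hθ : IsIrreducibleCharacter θ) (hθ' : IsIrreducibleCharacter θ')
    (hne : conjugateSum (orbitFixer μ) θ ≠ conjugateSum (orbitFixer μ) θ') :
    ∑ g, conjugateSum (orbitFixer μ) θ (leviHom P F g) *
      star (conjugateSum (orbitFixer μ) θ' (leviHom P F g)) = 0 := by
  have h1 := card_mul_sum_leviHom (orbitFixer_le (μ := μ))
    (f := fun h => conjugateSum (orbitFixer μ) θ h * star (conjugateSum (orbitFixer μ) θ' h))
    fun g hg => by rw [conjugateSum_eq_zero _ hg, zero_mul]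
  have h3 : ∀ x y, ∑ h, θ (conjOrbitFixer μ x h) * star (θ' (conjOrbitFixer μ y h)) = 0 := by
    intro x y
    have h4 := (hθ.comp_mulEquiv (conjOrbitFixer μ x)).charInner_eq_zero
      (hθ'.comp_mulEquiv (conjOrbitFixer μ y)) fun h => hne (by
        rw [← conjugateSum_comp_conjOrbitFixer θ x, h, conjugateSum_comp_conjOrbitFixer])
    rw [charInner] at h4
    exact (mul_eq_zero.1 h4).resolve_left
      (inv_ne_zero (Nat.cast_ne_zero.2 Fintype.card_ne_zero))
  have h5 : ∑ h : orbitFixer μ, conjugateSum (orbitFixer μ) θ h *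
      star (conjugateSum (orbitFixer μ) θ' h) = 0 := by
    simp only [conjugateSum_eq, star_mul', star_sum]
    have h6 : ∀ (c d : ℂ) (h : orbitFixer μ), c * (∑ x, θ (conjOrbitFixer μ x h)) *
        (d * ∑ y, star (θ' (conjOrbitFixer μ y h))) =
        c * d * ∑ x, ∑ y, θ (conjOrbitFixer μ x h) * star (θ' (conjOrbitFixer μ y h)) := by
      intro c d h
      rw [← Finset.sum_mul_sum]
      ring
    rw [Finset.sum_congr rfl fun h _ => h6 _ _ h, ← Finset.mul_sum]
    refine mul_eq_zero_of_right _ ?_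
    rw [Finset.sum_comm]
    refine Finset.sum_eq_zero fun x _ => ?_
    rw [Finset.sum_comm]
    exact Finset.sum_eq_zero fun y _ => h3 x y
  rw [h5, mul_zero] at h1
  exact (mul_eq_zero.1 h1).resolve_left (Nat.cast_ne_zero.2 Fintype.card_ne_zero)

include hε h2 in
-- Different orbits are orthogonal over `U^a`, and for one orbit different conjugate sums are
-- orthogonal over the fixer. Equality is a genuine case: conjugate `θ` give the same function.
theorem formSupercharacter_eq_or_charInner_eq_zero {H H' : Subgroup (ContractionGroup P F)}
    (hH : H = orbitFixer μ) (hH' : H' = orbitFixer μ') {θ : H → ℂ} {θ' : H' → ℂ}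
    (hθ : IsIrreducibleCharacter θ) (hθ' : IsIrreducibleCharacter θ') :
    formSupercharacter ε μ H θ = formSupercharacter ε μ' H' θ' ∨
      charInner (formSupercharacter ε μ H θ) (formSupercharacter ε μ' H' θ') = 0 := by
  rcases dualOrbit_eq_or_disjoint μ μ' with h | h
  swap
  · exact Or.inr (charInner_formSupercharacter_of_disjoint hε h2 hH hH' h θ θ')
  rw [← orbitFixer_congr h, ← hH] at hH'
  subst hH'
  rw [← formSupercharacter_congr h]
  subst hH
  by_cases hne : conjugateSum (orbitFixer μ) θ = conjugateSum (orbitFixer μ) θ'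
  · refine Or.inl ?_
    funext g
    rw [formSupercharacter_apply h2 rfl, formSupercharacter_apply h2 rfl, hne]
  · refine Or.inr ?_
    have h1 := sum_mul_leviHom_mul_unipotentPart (P := P) (F := F) (fun _ => 1)
      (fun h => conjugateSum (orbitFixer μ) θ h * star (conjugateSum (orbitFixer μ) θ' h))
      (fun u => orbitSum ε (dualOrbit P μ) (cayley P u) *
        star (orbitSum ε (dualOrbit P μ) (cayley P u)))
    simp only [one_mul, ← Finset.sum_mul, sum_conjugateSum_mul_star_eq_zero hθ hθ' hne,
      zero_mul] at h1
    rw [charInner]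
    refine mul_eq_zero_of_right _ (Eq.trans (Finset.sum_congr rfl fun g _ => ?_)
      ((mul_eq_zero.1 h1).resolve_left (Nat.cast_ne_zero.2 Fintype.card_ne_zero)))
    rw [formSupercharacter_apply h2 rfl, formSupercharacter_apply h2 rfl, star_mul']
    ring

end Orthogonality

/-! ### The supercharacters separate functions constant on superclasses. -/

section Separation

theorem act_mem_idealOf {h : ContractionGroup P F} (g : (ContractionAlgebra P F)ˣ)
    {X : nilradical P F} (hX : X ∈ idealOf P h) : act P g X ∈ idealOf P h := by
  rw [idealOf, Submodule.mem_sInf] at hX ⊢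
  exact fun W hW => hW.1 g X (hX W hW)

theorem act_sub_mem_idealOf (h : ContractionGroup P F) (X : nilradical P F) :
    act P (Unitary.toUnits h) X - X ∈ idealOf P h := by
  rw [idealOf, Submodule.mem_sInf]
  exact fun W hW => hW.2.2 X

/-- The Lie ideal condition in `idealOf` follows from invariance by linearising the action of `1 ±
Y`, so it need not be checked. -/
theorem idealOf_le (h2 : (2 : F) ≠ 0) {h : ContractionGroup P F}
    {W : Submodule F (nilradical P F)}
    (hW : ∀ g : (ContractionAlgebra P F)ˣ, ∀ X ∈ W, act P g X ∈ W)
    (hh : ∀ X, act P (Unitary.toUnits h) X - X ∈ W) : idealOf P h ≤ W := by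
  refine sInf_le ⟨hW, fun X hX Y Z hZ => ?_, hh⟩
  rw [← coe_mem_map_subtype, hZ]
  exact (isInvariant_map hW).lie_mem h2 (coe_mem_map_subtype.2 hX) Y.2

/-- Functions on `G^a` that have the invariance properties of functions which are constant on the
superclasses. -/
structure IsSuperInvariant (ψ : ContractionGroup P F → ℂ) : Prop where
  conj_eq : ∀ l ∈ leviSubgroup P F, ∀ h ∈ leviSubgroup P F, ∀ u : unipotentSubgroup P F,
    ψ (l * h * l⁻¹ * u.1) = ψ (h * u.1)
  act_eq : ∀ h ∈ leviSubgroup P F, ∀ (g : (ContractionAlgebra P F)ˣ) (u v : unipotentSubgroup P F),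
    cayley P v = act P g (cayley P u) → ψ (h * v.1) = ψ (h * u.1)
  mul_eq : ∀ h ∈ leviSubgroup P F, ∀ u k : unipotentSubgroup P F, cayley P k ∈ idealOf P h →
    ψ (h * (u * k : unipotentSubgroup P F).1) = ψ (h * u.1)

variable [Finite F] {ε : AddChar F ℂ} (hε : ε ≠ 1) (h2 : (2 : F) ≠ 0) {ψ : ContractionGroup P F → ℂ}

include h2 in
-- As a function of `h` the sum is a class function on the fixer. The hypothesis says that it is
-- orthogonal to all irreducible characters of the fixer.
theorem IsSuperInvariant.sum_mul_star_orbitSum_eq_zero (hψ : IsSuperInvariant ψ)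
    (μ : Module.Dual F (nilradical P F))
    (h0 : ∀ θ : orbitFixer μ → ℂ, IsIrreducibleCharacter θ →
      charInner ψ (formSupercharacter ε μ (orbitFixer μ) θ) = 0)
    {h : ContractionGroup P F} (hh : h ∈ orbitFixer μ) :
    ∑ u : unipotentSubgroup P F, ψ (h * u.1) *
      star (orbitSum ε (dualOrbit P μ) (cayley P u)) = 0 := by
  classical
  set Ψ : ContractionGroup P F → ℂ := fun h => ∑ u : unipotentSubgroup P F, ψ (h * u.1) *
      star (orbitSum ε (dualOrbit P μ) (cayley P u)) with hΨ
  have hinv : ∀ l ∈ leviSubgroup P F, ∀ h ∈ leviSubgroup P F, Ψ (l * h * l⁻¹) = Ψ h := by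
    intro l hl h hh
    exact Finset.sum_congr rfl fun u _ => by rw [hψ.conj_eq l hl h hh u]
  -- The inverse turns the complex conjugate of `θ` in the inner product into `θ` itself.
  suffices hz : (fun h : orbitFixer μ => Ψ h.1⁻¹) = 0 by
    have := congrFun hz ⟨h, hh⟩⁻¹
    rwa [Pi.zero_apply, Subgroup.coe_inv, inv_inv] at this
  refine eq_zero_of_orthogonal (fun g k => ?_) fun θ hθ => ?_
  · have := hinv k.1 k.2.1 g.1⁻¹ (inv_mem g.2.1)
    rw [← this]
    congr 1
    simp only [Subgroup.coe_mul, Subgroup.coe_inv]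
    group
  have hstar : ∀ g, star (θ g) = θ g⁻¹ := by
    obtain ⟨m, ρ, -, rfl⟩ := hθ
    exact star_character ρ
  have h1 := h0 θ hθ
  rw [charInner] at h1
  have h3 := (mul_eq_zero.1 h1).resolve_left
    (inv_ne_zero (Nat.cast_ne_zero.2 Fintype.card_ne_zero))
  simp only [formSupercharacter_apply h2 (rfl : orbitFixer μ = orbitFixer μ), star_mul'] at h3
  have h4 := sum_mul_leviHom_mul_unipotentPart ψ
    (fun h => star (conjugateSum (orbitFixer μ) θ h))
    (fun u => star (orbitSum ε (dualOrbit P μ) (cayley P u)))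
  rw [h3, mul_zero] at h4
  have h5 := card_mul_sum_leviHom (orbitFixer_le (μ := μ))
    (f := fun h => star (conjugateSum (orbitFixer μ) θ h) * Ψ h)
    fun g hg => by rw [conjugateSum_eq_zero _ hg, star_zero, zero_mul]
  rw [← h4, mul_zero] at h5
  have h6 := (mul_eq_zero.1 h5.symm).resolve_left (Nat.cast_ne_zero.2 Fintype.card_ne_zero)
  simp only [conjugateSum_eq, star_mul', star_sum, mul_assoc, Finset.sum_mul] at h6
  rw [← Finset.mul_sum, Finset.sum_comm] at h6
  have h7 : ∀ x : ContractionGroup P F, ∑ h : orbitFixer μ,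
      star (θ (conjOrbitFixer μ x h)) * Ψ h.1 = ∑ h : orbitFixer μ, Ψ h.1⁻¹ * θ h := by
    intro x
    rw [← Equiv.sum_comp (Equiv.inv _) fun h : orbitFixer μ => Ψ h.1⁻¹ * θ h]
    refine Eq.trans (Finset.sum_congr rfl fun h _ => ?_)
      (Equiv.sum_comp (conjOrbitFixer μ x).toEquiv
        fun h : orbitFixer μ => Ψ (Equiv.inv (orbitFixer μ) h).1⁻¹ * θ (Equiv.inv (orbitFixer μ) h))
    have e : Ψ (conjOrbitFixer μ x h).1 = Ψ h.1 := hinv _ (leviHom_mem x) _ h.2.1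
    rw [hstar, ← e, mul_comm]
    simp only [Equiv.inv_apply, Subgroup.coe_inv, inv_inv]
    rfl
  have h8 : star (Nat.card ((orbitFixer μ).comap (leviHom P F)) : ℂ)⁻¹ ≠ 0 :=
    star_ne_zero.2 (inv_ne_zero (Nat.cast_ne_zero.2 Nat.card_pos.ne'))
  have h9 := (mul_eq_zero.1 h6).resolve_left h8
  rw [Finset.sum_congr rfl fun x _ => h7 x, Finset.sum_const, Finset.card_univ, nsmul_eq_mul] at h9
  exact (mul_eq_zero.1 h9).resolve_left (Nat.cast_ne_zero.2 Fintype.card_ne_zero)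

include hε h2 in
-- For each `h` in `L` all Fourier coefficients of `u ↦ ψ (h u)`, transported to `u^a`, turn out to
-- vanish; then Fourier inversion applies.
theorem IsSuperInvariant.eq_zero (hψ : IsSuperInvariant ψ)
    (h0 : ∀ μ : Module.Dual F (nilradical P F), ∀ h ∈ orbitFixer μ,
      ∑ u : unipotentSubgroup P F, ψ (h * u.1) *
        star (orbitSum ε (dualOrbit P μ) (cayley P u)) = 0) : ψ = 0 := by
  classical
  have key : ∀ h ∈ leviSubgroup P F, ∀ ν : Module.Dual F (nilradical P F),
      ∑ u : unipotentSubgroup P F, ψ (h * u.1) * ε (-ν (cayley P u)) = 0 := by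
    intro h hh ν
    -- If `ν` vanishes on the ideal of `h`, then `h` fixes its orbit; the coefficient is constant
    -- along the orbit and hence a multiple of the sum in `h0`. Otherwise invariance of `ψ` under
    -- translation by the ideal kills it.
    by_cases hν : ∀ X ∈ idealOf P h, ν X = 0
    · have hfix : h ∈ orbitFixer ν := by
        refine ⟨hh, fun X => ?_⟩
        rintro _ ⟨g, rfl⟩
        exact hν _ (act_mem_idealOf _ (act_sub_mem_idealOf h X))
      have h1 := h0 ν h hfix
      obtain ⟨m, hm, hsum⟩ := exists_sum_dualAct_eq (ε := ε) ν
      have h3 : ∀ g : (ContractionAlgebra P F)ˣ,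
          ∑ u : unipotentSubgroup P F, ψ (h * u.1) * ε (-ν (cayley P u)) =
          ∑ u : unipotentSubgroup P F, ψ (h * u.1) * star (ε (dualAct g ν (cayley P u))) := by
        intro g
        let e := Equiv.ofBijective _ (cayley_bijective (P := P) h2)
        let a : nilradical P F ≃ nilradical P F :=
          ⟨act P (star g), act P (star g)⁻¹, fun X => by rw [← act_mul, inv_mul_cancel, act_one],
            fun X => by rw [← act_mul, mul_inv_cancel, act_one]⟩
        rw [← Equiv.sum_comp ((e.trans a).trans e.symm)]
        refine Finset.sum_congr rfl fun u _ => ?_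
        have hc : cayley P (((e.trans a).trans e.symm) u) = act P (star g) (cayley P u) :=
          e.apply_symm_apply _
        rw [hc, hψ.act_eq h hh _ _ _ hc, star_addChar, dualAct_apply]
      have h4 : (Fintype.card (ContractionAlgebra P F)ˣ : ℂ) *
          ∑ u : unipotentSubgroup P F, ψ (h * u.1) * ε (-ν (cayley P u)) = 0 := by
        rw [← nsmul_eq_mul, ← Finset.card_univ, ← Finset.sum_const,
          Finset.sum_congr rfl fun g _ => h3 g, Finset.sum_comm]
        simp only [← Finset.mul_sum, ← star_sum, hsum, star_mul']
        have h5 : ∀ u : unipotentSubgroup P F, ψ (h * u.1) *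
            (star (m : ℂ) * star (orbitSum ε (dualOrbit P ν) (cayley P u))) =
            star (m : ℂ) * (ψ (h * u.1) * star (orbitSum ε (dualOrbit P ν) (cayley P u))) :=
          fun u => by ring
        rw [Finset.sum_congr rfl fun u _ => h5 u, ← Finset.mul_sum, h1, mul_zero]
      exact (mul_eq_zero.1 h4).resolve_left (Nat.cast_ne_zero.2 Fintype.card_ne_zero)
    · push Not at hν
      obtain ⟨X, hX, hνX⟩ := hν
      let e := Equiv.ofBijective _ (cayley_bijective (P := P) h2)
      have hV := isInvariant_map (W := idealOf P h) fun g X hX => act_mem_idealOf g hX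
      -- Translation of the Cayley transform by `c • X` stays in a coset of the group of the ideal,
      -- so `ψ` does not change while the character picks up a factor, which is not `1` for a
      -- suitable `c`.
      have h1 : ∀ c : F, ∑ u : unipotentSubgroup P F, ψ (h * u.1) * ε (-ν (cayley P u)) =
          ε (ν (c • X)) * ∑ u : unipotentSubgroup P F, ψ (h * u.1) * ε (-ν (cayley P u)) := by
        intro c
        refine (Equiv.sum_comp ((e.trans (Equiv.subRight (c • X))).trans e.symm) _).symm.trans ?_
        rw [Finset.mul_sum]
        refine Finset.sum_congr rfl fun u _ => ?_
        set v := ((e.trans (Equiv.subRight (c • X))).trans e.symm) u with hv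
        have hc : cayley P v = cayley P u - c • X := e.apply_symm_apply _
        have hu : u = v * (v⁻¹ * u) := (mul_inv_cancel_left _ _).symm
        have hk : cayley P (v⁻¹ * u) ∈ idealOf P h := by
          rw [← coe_mem_map_subtype, ← cayley_mul_sub_mem_iff h2 hV, ← hu, hc]
          have : ((cayley P u).1 - (cayley P u - c • X : nilradical P F).1) =
              (c • X : nilradical P F).1 := by
            rw [Submodule.coe_sub, sub_sub_cancel]
          rw [this, coe_mem_map_subtype]
          exact Submodule.smul_mem _ _ hX
        have h3 : ψ (h * u.1) = ψ (h * v.1) := by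
          have := hψ.mul_eq h hh v _ hk
          rwa [← hu] at this
        rw [h3, hc, map_sub, neg_sub, sub_eq_add_neg, AddChar.map_add_eq_mul]
        ring
      obtain ⟨c, hc⟩ := AddChar.ne_one_iff.1 hε
      have h3 := h1 (c / ν X)
      rw [map_smul, smul_eq_mul, div_mul_cancel₀ _ hνX] at h3
      by_contra hne
      exact hc (mul_right_cancel₀ hne (h3.symm.trans (one_mul _).symm))
  funext g
  -- Fourier inversion at the unipotent part of `g`.
  have h1 : ∑ ν : Module.Dual F (nilradical P F), ε (ν (cayley P (unipotentPart P g))) *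
      ∑ u : unipotentSubgroup P F, ψ (leviHom P F g * u.1) * ε (-ν (cayley P u)) = 0 :=
    Finset.sum_eq_zero fun ν _ => by rw [key _ (leviHom_mem g), mul_zero]
  simp only [Finset.mul_sum] at h1
  rw [Finset.sum_comm] at h1
  have h3 : ∀ u : unipotentSubgroup P F, ∑ ν : Module.Dual F (nilradical P F),
      ε (ν (cayley P (unipotentPart P g))) * (ψ (leviHom P F g * u.1) * ε (-ν (cayley P u))) =
      if u = unipotentPart P g then
        Fintype.card (Module.Dual F (nilradical P F)) * ψ (leviHom P F g * u.1) else 0 := by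
    intro u
    have h4 : ∀ ν : Module.Dual F (nilradical P F),
        ε (ν (cayley P (unipotentPart P g))) * (ψ (leviHom P F g * u.1) * ε (-ν (cayley P u))) =
        ψ (leviHom P F g * u.1) * ε (ν (cayley P (unipotentPart P g) - cayley P u)) := by
      intro ν
      rw [map_sub, sub_eq_add_neg, AddChar.map_add_eq_mul]
      ring
    rw [Finset.sum_congr rfl fun ν _ => h4 ν, ← Finset.mul_sum, sum_addChar_dual hε, mul_ite,
      mul_zero, mul_comm]
    by_cases hu : u = unipotentPart P g
    · rw [if_pos hu, hu, sub_self, if_pos rfl]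
    · rw [if_neg hu, if_neg fun h => hu (cayley_injective h2 (sub_eq_zero.1 h)).symm]
  rw [Finset.sum_congr rfl fun u _ => h3 u, Finset.sum_eq_single (unipotentPart P g)
    (fun u _ hu => if_neg hu) fun h => absurd (Finset.mem_univ _) h, if_pos rfl,
    mul_unipotentPart] at h1
  exact (mul_eq_zero.1 h1).resolve_left (Nat.cast_ne_zero.2 Fintype.card_ne_zero)

end Separation

end ParabolicContraction

end

noncomputable section

namespace ParabolicContraction

variable {T : ClassicalType} {n : ℕ} {P : SymPartition T n} {F : Type*} [Field F]

/-! ## Diagonal elements and skew matrix units -/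

section Units

theorem coe_neg (i : Idx T n) : (-i).1 = -i.1 := rfl

theorem sgn_mul_sgn_neg_of_eq_C (hT : T = ClassicalType.C) (i : Idx T n) :
    sgn F i * sgn F (-i) = -1 := by
  have h0 : i.1 ≠ 0 := fun h => by
    have := i.2.2 h
    rw [hT] at this
    cases this
  simp only [sgn, hT, true_and, coe_neg]
  split_ifs <;> first | omega | simp

theorem sgn_of_ne_C (hT : T ≠ ClassicalType.C) (i : Idx T n) : sgn F i = 1 := by
  simp [sgn, hT]

theorem windCoeff_of_block_eq_left {i k : Idx T n} (h : P.block i = P.block k) (j : Idx T n) :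
    windCoeff P F i k j = 1 := by
  simp [windCoeff, wind, h]

theorem windCoeff_of_block_eq_right {k j : Idx T n} (h : P.block k = P.block j) (i : Idx T n) :
    windCoeff P F i k j = 1 := by
  simp [windCoeff, wind, h]

/-- The diagonal elements. -/
def diagonalElement (P : SymPartition T n) (c : Idx T n → F) : ContractionAlgebra P F :=
  fun i j => if i = j then c i else 0

theorem diagonalElement_entry (c : Idx T n → F) (i j : Idx T n) :
    diagonalElement P c i j = if i = j then c i else 0 := rfl

theorem diagonalElement_mul_entry (c : Idx T n → F) (X : ContractionAlgebra P F) (i j : Idx T n) :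
    (diagonalElement P c * X) i j = c i * X i j := by
  rw [mul_entry, Finset.sum_eq_single i]
  · rw [diagonalElement_entry, if_pos rfl, windCoeff_left, one_mul]
  · intro k _ hk
    rw [diagonalElement_entry, if_neg (Ne.symm hk), zero_mul, mul_zero]
  · exact fun h => absurd (Finset.mem_univ _) h

theorem mul_diagonalElement_entry (c : Idx T n → F) (X : ContractionAlgebra P F) (i j : Idx T n) :
    (X * diagonalElement P c) i j = c j * X i j := by
  rw [mul_entry, Finset.sum_eq_single j]
  · rw [diagonalElement_entry, if_pos rfl, windCoeff_right, one_mul, mul_comm]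
  · intro k _ hk
    rw [diagonalElement_entry, if_neg hk, mul_zero, mul_zero]
  · exact fun h => absurd (Finset.mem_univ _) h

theorem star_diagonalElement (c : Idx T n → F) :
    star (diagonalElement P c) = diagonalElement P fun i => c (-i) := by
  ext i j
  rw [star_entry, diagonalElement_entry, diagonalElement_entry]
  by_cases h : i = j
  · subst h
    rw [if_pos rfl, if_pos rfl, sgn_mul_self, one_mul]
  · rw [if_neg h, if_neg (fun h' => h (neg_injective h').symm), mul_zero]

theorem diagonalElement_conj_entry (c : Idx T n → F) (X : ContractionAlgebra P F) (i j : Idx T n) :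
    (diagonalElement P c * X * star (diagonalElement P c)) i j = c i * c (-j) * X i j := by
  rw [star_diagonalElement, mul_diagonalElement_entry, diagonalElement_mul_entry]
  ring

theorem isUnit_diagonalElement {c : Idx T n → F} (hc : ∀ i, c i ≠ 0) :
    IsUnit (diagonalElement P c) := by
  have key : ∀ c : Idx T n → F, (∀ i, c i ≠ 0) →
      diagonalElement P c * diagonalElement P (fun i => (c i)⁻¹) = 1 := by
    intro c hc
    ext i j
    rw [diagonalElement_mul_entry, diagonalElement_entry, one_entry]
    split_ifs
    · exact mul_inv_cancel₀ (hc i)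
    · rw [mul_zero]
  refine ⟨⟨_, _, key c hc, ?_⟩, rfl⟩
  have := key (fun i => (c i)⁻¹) fun i => inv_ne_zero (hc i)
  simpa only [inv_inv] using this

/-- The skew element `E_{ab} - E_{ab}†`. -/
def skewUnit (P : SymPartition T n) (F : Type*) [Field F] (a b : Idx T n) :
    ContractionAlgebra P F := matrixUnit P (a, b) - star (matrixUnit P (a, b))

theorem skewUnit_entry (a b i j : Idx T n) : skewUnit P F a b i j =
    (if i = a ∧ j = b then 1 else 0) -
      sgn F a * sgn F b * (if i = -b ∧ j = -a then 1 else 0) := by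
  rw [skewUnit, sub_entry, matrixUnit_entry, star_matrixUnit, smul_entry, matrixUnit_entry,
    sgn_neg_mul_sgn_neg]

theorem star_skewUnit (a b : Idx T n) : star (skewUnit P F a b) = -skewUnit P F a b := by
  rw [skewUnit, star_sub, star_star, neg_sub]

theorem skewUnit_mem {a b : Idx T n} (h : P.block a ≠ P.block b) :
    skewUnit P F a b ∈ nilradical P F := by
  refine ⟨star_skewUnit a b, fun i j hij => ?_⟩
  rw [skewUnit_entry, if_neg, if_neg, mul_zero, sub_zero]
  · rintro ⟨rfl, rfl⟩
    rw [P.block_neg, P.block_neg] at hij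
    omega
  · rintro ⟨rfl, rfl⟩
    exact h hij

theorem skewUnit_neg (a b : Idx T n) :
    skewUnit P F (-b) (-a) = -(sgn F a * sgn F b) • skewUnit P F a b := by
  ext i j
  rw [smul_entry, skewUnit_entry, skewUnit_entry, sgn_neg_mul_sgn_neg, neg_neg, neg_neg]
  linear_combination -(if i = -b ∧ j = -a then (1 : F) else 0) * sgn_mul_self (F := F) a -
    (if i = -b ∧ j = -a then (1 : F) else 0) * sgn F a * sgn F a * sgn_mul_self (F := F) b

theorem skewUnit_neg_mem_iff {V : Submodule F (ContractionAlgebra P F)} (a b : Idx T n) :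
    skewUnit P F (-b) (-a) ∈ V ↔ skewUnit P F a b ∈ V := by
  rw [skewUnit_neg]
  refine V.smul_mem_iff (neg_ne_zero.2 fun h => ?_)
  have := sgn_mul_self (F := F) a
  have h' := sgn_mul_self (F := F) b
  have : (1 : F) = 0 := by
    linear_combination (sgn F a * sgn F b) * h - h' * sgn F a * sgn F a - this
  exact one_ne_zero this

theorem IsRoot.eq_C {γ : Idx T n × Idx T n} (h : IsRoot γ) (h' : γ.2 = -γ.1) :
    T = ClassicalType.C := by
  have hv : γ.2.1 = -γ.1.1 := congrArg Subtype.val h'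
  rcases h with (h | h) | (h | h)
  · omega
  · exact h.1
  · simp only [Prod.fst_swap, Prod.snd_swap] at h
    omega
  · exact h.1

theorem conjPair_eq_iff (γ : Idx T n × Idx T n) : conjPair γ = γ ↔ γ.2 = -γ.1 := by
  rw [conjPair, Prod.ext_iff]
  constructor
  · exact fun h => h.2.symm
  · exact fun h => ⟨by rw [h, neg_neg], h.symm⟩

theorem rootVector_of_ne {γ : Idx T n × Idx T n} (h : γ.2 ≠ -γ.1) :
    rootVector P (F := F) γ = skewUnit P F γ.1 γ.2 := by
  rw [rootVector, if_neg (mt (conjPair_eq_iff γ).1 h), skewUnit, star_matrixUnit,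
    sgn_neg_mul_sgn_neg, neg_smul, sub_eq_add_neg]
  rfl

theorem two_smul_rootVector_of_eq {γ : Idx T n × Idx T n} (hT : T = ClassicalType.C)
    (h : γ.2 = -γ.1) : (2 : F) • rootVector P (F := F) γ = skewUnit P F γ.1 γ.2 := by
  rw [rootVector, if_pos ((conjPair_eq_iff γ).2 h), zero_smul, add_zero, skewUnit, star_matrixUnit,
    sgn_neg_mul_sgn_neg, h, sgn_mul_sgn_neg_of_eq_C hT, neg_neg, neg_one_smul, sub_neg_eq_add,
    two_smul, ← h]

theorem rootVector_mem_iff (h2 : (2 : F) ≠ 0) {V : Submodule F (ContractionAlgebra P F)}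
    {γ : Idx T n × Idx T n} (h : IsRoot γ) :
    rootVector P γ ∈ V ↔ skewUnit P F γ.1 γ.2 ∈ V := by
  by_cases h' : γ.2 = -γ.1
  · rw [← two_smul_rootVector_of_eq (h.eq_C h') h', V.smul_mem_iff h2]
  · rw [rootVector_of_ne h']

theorem isUnit_one_add_matrixUnit {a b : Idx T n} (h : a ≠ b) :
    IsUnit (1 + matrixUnit P (F := F) (a, b)) ∧ IsUnit (1 - matrixUnit P (F := F) (a, b)) := by
  have h0 : matrixUnit P (F := F) (a, b) * matrixUnit P (a, b) = 0 := by
    ext i j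
    rw [matrixUnit_mul_entry, matrixUnit_entry, if_neg (c := b = a ∧ j = b) fun h' => h h'.1.symm,
      mul_zero, ite_self]
    rfl
  have hn : IsNilpotent (matrixUnit P (F := F) (a, b)) := ⟨2, by rw [pow_two, h0]⟩
  exact ⟨hn.isUnit_one_add, hn.isUnit_one_sub⟩

end Units

/-! ## Invariant subspaces and the root vectors they contain -/

section Moves

variable (h2 : (2 : F) ≠ 0) {V : Submodule F (ContractionAlgebra P F)} (hV : IsInvariant P F V)

include h2 hV

/-- The derivation of the matrix unit at `(i, b)` moves row `b` to row `i`. At an antidiagonal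
position `a = -b` the element `skewUnit` is twice a matrix unit in type C, and zero in the
orthogonal types, so nothing could be deduced there. -/
theorem IsInvariant.row_move {i b a : Idx T n} (h : skewUnit P F b a ∈ V) (hib : i ≠ b)
    (hw : windCoeff P F i b a = 1) (hab : a ≠ -b ∨ T = ClassicalType.C) :
    skewUnit P F i a ∈ V := by
  obtain ⟨hu, hu'⟩ := isUnit_one_add_matrixUnit (P := P) (F := F) hib
  have h1 := hV.derivation_mem h2 hu hu' h
  have h3 : matrixUnit P (i, b) * skewUnit P F b a + skewUnit P F b a * star (matrixUnit P (i, b)) =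
      matrixUnit P (i, b) * skewUnit P F b a - star (matrixUnit P (i, b) * skewUnit P F b a) := by
    rw [star_mul, star_skewUnit, neg_mul, sub_neg_eq_add]
  rw [h3] at h1
  by_cases hab' : a = -b
  · have hT := hab.resolve_left (not_not.2 hab')
    have h4 : matrixUnit P (i, b) * skewUnit P F b a = (2 : F) • matrixUnit P (F := F) (i, a) := by
      ext x y
      rw [matrixUnit_mul_entry, skewUnit_entry, smul_entry, matrixUnit_entry, hab', neg_neg,
        sgn_mul_sgn_neg_of_eq_C hT]
      by_cases hx : x = i
      · by_cases hy : y = -b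
        · subst hy
          rw [hab'] at hw
          simp [hx, hw]
          norm_num
        · simp [hx, hy]
      · simp [hx]
    rw [h4, star_smul_entry, ← smul_sub] at h1
    exact (V.smul_mem_iff h2).1 h1
  · have h4 : matrixUnit P (i, b) * skewUnit P F b a = matrixUnit P (F := F) (i, a) := by
      ext x y
      rw [matrixUnit_mul_entry, skewUnit_entry, matrixUnit_entry]
      have hb : b ≠ -a := fun h => hab' (by rw [h, neg_neg])
      by_cases hx : x = i
      · by_cases hy : y = a
        · subst hy
          simp [hx, hw, hb]
        · simp [hx, hy, hb]
      · simp [hx]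
    rwa [h4] at h1

/-- The conjugate position `(-a, -b)` turns columns into rows. -/
theorem IsInvariant.column_move {b a j : Idx T n} (h : skewUnit P F b a ∈ V) (haj : a ≠ j)
    (hw : windCoeff P F b a j = 1) (hab : a ≠ -b ∨ T = ClassicalType.C) :
    skewUnit P F b j ∈ V := by
  rw [← skewUnit_neg_mem_iff] at h ⊢
  refine hV.row_move h2 h (neg_injective.ne haj.symm) ?_ (hab.imp_left fun h h' => h ?_)
  · rwa [windCoeff_neg]
  · rw [h', neg_neg]

/-- Subtracting the conjugate by a diagonal sign change at `x` keeps exactly the entries with either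
row `x` or column `-x`, but not both. Doing this at `b` and at `-a` leaves only `(b, a)` and its
conjugate position. Antidiagonal entries cannot be reached, since the sign enters them twice. -/
theorem IsInvariant.isolate {Z : ContractionAlgebra P F} (hZ : Z ∈ V) {b a : Idx T n}
    (hba : a ≠ -b) (h0 : Z b a ≠ 0) : skewUnit P F b a ∈ V := by
  have hflip : ∀ (x : Idx T n) (Y : ContractionAlgebra P F), Y ∈ V →
      ∃ Y' ∈ V, ∀ i j, Y' i j = (if i = x then (if j = -x then 0 else 2) else
        (if j = -x then 2 else 0)) * Y i j := by
    intro x Y hY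
    have hc : ∀ i, (if i = x then (-1 : F) else 1) ≠ 0 := by
      intro i
      split_ifs
      · exact neg_ne_zero.2 one_ne_zero
      · exact one_ne_zero
    refine ⟨_, V.sub_mem hY (hV.conj_mem _ (isUnit_diagonalElement (P := P) hc) Y hY), ?_⟩
    intro i j
    rw [sub_entry, diagonalElement_conj_entry]
    have : -j = x ↔ j = -x := neg_eq_iff_eq_neg
    simp only [this]
    split_ifs <;> ring
  obtain ⟨Y, hY, hYe⟩ := hflip b Z hZ
  obtain ⟨Y', hY', hYe'⟩ := hflip (-a) Y hY
  have hskew := nilradical_entry (hV.le hZ).1 b a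
  -- Each of the two sign changes contributes a factor `2`.
  have key : Y' = (4 * Z b a) • skewUnit P F b a := by
    ext i j
    rw [hYe', hYe, smul_entry, skewUnit_entry, neg_neg]
    have hba' : b ≠ -a := fun h => hba (by rw [h, neg_neg])
    by_cases h1 : i = b
    · subst h1
      by_cases h3 : j = a
      · subst h3
        simp [hba, hba']
        ring
      · simp [hba', h3]
    · by_cases h3 : i = -a
      · subst h3
        by_cases h4 : j = -b
        · subst h4
          have h5 : -b ≠ a := fun h => hba h.symm
          simp only [h5, h1, if_true, if_false, and_true, and_false, hskew]
          ring
        · simp [h1, h4]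
      · by_cases h4 : j = a
        · subst h4
          simp [h1, h3, hba]
        · simp [h1, h3, h4]
  rw [key] at hY'
  refine (V.smul_mem_iff (mul_ne_zero ?_ h0)).1 hY'
  have : (4 : F) = 2 * 2 := by norm_num
  rw [this]
  exact mul_ne_zero h2 h2

/-- If an invariant subspace does not contain the root vector of `(i, j)`, the entries of its
elements at other positions on the arc from `i` to `j` are zero. -/
theorem IsInvariant.entry_eq_zero_of_path {i j : Idx T n} (hij : skewUnit P F i j ∉ V)
    {Z : ContractionAlgebra P F} (hZ : Z ∈ V) {b a : Idx T n} (hw : windCoeff P F i b j = 1)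
    (hw' : windCoeff P F b a j = 1) (hba : a ≠ -b) : Z b a = 0 := by
  by_contra h0
  have h1 := hV.isolate h2 hZ hba h0
  have hc := windCoeff_cocycle P (F := F) i b a j
  rw [hw, hw', one_mul] at hc
  have hia : windCoeff P F i a j = 1 := by
    rcases windCoeff_eq_zero_or_one P (F := F) i a j with h | h
    · rw [h, zero_mul] at hc
      exact absurd hc zero_ne_one
    · exact h
  have hiba : windCoeff P F i b a = 1 := by rwa [hia, one_mul] at hc
  refine hij ?_
  -- The row is moved before the column, unless the intermediate position `(i, a)` is antidiagonal
  -- in an orthogonal type; then the column goes first. If `(b, j)` is antidiagonal too, then `(i,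
  -- j)` is already the conjugate of `(b, a)`.
  by_cases hA : a ≠ -i ∨ T = ClassicalType.C
  · have h3 : skewUnit P F i a ∈ V := by
      by_cases hib : i = b
      · rwa [hib]
      · exact hV.row_move h2 h1 hib hiba (Or.inl hba)
    by_cases haj : a = j
    · rwa [← haj]
    · exact hV.column_move h2 h3 haj hia hA
  · push Not at hA
    have h3 : skewUnit P F b j ∈ V := by
      by_cases haj : a = j
      · rwa [← haj]
      · exact hV.column_move h2 h1 haj hw' (Or.inl hba)
    by_cases hib : i = b
    · rwa [hib]
    · by_cases hjb : j = -b
      · rw [← skewUnit_neg_mem_iff, hjb, neg_neg, ← hA.1]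
        exact h1
      · exact hV.row_move h2 h3 hib hw (Or.inl hjb)

end Moves

end ParabolicContraction

end

noncomputable section

namespace ParabolicContraction

variable {T : ClassicalType} {n : ℕ} {P : SymPartition T n} {F : Type*} [Field F]

/-! ### Elements of `L` acting trivially modulo an invariant subspace. -/

section LeviEntries

variable {h : ContractionGroup P F} (hL : h ∈ leviSubgroup P F)

include hL in
theorem levi_conj_matrixUnit_entry (c d b a : Idx T n) :
    (h.1 * matrixUnit P (c, d) * star h.1 : ContractionAlgebra P F) b a =
      h.1 b c * (star h.1 : ContractionAlgebra P F) d a := by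
  have hL' : (star h.1 : ContractionAlgebra P F) d a ≠ 0 → P.block d = P.block a := by
    intro h0
    by_contra hne
    exact h0 (levi_entry P (inv_mem hL) d a hne)
  rw [mul_entry, Finset.sum_eq_single d]
  · rw [mul_matrixUnit_entry, if_pos rfl]
    by_cases h1 : P.block b = P.block c
    · by_cases h3 : (star h.1 : ContractionAlgebra P F) d a = 0
      · rw [h3, mul_zero, mul_zero, mul_zero]
      · rw [windCoeff_of_block_eq_left h1, windCoeff_of_block_eq_right (hL' h3), one_mul, one_mul]
    · rw [levi_entry P hL b c h1, mul_zero, zero_mul, mul_zero]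
  · intro k _ hk
    rw [mul_matrixUnit_entry, if_neg hk, zero_mul, mul_zero]
  · exact fun h => absurd (Finset.mem_univ _) h

include hL in
-- The factor `sgn F c * sgn F (-c)` is `1` in the orthogonal types and `-1` in type C, so the
-- entries of the action of `h` are its 2×2 minors or 2×2 permanents, compared with those of the
-- identity.
theorem levi_conj_skewUnit_entry (b c d e : Idx T n) :
    (sgn F (-d) * sgn F (-e)) * (h.1 * skewUnit P F c (-d) * star h.1 - skewUnit P F c (-d) :
      ContractionAlgebra P F) b (-e) =
      h.1 b c * h.1 e d - sgn F c * sgn F (-c) * (h.1 b d * h.1 e c) -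
        ((if b = c ∧ e = d then 1 else 0) -
          sgn F c * sgn F (-c) * (if b = d ∧ e = c then 1 else 0)) := by
  have h1 : h.1 * skewUnit P F c (-d) * star h.1 =
      h.1 * matrixUnit P (c, -d) * star h.1 -
        (sgn F c * sgn F (-d)) • (h.1 * matrixUnit P (d, -c) * star h.1) := by
    rw [skewUnit, star_matrixUnit, sgn_neg_mul_sgn_neg, neg_neg, mul_sub, sub_mul,
      mul_smul_comm, smul_mul_assoc]
  rw [h1, sub_entry, sub_entry, smul_entry, levi_conj_matrixUnit_entry hL,
    levi_conj_matrixUnit_entry hL, skewUnit_entry, star_entry, star_entry]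
  simp only [neg_neg, neg_inj]
  have hd := sgn_mul_self (F := F) (-d)
  have he := sgn_mul_self (F := F) (-e)
  have e1 : (sgn F (-d) * sgn F (-e)) * (if b = c ∧ e = d then (1 : F) else 0) =
      if b = c ∧ e = d then 1 else 0 := by
    split_ifs with hh
    · rw [hh.2, hd, one_mul]
    · rw [mul_zero]
  have e3 : sgn F (-e) * (if b = d ∧ e = c then (1 : F) else 0) =
      sgn F (-c) * (if b = d ∧ e = c then (1 : F) else 0) := by
    split_ifs with hh
    · rw [hh.2]
    · rw [mul_zero, mul_zero]
  linear_combination (h.1 b c * h.1 e d * sgn F (-e) * sgn F (-e) -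
      sgn F c * sgn F (-c) * h.1 b d * h.1 e c * sgn F (-e) * sgn F (-e)) * hd +
    (h.1 b c * h.1 e d - sgn F c * sgn F (-c) * (h.1 b d * h.1 e c)) * he - e1 +
    sgn F (-d) * sgn F (-d) * sgn F c * e3 +
    sgn F c * sgn F (-c) * (if b = d ∧ e = c then (1 : F) else 0) * hd

theorem mul_entry_neg_of_row {g : ContractionGroup P F} {a : Idx T n}
    (hg : ∀ d, d ≠ -a → g.1 (-a) d = 0) (d : Idx T n) :
    g.1 d a * g.1 (-a) (-a) = if d = a then 1 else 0 := by
  have h1 : (g.1 * star g.1 : ContractionAlgebra P F) = 1 := Unitary.mul_star_self_of_mem g.2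
  have h3 : (g.1 * star g.1 : ContractionAlgebra P F) d a = g.1 d a * g.1 (-a) (-a) := by
    rw [mul_entry, Finset.sum_eq_single a]
    · rw [windCoeff_right, star_entry, sgn_mul_self, one_mul, one_mul]
    · intro k _ hk
      rw [star_entry, hg _ (neg_injective.ne hk), mul_zero, mul_zero, mul_zero]
    · exact fun h => absurd (Finset.mem_univ _) h
  rw [← h3, h1, one_entry]

end LeviEntries

section Arcs

theorem inArc_iff {γ : Idx T n × Idx T n} (hγ : P.block γ.1 ≠ P.block γ.2) (b : Idx T n) :
    InArc P γ (P.block b) ↔ windCoeff P F γ.1 b γ.2 = 1 := by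
  have h : windCoeff P F γ.1 b γ.2 = 1 ↔ wind P γ.1 b + wind P b γ.2 = wind P γ.1 γ.2 := by
    unfold windCoeff
    split_ifs with h <;> simp [h]
  rw [h, InArc]
  clear h
  unfold wind
  split_ifs <;> constructor <;> intro h <;> first | omega | exact h.elim

theorem inArc_left (γ : Idx T n × Idx T n) (hγ : P.block γ.1 ≠ P.block γ.2) :
    InArc P γ (P.block γ.1) := by
  unfold InArc
  omega

theorem inArc_right (γ : Idx T n × Idx T n) (hγ : P.block γ.1 ≠ P.block γ.2) :
    InArc P γ (P.block γ.2) := by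
  unfold InArc
  omega

theorem exists_third {k : ℤ} (hk : P.size k ≠ 2) {b c : Idx T n} (hbc : b ≠ c)
    (hb : P.block b = k) (hc : P.block c = k) : ∃ e, P.block e = k ∧ e ≠ b ∧ e ≠ c := by
  by_contra hne
  push Not at hne
  refine hk (Nat.card_eq_two_iff.2 ⟨⟨b, hb⟩, ⟨c, hc⟩, fun h => hbc (congrArg Subtype.val h), ?_⟩)
  ext ⟨e, he⟩
  simp only [Set.mem_insert_iff, Set.mem_singleton_iff, Set.mem_univ, iff_true, Subtype.mk.injEq]
  by_contra hh
  push Not at hh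
  exact hh.2 (hne e he hh.1)

theorem size_neg (P : SymPartition T n) (k : ℤ) : P.size (-k) = P.size k := by
  refine Nat.card_congr ⟨fun i => ⟨-i.1, ?_⟩, fun i => ⟨-i.1, ?_⟩, fun i => ?_, fun i => ?_⟩
  · rw [P.block_neg, i.2, neg_neg]
  · rw [P.block_neg, i.2]
  · simp
  · simp

/-- An arc between opposite blocks that meets no other blocks either passes the ends `ℓ` and `-ℓ`,
whence the block is `-ℓ`, or passes the middle, whence it is `1` and `I_0` is empty. These are the
two cases covered by `Admissible`. -/
theorem size_ne_two_of_arc (hP : P.Admissible) (hT : T ≠ ClassicalType.C)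
    {γ : Idx T n × Idx T n} (hγ : P.block γ.1 ≠ P.block γ.2)
    (hγ' : P.block γ.2 = -P.block γ.1)
    (harc : ∀ z, InArc P γ (P.block z) → P.block z = P.block γ.1 ∨ P.block z = -P.block γ.1) :
    P.size (P.block γ.1) ≠ 2 := by
  obtain ⟨h1, h3⟩ := hP hT
  have hle := P.block_le γ.1
  have hle' := P.block_le γ.2
  rcases lt_or_gt_of_ne hγ with hk | hk
  · obtain ⟨w, hw⟩ := P.exists_block P.len (by omega) le_rfl
    have := harc w (by unfold InArc; omega)
    have hw' : P.block γ.1 = -(P.len : ℤ) := by omega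
    rw [hw', size_neg]
    exact h1 (by omega)
  · obtain ⟨w, hw⟩ := P.exists_block 1 le_rfl (by omega)
    have := harc w (by unfold InArc; omega)
    have hw' : P.block γ.1 = 1 := by omega
    rw [hw']
    refine h3 (Nat.card_eq_zero.2 (Or.inl ⟨?_⟩))
    rintro ⟨z, hz⟩
    have := harc z (by unfold InArc; omega)
    omega

end Arcs

section Fixers

variable (h2 : (2 : F) ≠ 0) {V : Submodule F (ContractionAlgebra P F)} (hV : IsInvariant P F V)
  {h : ContractionGroup P F} (hL : h ∈ leviSubgroup P F)
  (hh : ∀ X ∈ nilradical P F, h.1 * X * star h.1 - X ∈ V)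

include h2 hV hL hh

theorem levi_minor_eq {i j : Idx T n} (hij : skewUnit P F i j ∉ V) {b c d e : Idx T n}
    (hw : windCoeff P F i b j = 1) (hw' : windCoeff P F b (-e) j = 1) (hbe : b ≠ e)
    (hcd : P.block c ≠ P.block (-d)) :
    h.1 b c * h.1 e d - sgn F c * sgn F (-c) * (h.1 b d * h.1 e c) =
      (if b = c ∧ e = d then 1 else 0) -
        sgn F c * sgn F (-c) * (if b = d ∧ e = c then 1 else 0) := by
  rw [← sub_eq_zero, ← levi_conj_skewUnit_entry hL,
    hV.entry_eq_zero_of_path h2 hij (hh _ (skewUnit_mem hcd)) hw hw'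
      (neg_injective.ne hbe.symm), mul_zero]

/-- As `b` and `-a` lie in different blocks, one product in each minor vanishes and `h b c * h (-a)
d` is a Kronecker delta. Hence rows `b` and `-a` of `h` are diagonal, and unitarity passes from row
`-a` to column `a`. -/
theorem levi_diag_of_path {i j : Idx T n} (hij : skewUnit P F i j ∉ V) {b a : Idx T n}
    (hw : windCoeff P F i b j = 1) (hw' : windCoeff P F b a j = 1)
    (hb : P.block b ≠ P.block a) (hb' : P.block b ≠ -P.block a) :
    (∀ c, c ≠ b → h.1 b c = 0) ∧ (∀ d, d ≠ a → h.1 d a = 0) ∧ h.1 b b = h.1 a a := by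
  have key : ∀ c d, P.block c = P.block b → P.block d = -P.block a →
      h.1 b c * h.1 (-a) d = if b = c ∧ -a = d then 1 else 0 := by
    intro c d hc hd
    have hbd : P.block b ≠ P.block d := by omega
    have h1 := levi_minor_eq h2 hV hL hh hij (b := b) (c := c) (d := d) (e := -a) hw
      (by rwa [neg_neg]) (fun h => hb' (by rw [h, P.block_neg])) (by rw [P.block_neg]; omega)
    rwa [levi_entry P hL b d hbd, zero_mul, mul_zero, sub_zero,
      if_neg (c := b = d ∧ -a = c) (fun h => hbd (by rw [h.1])), mul_zero, sub_zero] at h1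
  have h1 := key b (-a) rfl (P.block_neg a)
  rw [if_pos ⟨rfl, rfl⟩] at h1
  have hb0 : h.1 b b ≠ 0 := left_ne_zero_of_mul_eq_one h1
  have ha0 : h.1 (-a) (-a) ≠ 0 := right_ne_zero_of_mul_eq_one h1
  have hrow : ∀ d, d ≠ -a → h.1 (-a) d = 0 := by
    intro d hd
    by_cases hbl : P.block (-a) = P.block d
    · have h3 := key b d rfl (by rw [← hbl, P.block_neg])
      rw [if_neg fun h => hd h.2.symm] at h3
      exact (mul_eq_zero.1 h3).resolve_left hb0
    · exact levi_entry P hL _ _ hbl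
  refine ⟨fun c hc => ?_, fun d hd => ?_, ?_⟩
  · by_cases hbl : P.block b = P.block c
    · have h3 := key c (-a) hbl.symm (P.block_neg a)
      rw [if_neg fun h => hc h.1.symm] at h3
      exact (mul_eq_zero.1 h3).resolve_right ha0
    · exact levi_entry P hL _ _ hbl
  · have h3 := mul_entry_neg_of_row hrow d
    rw [if_neg hd] at h3
    exact (mul_eq_zero.1 h3).resolve_right ha0
  · have h3 := mul_entry_neg_of_row hrow a
    rw [if_pos rfl] at h3
    exact mul_right_cancel₀ ha0 (h1.trans h3.symm)

/-- Every block of the arc is neither equal nor opposite to at least one of the blocks of `x` and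
`y`, so it can be compared with that one. -/
theorem isScalarOnArc_of_two {γ : Idx T n × Idx T n} (hγ : P.block γ.1 ≠ P.block γ.2)
    (hij : skewUnit P F γ.1 γ.2 ∉ V) {x y : Idx T n} (hx : InArc P γ (P.block x))
    (hy : InArc P γ (P.block y)) (hxy : P.block x ≠ P.block y) (hxy' : P.block x ≠ -P.block y) :
    IsScalarOnArc P γ h.1 := by
  have key : ∀ z w, InArc P γ (P.block z) → InArc P γ (P.block w) → P.block z ≠ P.block w →
      P.block z ≠ -P.block w → h.1 z z = h.1 w w ∧
        ∀ z', InArc P γ (P.block z') → P.block z = P.block z' → z ≠ z' → h.1 z z' = 0 := by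
    intro z w hz hw hzw hzw'
    rcases le_total (arcLength P w γ.2) (arcLength P z γ.2) with hl | hl
    · have := levi_diag_of_path h2 hV hL hh hij ((inArc_iff hγ z).1 hz)
        (windCoeff_eq_one_of_le P hl) hzw hzw'
      exact ⟨this.2.2, fun z' _ _ hne => this.1 z' hne.symm⟩
    · refine ⟨?_, fun z' hz' hbl hne => ?_⟩
      · exact (levi_diag_of_path h2 hV hL hh hij ((inArc_iff hγ w).1 hw)
          (windCoeff_eq_one_of_le P hl) (Ne.symm hzw) (by omega)).2.2.symm
      · have hl' : arcLength P z' γ.2 ≤ arcLength P w γ.2 := by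
          have : arcLength P z' γ.2 = arcLength P z γ.2 := by
            unfold arcLength wind
            rw [hbl]
          rwa [this]
        exact (levi_diag_of_path h2 hV hL hh hij ((inArc_iff hγ w).1 hw)
          (windCoeff_eq_one_of_le P hl') (by omega) (by omega)).2.1 z hne
  refine ⟨h.1 x x, fun z z' hz hz' => ?_⟩
  have hxy1 := (key x y hx hy hxy hxy').1
  by_cases hzx : P.block z ≠ P.block x ∧ P.block z ≠ -P.block x
  · obtain ⟨h1, h3⟩ := key z x hz hx hzx.1 hzx.2
    split_ifs with he
    · rw [← he, h1]
    · by_cases hbl : P.block z = P.block z'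
      · exact h3 z' hz' hbl he
      · exact levi_entry P hL z z' hbl
  · obtain ⟨h1, h3⟩ := key z y hz hy (by omega) (by omega)
    split_ifs with he
    · rw [← he, h1, hxy1]
    · by_cases hbl : P.block z = P.block z'
      · exact h3 z' hz' hbl he
      · exact levi_entry P hL z z' hbl

omit h2 hV hh in
-- By unitarity the block opposite to one with scalar `c` has the scalar `c⁻¹`, which is `c` again.
theorem isScalarOnArc_of_block {γ : Idx T n × Idx T n}
    (harc : ∀ z, InArc P γ (P.block z) → P.block z = P.block γ.1 ∨ P.block z = -P.block γ.1)
    {c : F} (hc : c * c = 1)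
    (hsc : ∀ b e, P.block b = P.block γ.1 → P.block e = P.block γ.1 →
      h.1 b e = if b = e then c else 0) : IsScalarOnArc P γ h.1 := by
  refine ⟨c, fun z z' hz hz' => ?_⟩
  by_cases hbl : P.block z = P.block z'
  swap
  · rw [levi_entry P hL z z' hbl, if_neg fun h => hbl (by rw [h])]
  rcases harc z' hz' with h1 | h1
  · exact hsc z z' (hbl.trans h1) h1
  · have hz1 : P.block (-z') = P.block γ.1 := by rw [P.block_neg, h1, neg_neg]
    have h3 := mul_entry_neg_of_row (g := h) (a := z') (fun d hd => by
      by_cases hd' : P.block (-z') = P.block d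
      · rw [hsc _ _ hz1 (hd'.symm.trans hz1), if_neg (Ne.symm hd)]
      · exact levi_entry P hL _ _ hd') z
    rw [hsc _ _ hz1 hz1, if_pos rfl] at h3
    have h4 : h.1 z z' = (if z = z' then 1 else 0) * c := by
      rw [← h3, mul_assoc, hc, mul_one]
    rw [h4, ite_mul, one_mul, zero_mul]

/-- All 2×2 minors of a diagonal block of `h` are those of the identity. This forces a scalar `±1`
once the block has at least three rows; for two rows it only says that the determinant is `1`, and
hence the assumption on the sizes. -/
theorem isScalarOnArc_of_ne_C (hT : T ≠ ClassicalType.C) (hP : P.Admissible)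
    {γ : Idx T n × Idx T n} (hγ : P.block γ.1 ≠ P.block γ.2) (hγ' : P.block γ.2 = -P.block γ.1)
    (hij : skewUnit P F γ.1 γ.2 ∉ V)
    (harc : ∀ z, InArc P γ (P.block z) → P.block z = P.block γ.1 ∨ P.block z = -P.block γ.1) :
    IsScalarOnArc P γ h.1 := by
  have hsize := size_ne_two_of_arc hP hT hγ hγ' harc
  -- In the orthogonal types the skew element at an antidiagonal position is zero and so lies in
  -- `V`. Hence the block contains two different labels.
  have hne : -γ.2 ≠ γ.1 := by
    intro hne
    refine hij ?_
    have : skewUnit P F γ.1 γ.2 = 0 := by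
      ext x y
      rw [skewUnit_entry, sgn_of_ne_C hT, sgn_of_ne_C hT, hne, ← hne, neg_neg, one_mul, one_mul]
      exact sub_self _
    rw [this]
    exact V.zero_mem
  have hbl : P.block (-γ.2) = P.block γ.1 := by rw [P.block_neg, hγ', neg_neg]
  have hM : ∀ b e c d, P.block b = P.block γ.1 → P.block e = P.block γ.1 →
      P.block c = P.block γ.1 → P.block d = P.block γ.1 → b ≠ e →
      h.1 b c * h.1 e d - h.1 b d * h.1 e c =
        (if b = c ∧ e = d then 1 else 0) - (if b = d ∧ e = c then 1 else 0) := by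
    intro b e c d hb he hc hd hbe
    have h1 := levi_minor_eq h2 hV hL hh hij (b := b) (c := c) (d := d) (e := e)
      (windCoeff_of_block_eq_left hb.symm _)
      (windCoeff_of_block_eq_right (by rw [P.block_neg, he, hγ']) _) hbe
      (by rw [P.block_neg]; omega)
    rwa [sgn_of_ne_C hT, sgn_of_ne_C hT, one_mul, one_mul, one_mul] at h1
  have hoff : ∀ b f, P.block b = P.block γ.1 → P.block f = P.block γ.1 → b ≠ f →
      h.1 b f = 0 := by
    intro b f hb hf hbf
    obtain ⟨e, he, heb, hef⟩ := exists_third hsize hbf hb hf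
    have m1 := hM b e b e hb he hb he heb.symm
    have m2 := hM b e f e hb he hf he heb.symm
    have m3 := hM b e f b hb he hf hb heb.symm
    simp only [hbf, heb, hef, heb.symm, if_true, if_false, and_true, and_false,
      sub_zero] at m1 m2 m3
    -- This expands the vanishing determinant with rows `b`, `b`, `e` and columns `f`, `b`, `e`
    -- along its first row.
    linear_combination (-h.1 b f) * m1 + h.1 b b * m2 - h.1 b e * m3
  have hdiag : ∀ b e, P.block b = P.block γ.1 → P.block e = P.block γ.1 → b ≠ e →
      h.1 b b * h.1 e e = 1 := by
    intro b e hb he hbe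
    have m1 := hM b e b e hb he hb he hbe
    rw [hoff b e hb he hbe, zero_mul, sub_zero, if_pos ⟨rfl, rfl⟩,
      if_neg fun h => hbe h.1, sub_zero] at m1
    exact m1
  have hdiag' : ∀ b f, P.block b = P.block γ.1 → P.block f = P.block γ.1 → b ≠ f →
      h.1 b b = h.1 f f := by
    intro b f hb hf hbf
    obtain ⟨e, he, heb, hef⟩ := exists_third hsize hbf hb hf
    have m1 := hdiag b e hb he heb.symm
    have m2 := hdiag f e hf he hef.symm
    exact mul_right_cancel₀ (right_ne_zero_of_mul_eq_one m1) (m1.trans m2.symm)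
  refine isScalarOnArc_of_block hL harc (c := h.1 γ.1 γ.1) ?_ fun b e hb he => ?_
  · have m1 := hdiag _ _ hbl rfl hne
    rwa [hdiag' _ _ hbl rfl hne] at m1
  · split_ifs with hbe
    · subst hbe
      by_cases hb' : b = γ.1
      · rw [hb']
      · exact hdiag' b γ.1 hb rfl hb'
    · exact hoff b e hb he hbe

omit hL hh in
-- `isolate` does not reach antidiagonal entries. Sandwiching with the matrix unit at `(c, b)`
-- instead carries the entry to `(c, -c)` and kills all other entries; this needs a second label `c`
-- in the block.
theorem IsInvariant.antidiagonal_entry_eq_zero (hT : T = ClassicalType.C) {i j : Idx T n}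
    (hij : skewUnit P F i j ∉ V) {Z : ContractionAlgebra P F} (hZ : Z ∈ V) {b c : Idx T n}
    (hb : P.block b = P.block i) (hb' : P.block (-b) = P.block j) (hc : P.block c = P.block b)
    (hcb : c ≠ b) : Z b (-b) = 0 := by
  by_contra h0
  obtain ⟨hu, hu'⟩ := isUnit_one_add_matrixUnit (P := P) (F := F) hcb
  have h1 := hV.sandwich_mem h2 hu hu' hZ
  have hcn : P.block (-c) = P.block (-b) := by rw [P.block_neg, P.block_neg, hc]
  have h3 : (2 : F) • (matrixUnit P (c, b) * Z * star (matrixUnit P (c, b))) =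
      (sgn F c * sgn F b * Z b (-b)) • skewUnit P F c (-c) := by
    ext x y
    rw [star_matrixUnit, mul_smul_comm, smul_entry, smul_entry, smul_entry, skewUnit_entry,
      sgn_mul_sgn_neg_of_eq_C hT, sgn_neg_mul_sgn_neg, mul_matrixUnit_entry, matrixUnit_mul_entry,
      neg_neg]
    by_cases hx : x = c
    · by_cases hy : y = -c
      · subst hx hy
        rw [windCoeff_of_block_eq_left hc, windCoeff_of_block_eq_right hcn.symm]
        simp only [if_true, and_self]
        ring
      · simp [hy]
    · simp [hx]
  have h4 : skewUnit P F c (-c) ∈ V := by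
    refine (V.smul_mem_iff ?_).1 (h3 ▸ V.smul_mem (2 : F) h1)
    have hs : ∀ x : Idx T n, sgn F x ≠ 0 := fun x hx => by
      have := sgn_mul_self (F := F) x
      rw [hx, zero_mul] at this
      exact zero_ne_one this
    exact mul_ne_zero (mul_ne_zero (hs c) (hs b)) h0
  have h5 : skewUnit P F i (-c) ∈ V := by
    by_cases hic : i = c
    · rwa [hic]
    · exact hV.row_move h2 h4 hic (windCoeff_of_block_eq_left (by omega) _) (Or.inr hT)
  refine hij ?_
  by_cases hcj : -c = j
  · rwa [← hcj]
  · exact hV.column_move h2 h5 hcj (windCoeff_of_block_eq_right (hcn.trans hb') _) (Or.inr hT)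

/-- In type C all 2×2 permanents, including those with a repeated row, agree with the identity. With
a repeated row they give `2 h_bf² = 0` off the diagonal and `h_bb² = 1` on it, whatever the size of
the block. -/
theorem isScalarOnArc_of_eq_C (hT : T = ClassicalType.C)
    {γ : Idx T n × Idx T n} (hγ : P.block γ.1 ≠ P.block γ.2) (hγ' : P.block γ.2 = -P.block γ.1)
    (hij : skewUnit P F γ.1 γ.2 ∉ V)
    (harc : ∀ z, InArc P γ (P.block z) → P.block z = P.block γ.1 ∨ P.block z = -P.block γ.1) :
    IsScalarOnArc P γ h.1 := by
  have hanti : ∀ b c d, P.block b = P.block γ.1 → P.block c = P.block γ.1 →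
      P.block d = P.block γ.1 →
      (h.1 * skewUnit P F c (-d) * star h.1 - skewUnit P F c (-d) :
        ContractionAlgebra P F) b (-b) = 0 := by
    intro b c d hb hc hd
    have hmem := hh _ (skewUnit_mem (P := P) (F := F) (a := c) (b := -d)
      (by rw [P.block_neg]; omega))
    -- In a block with a single label the difference `Z` is itself a multiple of the root vector.
    by_cases hex : ∃ e, P.block e = P.block b ∧ e ≠ b
    · obtain ⟨e, he, heb⟩ := hex
      exact hV.antidiagonal_entry_eq_zero h2 hT hij hmem hb (by rw [P.block_neg, hb, hγ']) he heb
    · push Not at hex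
      have hc' := hex c (hc.trans hb.symm)
      have hd' := hex d (hd.trans hb.symm)
      have hi := hex γ.1 hb.symm
      have hj : γ.2 = -b := by
        rw [← hex (-γ.2) (by rw [P.block_neg, hγ', neg_neg, hb]), neg_neg]
      rw [hc', hd'] at hmem ⊢
      rw [hi, hj] at hij
      set Z := h.1 * skewUnit P F b (-b) * star h.1 - skewUnit P F b (-b) with hZ
      by_contra h0
      refine hij ((V.smul_mem_iff h0).1 (?_ : Z b (-b) • skewUnit P F b (-b) ∈ V))
      have hsk : skewUnit P F b (-b) = (2 : F) • matrixUnit P (F := F) (b, -b) := by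
        rw [skewUnit, star_matrixUnit, sgn_neg_mul_sgn_neg, sgn_mul_sgn_neg_of_eq_C hT, neg_neg,
          neg_one_smul, sub_neg_eq_add, two_smul]
      have : Z b (-b) • skewUnit P F b (-b) = (2 : F) • Z := by
        have hZ' : Z = (2 : F) • (h.1 * matrixUnit P (b, -b) * star h.1) -
            (2 : F) • matrixUnit P (F := F) (b, -b) := by
          rw [hZ, hsk, mul_smul_comm, smul_mul_assoc]
        ext x y
        rw [hsk, smul_entry, smul_entry, smul_entry, hZ', sub_entry, sub_entry, smul_entry,
          smul_entry, smul_entry, smul_entry, levi_conj_matrixUnit_entry hL,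
          levi_conj_matrixUnit_entry hL, matrixUnit_entry, matrixUnit_entry]
        by_cases hx : x = b
        · by_cases hy : y = -b
          · subst hx hy
            simp only [and_self, if_true]
            ring
          · have hy' : (star h.1 : ContractionAlgebra P F) (-b) y = 0 := by
              refine levi_entry P (inv_mem hL) (-b) y fun hbl => hy ?_
              rw [← hex (-y) (by rw [P.block_neg, ← hbl, P.block_neg, neg_neg]), neg_neg]
            simp [hy, hy']
        · have hx' : h.1 x b = 0 := levi_entry P hL x b fun hbl => hx (hex x hbl)
          simp [hx, hx']
      rw [this]
      exact V.smul_mem _ hmem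
  have hM : ∀ b e c d, P.block b = P.block γ.1 → P.block e = P.block γ.1 →
      P.block c = P.block γ.1 → P.block d = P.block γ.1 →
      h.1 b c * h.1 e d + h.1 b d * h.1 e c =
        (if b = c ∧ e = d then 1 else 0) + (if b = d ∧ e = c then 1 else 0) := by
    intro b e c d hb he hc hd
    have h1 : h.1 b c * h.1 e d - sgn F c * sgn F (-c) * (h.1 b d * h.1 e c) =
      (if b = c ∧ e = d then 1 else 0) -
        sgn F c * sgn F (-c) * (if b = d ∧ e = c then 1 else 0) := by
      by_cases hbe : b = e
      · subst hbe
        rw [← sub_eq_zero, ← levi_conj_skewUnit_entry hL, hanti b c d hb hc hd, mul_zero]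
      · exact levi_minor_eq h2 hV hL hh hij (b := b) (c := c) (d := d) (e := e)
          (windCoeff_of_block_eq_left hb.symm _)
          (windCoeff_of_block_eq_right (by rw [P.block_neg, he, hγ']) _) hbe
          (by rw [P.block_neg]; omega)
    rw [sgn_mul_sgn_neg_of_eq_C hT] at h1
    linear_combination h1
  have hoff : ∀ b f, P.block b = P.block γ.1 → P.block f = P.block γ.1 → b ≠ f →
      h.1 b f = 0 := by
    intro b f hb hf hbf
    have m1 := hM b b f f hb hb hf hf
    rw [if_neg fun h => hbf h.1, add_zero, ← two_mul] at m1
    exact mul_self_eq_zero.1 ((mul_eq_zero.1 m1).resolve_left h2)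
  have hsq : ∀ b, P.block b = P.block γ.1 → h.1 b b * h.1 b b = 1 := by
    intro b hb
    have m1 := hM b b b b hb hb hb hb
    rw [if_pos ⟨rfl, rfl⟩, ← two_mul, one_add_one_eq_two] at m1
    exact mul_left_cancel₀ h2 (m1.trans (mul_one _).symm)
  refine isScalarOnArc_of_block hL harc (hsq γ.1 rfl) fun b e hb he => ?_
  split_ifs with hbe
  · subst hbe
    by_cases hb' : b = γ.1
    · rw [hb']
    · have m1 := hM b γ.1 b γ.1 hb rfl hb rfl
      rw [hoff b γ.1 hb rfl hb', zero_mul, add_zero, if_pos ⟨rfl, rfl⟩,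
        if_neg fun h => hb' h.1, add_zero] at m1
      have m2 := hsq γ.1 rfl
      exact mul_right_cancel₀ (right_ne_zero_of_mul_eq_one m1) (m1.trans m2.symm)
  · exact hoff b e hb he hbe

theorem isScalarOnArc_of_fixes (hP : P.Admissible) {γ : Idx T n × Idx T n}
    (hγ : P.block γ.1 ≠ P.block γ.2) (hij : skewUnit P F γ.1 γ.2 ∉ V) :
    IsScalarOnArc P γ h.1 := by
  by_cases hex : ∃ x y, InArc P γ (P.block x) ∧ InArc P γ (P.block y) ∧
      P.block x ≠ P.block y ∧ P.block x ≠ -P.block y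
  · obtain ⟨x, y, hx, hy, hxy, hxy'⟩ := hex
    exact isScalarOnArc_of_two h2 hV hL hh hγ hij hx hy hxy hxy'
  · push Not at hex
    have hi := inArc_left γ hγ
    have hγ' := hex _ _ (inArc_right γ hγ) hi (Ne.symm hγ)
    have harc : ∀ z, InArc P γ (P.block z) →
        P.block z = P.block γ.1 ∨ P.block z = -P.block γ.1 := by
      intro z hz
      by_cases h1 : P.block z = P.block γ.1
      · exact Or.inl h1
      · exact Or.inr (hex _ _ hz hi h1)
    by_cases hT : T = ClassicalType.C
    · exact isScalarOnArc_of_eq_C h2 hV hL hh hT hγ hγ' hij harc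
    · exact isScalarOnArc_of_ne_C h2 hV hL hh hT hP hγ hγ' hij harc

/-- An element of `L` that acts trivially modulo an invariant subspace lies in the subgroups `H_γ`
of the roots whose root vectors are not in this subspace. -/
theorem mem_rootSubgroup_of_fixes (hP : P.Admissible) {γ : Idx T n × Idx T n}
    (hγ : P.block γ.1 ≠ P.block γ.2) (hij : skewUnit P F γ.1 γ.2 ∉ V) :
    h ∈ rootSubgroup P F γ := by
  refine ⟨hL, isScalarOnArc_of_fixes h2 hV hL hh hP hγ hij,
    isScalarOnArc_of_fixes h2 hV hL hh hP ?_ ?_⟩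
  · change P.block (-γ.2) ≠ P.block (-γ.1)
    rw [P.block_neg, P.block_neg]
    omega
  · exact mt (skewUnit_neg_mem_iff γ.1 γ.2).1 hij

end Fixers

end ParabolicContraction

end

noncomputable section

namespace ParabolicContraction

variable {T : ClassicalType} {n : ℕ} {P : SymPartition T n} {F : Type*} [Field F]

/-! ### The subgroup `H_D` is the fixer of the orbit of the basic form. -/

section RookSubgroup

/-- On the arc `h` is a scalar `c` and `h†` a scalar `d`, and `h h† = 1` gives `c d = 1`. -/
theorem isScalarOnArc_conj_entry {γ : Idx T n × Idx T n}
    {h : ContractionGroup P F} (hh : h ∈ rootSubgroup P F γ) (X : ContractionAlgebra P F)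
    {b a : Idx T n} (hb : InArc P γ (P.block b)) (ha : InArc P γ (P.block a)) :
    (h.1 * X * star h.1 : ContractionAlgebra P F) b a = X b a := by
  obtain ⟨hL, ⟨c, hc⟩, hs⟩ := hh
  obtain ⟨d, hd⟩ := hs.star P
  rw [conjPair_conjPair] at hd
  have hleft : ∀ k, (h.1 * X : ContractionAlgebra P F) b k = c * X b k := by
    intro k
    rw [mul_entry, Finset.sum_eq_single b]
    · rw [windCoeff_left, hc b b hb hb, if_pos rfl, one_mul]
    · intro e _ he
      by_cases hbe : P.block b = P.block e
      · rw [hc b e hb (hbe ▸ hb), if_neg (Ne.symm he), zero_mul, mul_zero]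
      · rw [levi_entry P hL b e hbe, zero_mul, mul_zero]
    · exact fun h => absurd (Finset.mem_univ _) h
  have hright : ∀ (Y : ContractionAlgebra P F) (x : Idx T n),
      (Y * star h.1 : ContractionAlgebra P F) x a = Y x a * d := by
    intro Y x
    rw [mul_entry, Finset.sum_eq_single a]
    · rw [windCoeff_right, hd a a ha ha, if_pos rfl, one_mul]
    · intro e _ he
      by_cases hbe : P.block e = P.block a
      · rw [hd e a (hbe ▸ ha) ha, if_neg he, mul_zero, mul_zero]
      · rw [show (star h.1 : ContractionAlgebra P F) e a = 0 from
          levi_entry P (inv_mem hL) e a hbe, mul_zero, mul_zero]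
    · exact fun h => absurd (Finset.mem_univ _) h
  have hcd : c * d = 1 := by
    have h1 := hright h.1 a
    rw [hc a a ha ha, if_pos rfl, Unitary.mul_star_self_of_mem h.2, one_entry, if_pos rfl] at h1
    exact h1.symm
  rw [hright, hleft]
  linear_combination X b a * hcd

/-- An entry of a product at `γ` involves only entries at positions on the arc of `γ`, where
conjugation by `h` does nothing. -/
theorem isScalarOnArc_sandwich_entry {γ : Idx T n × Idx T n} (hγ : P.block γ.1 ≠ P.block γ.2)
    {h : ContractionGroup P F} (hh : h ∈ rootSubgroup P F γ) (g X g' : ContractionAlgebra P F) :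
    (g * (h.1 * X * star h.1 - X) * g' : ContractionAlgebra P F) γ.1 γ.2 = 0 := by
  rw [mul_entry]
  refine Finset.sum_eq_zero fun a _ => ?_
  by_cases ha : windCoeff P F γ.1 a γ.2 = 1
  · rw [mul_entry, Finset.sum_mul, Finset.mul_sum]
    refine Finset.sum_eq_zero fun b _ => ?_
    by_cases hb : windCoeff P F γ.1 b a = 1
    · have hc := windCoeff_cocycle P (F := F) γ.1 b a γ.2
      rw [ha, hb, one_mul] at hc
      have hb' : windCoeff P F γ.1 b γ.2 = 1 := by
        rcases windCoeff_eq_zero_or_one P (F := F) γ.1 b γ.2 with h0 | h0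
        · rw [h0, zero_mul] at hc
          exact absurd hc.symm zero_ne_one
        · exact h0
      rw [sub_entry, isScalarOnArc_conj_entry hh X ((inArc_iff hγ b).2 hb')
        ((inArc_iff hγ a).2 ha), sub_self]
      ring
    · rw [(windCoeff_eq_zero_or_one P (F := F) γ.1 b a).resolve_right hb]
      ring
  · rw [(windCoeff_eq_zero_or_one P (F := F) γ.1 a γ.2).resolve_right ha, zero_mul]

theorem rootVector_mem {γ : Idx T n × Idx T n} (h2 : (2 : F) ≠ 0) (hγ : IsRoot γ)
    (hγ' : P.block γ.1 ≠ P.block γ.2) : rootVector P γ ∈ nilradical P F :=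
  (rootVector_mem_iff h2 hγ).2 (skewUnit_mem hγ')

theorem rootVector_entry (γ : Idx T n × Idx T n) (i j : Idx T n) :
    rootVector P (F := F) γ i j = (if i = γ.1 ∧ j = γ.2 then 1 else 0) +
      (if conjPair γ = γ then 0 else -(sgn F γ.1 * sgn F γ.2)) *
        (if i = -γ.2 ∧ j = -γ.1 then 1 else 0) := by
  rw [rootVector, add_entry, smul_entry, matrixUnit_entry]
  congr 2
  exact matrixUnit_entry _ _ _ _

theorem basicForm_apply (D : Finset (Idx T n × Idx T n)) (φ : D → Fˣ) (X : nilradical P F) :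
    basicForm P D φ X = ∑ γ : D, (φ γ : F) * X.1 γ.1.1 γ.1.2 := by
  rw [basicForm, LinearMap.sum_apply]
  rfl

theorem IsRoot.conjPair_eq {γ : Idx T n × Idx T n} (h : IsRoot γ) (h' : IsRoot (conjPair γ)) :
    conjPair γ = γ := by
  rw [conjPair_eq_iff]
  refine Subtype.ext ?_
  rw [coe_neg]
  simp only [IsRoot, IsPositiveRoot, conjPair, Prod.fst_swap, Prod.snd_swap, Subtype.ext_iff,
    coe_neg] at h h'
  omega

theorem rootVector_entry_of_isRoot {γ γ' : Idx T n × Idx T n} (hγ : IsRoot γ) (hγ' : IsRoot γ') :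
    rootVector P (F := F) γ γ'.1 γ'.2 = if γ' = γ then 1 else 0 := by
  rw [rootVector_entry]
  have e1 : (γ'.1 = γ.1 ∧ γ'.2 = γ.2) ↔ γ' = γ := Prod.ext_iff.symm
  have e3 : (γ'.1 = -γ.2 ∧ γ'.2 = -γ.1) ↔ γ' = conjPair γ :=
    (Prod.ext_iff (y := conjPair γ)).symm
  rw [if_congr e1 rfl rfl, if_congr e3 rfl rfl]
  by_cases hc : conjPair γ = γ
  · rw [if_pos hc, zero_mul, add_zero]
  · rw [if_neg hc, if_neg (c := γ' = conjPair γ), mul_zero, add_zero]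
    rintro rfl
    exact hc (hγ.conjPair_eq hγ')

theorem basicForm_rootVector {D : Finset (Idx T n × Idx T n)} (φ : D → Fˣ)
    (hD : IsRookPlacement P D) (γ : D) (h : rootVector P γ.1 ∈ nilradical P F) :
    basicForm P D φ ⟨rootVector P γ.1, h⟩ = φ γ := by
  have hγ := (hD.1 γ.1 γ.2).1
  rw [basicForm_apply, Finset.sum_eq_single γ]
  · change (φ γ : F) * rootVector P γ.1 γ.1.1 γ.1.2 = _
    rw [rootVector_entry_of_isRoot hγ hγ, if_pos rfl, mul_one]
  · intro γ' _ hne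
    change (φ γ' : F) * rootVector P γ.1 γ'.1.1 γ'.1.2 = _
    rw [rootVector_entry_of_isRoot hγ (hD.1 γ'.1 γ'.2).1, if_neg fun h => hne (Subtype.ext h), mul_zero]
  · exact fun h => absurd (Finset.mem_univ _) h

theorem mem_rookSubgroup_iff {D : Finset (Idx T n × Idx T n)} {h : ContractionGroup P F} :
    h ∈ rookSubgroup P F D ↔ h ∈ leviSubgroup P F ∧ ∀ γ ∈ D, h ∈ rootSubgroup P F γ := by
  simp only [rookSubgroup, Subgroup.mem_inf, Subgroup.mem_iInf]

/-- Elements of `H_D` do not change the entries that the orbit of the basic form reads. Conversely,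
this form is nonzero on the root vector of each `γ ∈ D`, so that vector is not annihilated by the
orbit and `mem_rootSubgroup_of_fixes` applies. -/
theorem rookSubgroup_eq_orbitFixer (h2 : (2 : F) ≠ 0) (hP : P.Admissible)
    {D : Finset (Idx T n × Idx T n)} (φ : D → Fˣ) (hD : IsRookPlacement P D) :
    rookSubgroup P F D = orbitFixer (basicForm P D φ) := by
  ext h
  rw [mem_rookSubgroup_iff]
  refine and_congr_right fun hL => ⟨fun hh X => ?_, fun hh γ hγ => ?_⟩
  · rintro _ ⟨g, rfl⟩
    rw [LinearMap.comp_apply, basicForm_apply]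
    refine Finset.sum_eq_zero fun γ _ => ?_
    refine mul_eq_zero_of_right _ ?_
    exact isScalarOnArc_sandwich_entry (hD.1 γ.1 γ.2).2 (hh γ.1 γ.2) _ X.1 _
  · obtain ⟨hr, hb⟩ := hD.1 γ hγ
    have hV := isInvariant_map (W := orbitAnnihilator (basicForm P D φ))
      fun g X hX => act_mem_orbitAnnihilator g hX
    refine mem_rootSubgroup_of_fixes h2 hV hL (fun X hX => ?_) hP hb ?_
    · exact coe_mem_map_subtype.2 (hh ⟨X, hX⟩)
    · rw [← rootVector_mem_iff h2 hr]
      intro hmem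
      have hmem' : (⟨rootVector P γ, rootVector_mem h2 hr hb⟩ : nilradical P F) ∈
          orbitAnnihilator (basicForm P D φ) := coe_mem_map_subtype.1 hmem
      have := hmem' _ (mem_dualOrbit_self _)
      rw [basicForm_rootVector φ hD ⟨γ, hγ⟩] at this
      exact (φ ⟨γ, hγ⟩).ne_zero this

end RookSubgroup

end ParabolicContraction

end

noncomputable section

namespace ParabolicContraction

variable {T : ClassicalType} {n : ℕ} {P : SymPartition T n} {F : Type*} [Field F]

/-! ## Reduction of elements of `u^a` to monomial form -/

/-- The elements `Y` of `u^a` which are in monomial form outside of the rows in `S` and the columns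
in `-S`, while their entries in the rows in `S` are at positions of arc length at least `m`. -/
structure PartialMonomial (P : SymPartition T n) (S : Finset (Idx T n)) (m : ℤ)
    (Y : ContractionAlgebra P F) : Prop where
  mem : Y ∈ nilradical P F
  supp : ∀ a b, Y a b ≠ 0 → (a ∈ S ↔ -b ∈ S)
  row : ∀ a, a ∉ S → ∀ b b', Y a b ≠ 0 → Y a b' ≠ 0 → b = b'
  anti : T = ClassicalType.C → ∀ a, a ∉ S → ∀ b, Y a b ≠ 0 → P.block b = -P.block a → b = -a
  le : ∀ a ∈ S, ∀ b, Y a b ≠ 0 → m ≤ arcLength P a b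

section Clean

theorem nilradical_entry_neg_ne_zero {X : ContractionAlgebra P F} (hX : star X = -X) {i j : Idx T n} :
    X (-j) (-i) ≠ 0 ↔ X i j ≠ 0 := by
  rw [nilradical_entry hX, neg_ne_zero, mul_ne_zero_iff, mul_ne_zero_iff]
  have hs : ∀ x : Idx T n, sgn F x ≠ 0 := fun x hx => by
    have := sgn_mul_self (F := F) x
    rw [hx, zero_mul] at this
    exact zero_ne_one this
  exact ⟨fun h => h.2, fun h => ⟨⟨hs i, hs j⟩, h⟩⟩

theorem mem_nilradical_conj {X : ContractionAlgebra P F} (hX : X ∈ nilradical P F)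
    {g : ContractionAlgebra P F} (hg : IsUnit g) : g * X * star g ∈ nilradical P F := by
  obtain ⟨g, rfl⟩ := hg
  exact (act P g ⟨X, hX⟩).2

theorem exists_of_sandwich_entry_ne_zero {g Y k : ContractionAlgebra P F} {a b : Idx T n}
    (h : (g * Y * k : ContractionAlgebra P F) a b ≠ 0) :
    ∃ a' b', g a a' ≠ 0 ∧ Y a' b' ≠ 0 ∧ k b' b ≠ 0 ∧ arcLength P a' b' ≤ arcLength P a b := by
  rw [mul_entry] at h
  obtain ⟨b', -, hb'⟩ := Finset.exists_ne_zero_of_sum_ne_zero h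
  have hw := left_ne_zero_of_mul hb'
  have hk := right_ne_zero_of_mul (right_ne_zero_of_mul hb')
  have hg := left_ne_zero_of_mul (right_ne_zero_of_mul hb')
  rw [mul_entry] at hg
  obtain ⟨a', -, ha'⟩ := Finset.exists_ne_zero_of_sum_ne_zero hg
  have hw' := left_ne_zero_of_mul ha'
  refine ⟨a', b', left_ne_zero_of_mul (right_ne_zero_of_mul ha'),
    right_ne_zero_of_mul (right_ne_zero_of_mul ha'), hk, ?_⟩
  have h1 := (windCoeff_eq_one_iff P (F := F) a b' b).1
    ((windCoeff_eq_zero_or_one P _ _ _).resolve_left hw)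
  have h3 := (windCoeff_eq_one_iff P (F := F) a a' b').1
    ((windCoeff_eq_zero_or_one P _ _ _).resolve_left hw')
  have h4 := arcLength_nonneg P b' b
  have h5 := arcLength_nonneg P a a'
  omega

/-- Conjugation by `1 + y` with `y` supported on `S × S` mixes only the rows in `S` and the columns
in `-S`, and multiplication never shortens arcs. -/
theorem PartialMonomial.conj {S : Finset (Idx T n)} {m : ℤ} {Y y : ContractionAlgebra P F}
    (hY : PartialMonomial P S m Y) (hy : ∀ a b, y a b ≠ 0 → a ∈ S ∧ b ∈ S)
    (hu : IsUnit (1 + y)) : PartialMonomial P S m ((1 + y) * Y * star (1 + y)) := by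
  have hg : ∀ a b, (1 + y : ContractionAlgebra P F) a b ≠ 0 → a = b ∨ (a ∈ S ∧ b ∈ S) := by
    intro a b h
    by_contra hne
    push Not at hne
    rw [add_entry, one_entry, if_neg hne.1, zero_add] at h
    exact hne.2 (hy a b h).1 (hy a b h).2
  have hg' : ∀ a b, (star (1 + y) : ContractionAlgebra P F) a b ≠ 0 →
      a = b ∨ (-a ∈ S ∧ -b ∈ S) := by
    intro a b h
    rw [star_entry] at h
    exact (hg _ _ (right_ne_zero_of_mul h)).imp (fun h => (neg_injective h).symm) And.symm
  have hout : ∀ a, a ∉ S → ∀ b, ((1 + y) * Y * star (1 + y) : ContractionAlgebra P F) a b ≠ 0 →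
      Y a b ≠ 0 := by
    intro a ha b h
    obtain ⟨a', b', h1, h3, h4, -⟩ := exists_of_sandwich_entry_ne_zero h
    obtain rfl : a = a' := (hg a a' h1).resolve_right fun h => ha h.1
    obtain rfl : b' = b := (hg' b' b h4).resolve_right fun h => ha ((hY.supp a b' h3).2 h.1)
    exact h3
  refine ⟨mem_nilradical_conj hY.mem hu, fun a b h => ?_, fun a ha b b' h h' =>
    hY.row a ha b b' (hout a ha b h) (hout a ha b' h'), fun hT a ha b h hbl =>
    hY.anti hT a ha b (hout a ha b h) hbl, fun a ha b h => ?_⟩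
  · obtain ⟨a', b', h1, h3, h4, -⟩ := exists_of_sandwich_entry_ne_zero h
    have e1 : a ∈ S ↔ a' ∈ S := by
      rcases hg a a' h1 with h | h
      · rw [h]
      · exact iff_of_true h.1 h.2
    have e2 : -b' ∈ S ↔ -b ∈ S := by
      rcases hg' b' b h4 with h | h
      · rw [h]
      · exact iff_of_true h.1 h.2
    rw [e1, ← e2]
    exact hY.supp a' b' h3
  · obtain ⟨a', b', h1, h3, -, h5⟩ := exists_of_sandwich_entry_ne_zero h
    refine (hY.le a' ?_ b' h3).trans h5
    rcases hg a a' h1 with h | h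
    · rwa [← h]
    · exact h.2

/-- Elimination of the entries in the rows and columns of a pivot. -/
theorem PartialMonomial.eliminate {S : Finset (Idx T n)} {i j : Idx T n}
    {Y : ContractionAlgebra P F} (hY : PartialMonomial P S (arcLength P i j) Y) (hi : i ∈ S)
    (hij : Y i j ≠ 0) (h1 : j ≠ -i → Y i (-i) = 0 ∧ Y (-j) j = 0)
    (hC : T = ClassicalType.C → P.block j = -P.block i → j = -i) :
    ∃ g : ContractionAlgebra P F, IsUnit g ∧
      PartialMonomial P (S \ {i, -j}) (arcLength P i j) (g * Y * star g) := by
  set R : Finset (Idx T n) := {i, -j} with hR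
  have hRmem : ∀ r, r ∈ R ↔ r = i ∨ r = -j := fun r => by simp [hR]
  -- The pivot `(i, j)` and its conjugate `(-j, -i)` are treated together: `π r` is the pivot column
  -- of row `r`. The two coincide if `j = -i`.
  set π : Idx T n → Idx T n := fun r => if r = i then j else -i with hπ
  have hπi : π i = j := if_pos rfl
  have hπj : π (-j) = -i := by
    by_cases h : -j = i
    · rw [h, hπi, ← h, neg_neg]
    · exact if_neg h
  have hjS : -j ∈ S := (hY.supp i j hij).1 hi
  have hRS : ∀ r ∈ R, r ∈ S := fun r hr => by
    rcases (hRmem r).1 hr with rfl | rfl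
    · exact hi
    · exact hjS
  have hπR : ∀ r ∈ R, -π r ∈ R := fun r hr => by
    rcases (hRmem r).1 hr with rfl | rfl
    · rw [hπi]
      exact (hRmem _).2 (Or.inr rfl)
    · rw [hπj, neg_neg]
      exact (hRmem _).2 (Or.inl rfl)
  have hπR' : ∀ b, -b ∈ R → ∃ r ∈ R, b = π r := fun b hb => by
    rcases (hRmem _).1 hb with h | h
    · exact ⟨-j, (hRmem _).2 (Or.inr rfl), by rw [hπj, ← h, neg_neg]⟩
    · exact ⟨i, (hRmem _).2 (Or.inl rfl), by rw [hπi, neg_injective h]⟩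
  have hpiv : ∀ r ∈ R, Y r (π r) ≠ 0 := fun r hr => by
    rcases (hRmem r).1 hr with rfl | rfl
    · rwa [hπi]
    · rw [hπj]
      exact (nilradical_entry_neg_ne_zero hY.mem.1).2 hij
  have hlen : ∀ r ∈ R, arcLength P r (π r) = arcLength P i j := fun r hr => by
    rcases (hRmem r).1 hr with rfl | rfl
    · rw [hπi]
    · rw [hπj, arcLength_neg]
  have hoff : ∀ r ∈ R, ∀ r' ∈ R, r ≠ r' → Y r (π r') = 0 := fun r hr r' hr' hne => by
    rcases (hRmem r).1 hr with rfl | rfl <;> rcases (hRmem r').1 hr' with rfl | rfl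
    · exact absurd rfl hne
    · rw [hπj]
      exact (h1 fun h => hne (by rw [h, neg_neg])).1
    · rw [hπi]
      exact (h1 fun h => hne (by rw [h, neg_neg])).2
    · exact absurd rfl hne
  -- Ordinary elimination by the pivot rows. The quotients are effective because `arcLength P i j`
  -- is minimal, so each pivot arc is contained in the arc of the entry it has to clear.
  let y : ContractionAlgebra P F := fun a r =>
    if (a ∈ S ∧ a ∉ R) ∧ r ∈ R then -(Y a (π r) / Y r (π r)) else 0
  have hy_entry : ∀ a r, y a r =
      if (a ∈ S ∧ a ∉ R) ∧ r ∈ R then -(Y a (π r) / Y r (π r)) else 0 := fun _ _ => rfl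
  have hy0 : ∀ a r, a ∈ R → y a r = 0 := fun a r ha => if_neg fun h => h.1.2 ha
  have hu : IsUnit (1 + y) := by
    have h0 : y * y = 0 := by
      ext a b
      rw [mul_entry]
      refine Finset.sum_eq_zero fun k _ => ?_
      by_cases hk : k ∈ R
      · rw [hy0 k b hk, mul_zero, mul_zero]
      · rw [hy_entry a k, if_neg fun h => hk h.2, zero_mul, mul_zero]
    exact IsNilpotent.isUnit_one_add ⟨2, by rw [pow_two, h0]⟩
  have hY' := hY.conj (y := y) (fun a b h => by
    by_contra hne
    refine h (if_neg fun hh => hne ⟨hh.1.1, hRS b hh.2⟩)) hu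
  set Y' := (1 + y) * Y * star (1 + y) with hYdef
  -- The right factor adds nothing to the pivot columns, as `y` has no entries in the pivot rows;
  -- the row operations alone decide there. The rows are cleared by skewness.
  have hcol : ∀ a, ∀ r ∈ R, Y' a (π r) = ((1 + y) * Y : ContractionAlgebra P F) a (π r) := by
    intro a r hr
    rw [hYdef, star_add, star_one, mul_add, mul_one, add_entry,
      mul_entry P ((1 + y) * Y) (star y), Finset.sum_eq_zero, add_zero]
    intro k _
    rw [star_entry, hy0 _ _ (hπR r hr), mul_zero, mul_zero, mul_zero]
  have hcolR : ∀ r ∈ R, ∀ r' ∈ R, Y' r (π r') = Y r (π r') := by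
    intro r hr r' hr'
    rw [hcol r r' hr', add_mul, one_mul, add_entry, mul_entry, Finset.sum_eq_zero, add_zero]
    intro k _
    rw [hy0 _ _ hr, zero_mul, mul_zero]
  have hzero : ∀ a, a ∉ R → ∀ r ∈ R, Y' a (π r) = 0 := by
    intro a ha r hr
    by_contra hne
    have haS : a ∈ S := (hY'.supp a (π r) hne).2 (hRS _ (hπR r hr))
    refine hne ?_
    rw [hcol a r hr, add_mul, one_mul, add_entry, mul_entry, Finset.sum_eq_single r]
    · rw [hy_entry, if_pos ⟨⟨haS, ha⟩, hr⟩]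
      by_cases h0 : Y a (π r) = 0
      · rw [h0]
        ring
      · have hw : windCoeff P F a r (π r) = 1 :=
          windCoeff_eq_one_of_le P (by rw [hlen r hr]; exact hY.le a haS _ h0)
        rw [hw]
        have := hpiv r hr
        field_simp
        ring
    · intro k _ hk
      by_cases hkR : k ∈ R
      · rw [hoff k hkR r hr hk, mul_zero, mul_zero]
      · rw [hy_entry, if_neg fun h => hkR h.2, zero_mul, mul_zero]
    · exact fun h => absurd (Finset.mem_univ _) h
  have hR1 : ∀ a b, Y' a b ≠ 0 → -b ∈ R → a ∈ R := by
    intro a b hab hb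
    obtain ⟨r, hr, rfl⟩ := hπR' b hb
    by_contra ha
    exact hab (hzero a ha r hr)
  have hR2 : ∀ a b, Y' a b ≠ 0 → (a ∈ R ↔ -b ∈ R) := by
    intro a b hab
    refine ⟨fun ha => ?_, hR1 a b hab⟩
    refine hR1 _ (-a) ((nilradical_entry_neg_ne_zero hY'.mem.1).2 hab) ?_
    rwa [neg_neg]
  have hrow : ∀ r ∈ R, ∀ b, Y' r b ≠ 0 → b = π r := by
    intro r hr b hb
    obtain ⟨r', hr', rfl⟩ := hπR' b ((hR2 r b hb).1 hr)
    by_contra hne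
    rw [hcolR r hr r' hr'] at hb
    exact hb (hoff r hr r' hr' fun h => hne (by rw [h]))
  refine ⟨1 + y, hu, hY'.mem, fun a b h => ?_, fun a ha b b' h h' => ?_, fun hT a ha b h hbl => ?_,
    fun a ha b h => ?_⟩
  · rw [Finset.mem_sdiff, Finset.mem_sdiff, hY'.supp a b h, hR2 a b h]
  · by_cases haS : a ∈ S
    · have haR : a ∈ R := by
        by_contra hne
        exact ha (Finset.mem_sdiff.2 ⟨haS, hne⟩)
      rw [hrow a haR b h, hrow a haR b' h']
    · exact hY'.row a haS b b' h h'
  · by_cases haS : a ∈ S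
    · have haR : a ∈ R := by
        by_contra hne
        exact ha (Finset.mem_sdiff.2 ⟨haS, hne⟩)
      have hb := hrow a haR b h
      rcases (hRmem a).1 haR with rfl | rfl
      · rw [hπi] at hb
        rw [hb] at hbl ⊢
        exact hC hT hbl
      · rw [hπj] at hb
        rw [hb, P.block_neg, P.block_neg] at hbl
        rw [hb, neg_neg, hC hT (by omega)]
    · exact hY'.anti hT a haS b h hbl
  · exact hY'.le a (Finset.mem_sdiff.1 ha).1 b h

end Clean

section Transvections

theorem one_add_smul_matrixUnit_mul_entry (c : F) (p q : Idx T n) (Y : ContractionAlgebra P F)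
    (a b : Idx T n) : ((1 + c • matrixUnit P (p, q)) * Y : ContractionAlgebra P F) a b =
      Y a b + if a = p then c * windCoeff P F p q b * Y q b else 0 := by
  rw [add_mul, one_mul, smul_mul_assoc, add_entry, smul_entry, matrixUnit_mul_entry, mul_ite,
    mul_zero, mul_assoc]

theorem transvection_entry (c : F) (p q : Idx T n) (Y : ContractionAlgebra P F) (a b : Idx T n) :
    ((1 + c • matrixUnit P (p, q)) * Y * star (1 + c • matrixUnit P (p, q)) :
      ContractionAlgebra P F) a b =
      ((1 + c • matrixUnit P (p, q)) * Y : ContractionAlgebra P F) a b +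
        if b = -p then c * (sgn F p * sgn F q) * windCoeff P F a (-q) (-p) *
          ((1 + c • matrixUnit P (p, q)) * Y : ContractionAlgebra P F) a (-q) else 0 := by
  rw [star_add, star_one, star_smul_entry, star_matrixUnit, sgn_neg_mul_sgn_neg, mul_add, mul_one,
    mul_smul_comm, mul_smul_comm, add_entry, smul_entry, smul_entry, mul_matrixUnit_entry]
  congr 1
  split_ifs <;> ring

theorem isUnit_one_add_smul_matrixUnit (c : F) {p q : Idx T n} (h : p ≠ q) :
    IsUnit (1 + c • matrixUnit P (F := F) (p, q)) := by
  have h0 : (c • matrixUnit P (F := F) (p, q)) * (c • matrixUnit P (F := F) (p, q)) = 0 := by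
    have : matrixUnit P (F := F) (p, q) * matrixUnit P (p, q) = 0 := by
      ext i j
      rw [matrixUnit_mul_entry, matrixUnit_entry, if_neg (c := q = p ∧ j = q) fun h' => h h'.1.symm,
        mul_zero, ite_self]
      rfl
    rw [smul_mul_smul_comm, this, smul_zero]
  exact IsNilpotent.isUnit_one_add ⟨2, by rw [pow_two, h0]⟩

theorem PartialMonomial.transvection {S : Finset (Idx T n)} {m : ℤ} {Y : ContractionAlgebra P F}
    (hY : PartialMonomial P S m Y) (c : F) {p q : Idx T n} (hp : p ∈ S) (hq : q ∈ S) (h : p ≠ q) :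
    PartialMonomial P S m ((1 + c • matrixUnit P (p, q)) * Y * star (1 + c • matrixUnit P (p, q))) := by
  refine hY.conj (fun a b hab => ?_) (isUnit_one_add_smul_matrixUnit c h)
  rw [smul_entry, matrixUnit_entry] at hab
  by_cases hh : a = p ∧ b = q
  · rw [hh.1, hh.2]
    exact ⟨hp, hq⟩
  · rw [if_neg hh, mul_zero] at hab
    exact absurd rfl hab

variable (h2 : (2 : F) ≠ 0)

theorem sgn_ne_zero (x : Idx T n) : sgn F x ≠ 0 := fun hx => by
  have := sgn_mul_self (F := F) x
  rw [hx, zero_mul] at this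
  exact zero_ne_one this

include h2 in
/-- In a self-conjugate block an antidiagonal entry can be made nonzero. -/
theorem PartialMonomial.antidiagonalize (hT : T = ClassicalType.C) {S : Finset (Idx T n)} {m : ℤ}
    {i j : Idx T n} {Y : ContractionAlgebra P F} (hY : PartialMonomial P S m Y) (hi : i ∈ S)
    (hij : Y i j ≠ 0) (hbl : P.block j = -P.block i) (hne : j ≠ -i) :
    ∃ g : ContractionAlgebra P F, IsUnit g ∧ PartialMonomial P S m (g * Y * star g) ∧
      ∃ b ∈ S, P.block b = P.block i ∧ (g * Y * star g : ContractionAlgebra P F) b (-b) ≠ 0 := by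
  have hjS : -j ∈ S := (hY.supp i j hij).1 hi
  have hbl' : P.block (-j) = P.block i := by rw [P.block_neg, hbl, neg_neg]
  have hone : PartialMonomial P S m (1 * Y * star 1) := by rwa [star_one, one_mul, mul_one]
  by_cases h1 : Y i (-i) = 0
  swap
  · exact ⟨1, isUnit_one, hone, i, hi, rfl, by rwa [star_one, one_mul, mul_one]⟩
  by_cases h3 : Y (-j) j = 0
  swap
  · exact ⟨1, isUnit_one, hone, -j, hjS, hbl', by rwa [star_one, one_mul, mul_one, neg_neg]⟩
  have hne' : i ≠ -j := fun h => hne (by rw [h, neg_neg])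
  -- In type C the row operation and its conjugate column operation contribute equal terms to the
  -- entry at `(i, -i)`, which becomes `-2 sgn(i) sgn(j) Y i j`.
  refine ⟨_, isUnit_one_add_smul_matrixUnit 1 hne', hY.transvection 1 hi hjS hne', i, hi, rfl, ?_⟩
  rw [transvection_entry, if_pos rfl, one_add_smul_matrixUnit_mul_entry,
    one_add_smul_matrixUnit_mul_entry, if_pos rfl, if_pos rfl, neg_neg, h1, h3,
    windCoeff_of_block_eq_left hbl'.symm,
    windCoeff_of_block_eq_right (show P.block j = P.block (-i) by rw [P.block_neg, hbl]),
    nilradical_entry hY.mem.1]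
  have hs := sgn_mul_sgn_neg_of_eq_C (F := F) hT j
  have hs' := sgn_mul_self (F := F) j
  have hsj : sgn F (-j) = -sgn F j := by
    linear_combination sgn F j * hs - sgn F (-j) * hs'
  rw [hsj]
  have : 0 + 1 * 1 * -(sgn F i * sgn F j * Y i j) +
      1 * (sgn F i * -sgn F j) * 1 * (Y i j + 1 * windCoeff P F i (-j) j * 0) =
      -(2 * (sgn F i * sgn F j * Y i j)) := by ring
  rw [this]
  exact neg_ne_zero.2 (mul_ne_zero h2 (mul_ne_zero (mul_ne_zero (sgn_ne_zero i) (sgn_ne_zero j)) hij))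

include h2 in
/-- Elimination of an antidiagonal entry in the column of a pivot. -/
theorem PartialMonomial.eliminate_antidiagonal (hT : T = ClassicalType.C) {S : Finset (Idx T n)}
    {i j : Idx T n} {Y : ContractionAlgebra P F} (hY : PartialMonomial P S (arcLength P i j) Y)
    (hi : i ∈ S) (hij : Y i j ≠ 0) (hbl : P.block j ≠ -P.block i) :
    ∃ g : ContractionAlgebra P F, IsUnit g ∧
      PartialMonomial P S (arcLength P i j) (g * Y * star g) ∧
      (g * Y * star g : ContractionAlgebra P F) (-j) j = 0 ∧
      (g * Y * star g : ContractionAlgebra P F) i (-i) = Y i (-i) ∧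
      (g * Y * star g : ContractionAlgebra P F) i j = Y i j := by
  have hjS : -j ∈ S := (hY.supp i j hij).1 hi
  have hne : -j ≠ i := fun h => hbl (by rw [← h, P.block_neg, neg_neg])
  have hne' : i ≠ -j := fun h => hne h.symm
  have hne3 : -i ≠ j := fun h => hne (by rw [← h, neg_neg])
  -- A nonzero value would join an arc from `-j` to `i` to an arc of length at least that of the
  -- pivot and give the length of the pivot, so `-j` and `i` would share a block.
  have hw1 : windCoeff P F (-j) i (-i) * Y i (-i) = 0 := by
    by_contra h
    have h1 := (windCoeff_eq_one_iff P (F := F) _ _ _).1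
      ((windCoeff_eq_zero_or_one P _ _ _).resolve_left (left_ne_zero_of_mul h))
    have h3 := hY.le i hi _ (right_ne_zero_of_mul h)
    have h4 := arcLength_nonneg P (-j) i
    rw [arcLength_neg] at h1
    have h5 := (arcLength_eq_zero_iff P (-j) i).1 (by omega)
    rw [P.block_neg] at h5
    omega
  have hw2 : windCoeff P F i (-i) j * Y i (-i) = 0 := by
    by_contra h
    have h1 := (windCoeff_eq_one_iff P (F := F) _ _ _).1
      ((windCoeff_eq_zero_or_one P _ _ _).resolve_left (left_ne_zero_of_mul h))
    have h3 := hY.le i hi _ (right_ne_zero_of_mul h)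
    have h4 := arcLength_nonneg P (-i) j
    have h5 := (arcLength_eq_zero_iff P (-i) j).1 (by omega)
    rw [P.block_neg] at h5
    omega
  -- The row and the column operation both add `c Y i j` to the entry at `(-j, j)`, so `2 c Y i j`
  -- has to cancel it.
  set c : F := -(Y (-j) j / (2 * Y i j)) with hc
  have hw3 : c * windCoeff P F (-j) i j = c := by
    by_cases h0 : Y (-j) j = 0
    · rw [hc, h0, zero_div, neg_zero, zero_mul]
    · rw [windCoeff_eq_one_of_le P (hY.le _ hjS _ h0), mul_one]
  refine ⟨_, isUnit_one_add_smul_matrixUnit c hne, hY.transvection c hjS hi hne, ?_, ?_, ?_⟩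
  · have hw4 : windCoeff P F (-j) (-i) j = windCoeff P F (-j) i j := by
      have := windCoeff_neg P (F := F) (-j) i j
      rwa [neg_neg] at this
    rw [transvection_entry, neg_neg, if_pos rfl, one_add_smul_matrixUnit_mul_entry,
      one_add_smul_matrixUnit_mul_entry, if_pos rfl, if_pos rfl, mul_assoc c _ (Y i (-i)), hw1,
      hw4, nilradical_entry hY.mem.1]
    have hs := sgn_mul_sgn_neg_of_eq_C (F := F) hT j
    have hs' := sgn_mul_self (F := F) j
    have hsi := sgn_mul_self (F := F) i
    have hcY : 2 * Y i j * c = -Y (-j) j := by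
      rw [hc]
      field_simp
    linear_combination hcY + 2 * Y i j * hw3 -
      (windCoeff P F (-j) i j * c * Y i j * sgn F i * sgn F i) * hs +
      windCoeff P F (-j) i j * c * Y i j * hsi
  · rw [transvection_entry, neg_neg, if_neg hne3, one_add_smul_matrixUnit_mul_entry, if_neg hne',
      add_zero, add_zero]
  · rw [transvection_entry, neg_neg, if_pos rfl, one_add_smul_matrixUnit_mul_entry,
      one_add_smul_matrixUnit_mul_entry, if_neg hne', if_neg hne', add_zero, add_zero, mul_assoc,
      hw2, mul_zero, add_zero]

end Transvections

section Monomial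

theorem conj_mul (g k X : ContractionAlgebra P F) :
    g * k * X * star (g * k) = g * (k * X * star k) * star g := by
  rw [star_mul]
  noncomm_ring

variable (h2 : (2 : F) ≠ 0)

include h2 in
-- The pivot has minimal arc length among the rows of `S`. In the orthogonal types antidiagonal
-- entries are zero. In type C a self-conjugate block gets an antidiagonal pivot; otherwise the
-- antidiagonal entries meeting the pivot and its conjugate are removed one after the other.
theorem PartialMonomial.exists_step {S : Finset (Idx T n)} {m : ℤ} {Y : ContractionAlgebra P F}
    (hY : PartialMonomial P S m Y) (hS : ∃ a ∈ S, ∃ b, Y a b ≠ 0) :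
    ∃ S', S' ⊂ S ∧ ∃ m', ∃ g : ContractionAlgebra P F, IsUnit g ∧
      PartialMonomial P S' m' (g * Y * star g) := by
  classical
  have key : ∀ (Z : ContractionAlgebra P F) (i j : Idx T n),
      PartialMonomial P S (arcLength P i j) Z → i ∈ S → Z i j ≠ 0 →
      (j ≠ -i → Z i (-i) = 0 ∧ Z (-j) j = 0) →
      (T = ClassicalType.C → P.block j = -P.block i → j = -i) →
      ∃ S', S' ⊂ S ∧ ∃ m', ∃ g : ContractionAlgebra P F, IsUnit g ∧
        PartialMonomial P S' m' (g * Z * star g) := by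
    intro Z i j hZ hi hij h1 hC
    obtain ⟨g, hg, hg'⟩ := hZ.eliminate hi hij h1 hC
    refine ⟨_, ?_, _, g, hg, hg'⟩
    refine Finset.ssubset_iff_subset_ne.2 ⟨Finset.sdiff_subset, fun h => ?_⟩
    have : i ∈ S \ {i, -j} := by
      rw [h]
      exact hi
    exact (Finset.mem_sdiff.1 this).2 (Finset.mem_insert_self _ _)
  obtain ⟨a, ha, b, hab⟩ := hS
  obtain ⟨⟨i, j⟩, hp, hmin⟩ := Finset.exists_min_image
    (Finset.univ.filter fun p : Idx T n × Idx T n => p.1 ∈ S ∧ Y p.1 p.2 ≠ 0)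
    (fun p => arcLength P p.1 p.2) ⟨(a, b), by simp [ha, hab]⟩
  simp only [Finset.mem_filter, Finset.mem_univ, true_and] at hp hmin
  obtain ⟨hi, hij⟩ := hp
  have hY' : PartialMonomial P S (arcLength P i j) Y :=
    ⟨hY.mem, hY.supp, hY.row, hY.anti, fun a ha b h => hmin (a, b) ⟨ha, h⟩⟩
  by_cases hT : T = ClassicalType.C
  swap
  · refine key Y i j hY' hi hij (fun _ => ?_) fun h => absurd h hT
    have hz : ∀ x, Y x (-x) = 0 := by
      intro x
      have := nilradical_entry hY.mem.1 x (-x)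
      rw [neg_neg, sgn_of_ne_C hT, sgn_of_ne_C hT, one_mul, one_mul] at this
      have h3 : 2 * Y x (-x) = 0 := by linear_combination this
      exact (mul_eq_zero.1 h3).resolve_left h2
    refine ⟨hz i, ?_⟩
    have := hz (-j)
    rwa [neg_neg] at this
  by_cases hji : j = -i
  · exact key Y i j hY' hi hij (fun h => absurd hji h) fun _ _ => hji
  by_cases hbl : P.block j = -P.block i
  · obtain ⟨g, hg, hgY, b, hb, hbb, hne⟩ := hY'.antidiagonalize h2 hT hi hij hbl hji
    have hlen : arcLength P b (-b) = arcLength P i j := by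
      unfold arcLength wind
      rw [P.block_neg, hbb, hbl]
    rw [← hlen] at hgY
    obtain ⟨S', hS', m', k, hk, hk'⟩ :=
      key _ b (-b) hgY hb hne (fun h => absurd rfl h) fun _ _ => rfl
    exact ⟨S', hS', m', k * g, hk.mul hg, by rwa [conj_mul]⟩
  · obtain ⟨g, hg, hgY, h1, h3, h4⟩ := hY'.eliminate_antidiagonal h2 hT hi hij hbl
    rw [← h4] at hij
    set Z := g * Y * star g
    have hjS : -j ∈ S := (hgY.supp i j hij).1 hi
    -- The same elimination at the conjugate pivot `(-j, -i)` clears `(i, -i)` and leaves the zero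
    -- at `(-j, j)` intact.
    rw [← arcLength_neg] at hgY
    obtain ⟨k, hk, hkY, h5, h6, h7⟩ := hgY.eliminate_antidiagonal h2 hT hjS
      ((nilradical_entry_neg_ne_zero hgY.mem.1).2 hij) (by rw [P.block_neg, P.block_neg]; omega)
    rw [arcLength_neg] at hkY
    rw [neg_neg] at h5 h6
    have hij' : (k * Z * star k : ContractionAlgebra P F) i j ≠ 0 := by
      rw [← nilradical_entry_neg_ne_zero hkY.mem.1, h7, nilradical_entry_neg_ne_zero hgY.mem.1]
      exact hij
    obtain ⟨S', hS', m', l, hl, hl'⟩ :=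
      key _ i j hkY hi hij' (fun _ => ⟨h5, h6.trans h1⟩) fun _ h => absurd h hbl
    exact ⟨S', hS', m', l * (k * g), hl.mul (hk.mul hg), by rwa [conj_mul, conj_mul]⟩

include h2 in
theorem PartialMonomial.exists_monomial (S : Finset (Idx T n)) :
    ∀ (m : ℤ) (Y : ContractionAlgebra P F), PartialMonomial P S m Y →
      ∃ g : ContractionAlgebra P F, IsUnit g ∧ PartialMonomial P ∅ 0 (g * Y * star g) := by
  induction S using Finset.strongInduction with
  | H S ih =>
    intro m Y hY
    by_cases hS : ∃ a ∈ S, ∃ b, Y a b ≠ 0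
    · obtain ⟨S', hS', m', g, hg, hgY⟩ := hY.exists_step h2 hS
      obtain ⟨k, hk, hkY⟩ := ih S' hS' m' _ hgY
      exact ⟨k * g, hk.mul hg, by rwa [conj_mul]⟩
    · push Not at hS
      refine ⟨1, isUnit_one, ?_⟩
      rw [star_one, one_mul, mul_one]
      have hout : ∀ a b, Y a b ≠ 0 → a ∉ S := fun a b h ha => h (hS a ha b)
      exact ⟨hY.mem, fun a b _ => by simp, fun a _ b b' h h' => hY.row a (hout a b h) b b' h h',
        fun hT a _ b h hbl => hY.anti hT a (hout a b h) b h hbl, fun a ha => by simp at ha⟩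

include h2 in
/-- Every element of `u^a` is congruent to a monomial one. -/
theorem exists_monomial {X : ContractionAlgebra P F} (hX : X ∈ nilradical P F) :
    ∃ g : ContractionAlgebra P F, IsUnit g ∧ PartialMonomial P ∅ 0 (g * X * star g) :=
  PartialMonomial.exists_monomial h2 Finset.univ 0 X ⟨hX, fun _ _ _ => by simp,
    fun a ha => absurd (Finset.mem_univ a) ha, fun _ a ha => absurd (Finset.mem_univ a) ha,
    fun a _ b _ => arcLength_nonneg P a b⟩

end Monomial

end ParabolicContraction

end

noncomputable section

namespace ParabolicContraction

variable {T : ClassicalType} {n : ℕ} {P : SymPartition T n} {F : Type*} [Field F]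

/-! ### Squares in finite fields and rotations of two rows. -/

section Squares

variable [Finite F] (h2 : (2 : F) ≠ 0) {δ : F} (hδ : ¬IsSquare δ)

include hδ in
-- The squares have index two in the multiplicative group of a finite field.
theorem exists_mul_self_mul_eq {y : F} (hy : y ≠ 0) :
    ∃ c : F, c ≠ 0 ∧ (c * c * y = 1 ∨ c * c * y = δ) := by
  classical
  have : Fintype F := Fintype.ofFinite F
  by_cases hs : IsSquare y
  · obtain ⟨r, rfl⟩ := hs
    have hr : r ≠ 0 := left_ne_zero_of_mul hy
    exact ⟨r⁻¹, inv_ne_zero hr, Or.inl (by field_simp)⟩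
  · have hδ0 : δ ≠ 0 := fun h => hδ (h ▸ IsSquare.zero)
    have h1 : quadraticChar F (y * δ) = 1 := by
      rw [map_mul, quadraticChar_neg_one_iff_not_isSquare.2 hs,
        quadraticChar_neg_one_iff_not_isSquare.2 hδ]
      norm_num
    obtain ⟨r, hr⟩ := (quadraticChar_one_iff_isSquare (mul_ne_zero hy hδ0)).1 h1
    have hr0 : r ≠ 0 := fun h => mul_ne_zero hy hδ0 (by rw [hr, h, zero_mul])
    refine ⟨r / y, div_ne_zero hr0 hy, Or.inr ?_⟩
    field_simp
    linear_combination -hr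

include h2 in
-- Applied to `δ⁻¹`, this makes the form with diagonal `(δ, δ)` equivalent to the one with diagonal
-- `(1, 1)`.
theorem exists_mul_self_add_mul_self (a : F) : ∃ x y : F, x * x + y * y = a := by
  classical
  have : Fintype F := Fintype.ofFinite F
  open Polynomial in
  obtain ⟨x, y, hxy⟩ := FiniteField.exists_root_sum_quadratic (R := F)
    (f := X ^ 2) (g := X ^ 2 - C a) (degree_X_pow 2)
    (degree_X_pow_sub_C (by norm_num) a)
    (FiniteField.odd_card_of_char_ne_two fun h => h2 (by
      have := CharP.cast_eq_zero F (ringChar F)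
      rw [h] at this
      exact_mod_cast this))
  refine ⟨x, y, ?_⟩
  simp only [Polynomial.eval_pow, Polynomial.eval_X, Polynomial.eval_sub, Polynomial.eval_C] at hxy
  linear_combination hxy

end Squares

section Rotation

/-- The element that acts on the rows `b` and `e` by the matrix with rows `(x, y)`, `(-y, x)`. -/
def rotation (P : SymPartition T n) (b e : Idx T n) (x y : F) : ContractionAlgebra P F := fun i j =>
  if i = b then (if j = b then x else if j = e then y else 0)
  else if i = e then (if j = b then -y else if j = e then x else 0)
  else if i = j then 1 else 0

variable {b e : Idx T n} (hbe : b ≠ e) (hbl : P.block b = P.block e)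

include hbe hbl

theorem rotation_mul_entry (x y : F) (Z : ContractionAlgebra P F) (i j : Idx T n) :
    (rotation P b e x y * Z) i j = if i = b then x * Z b j + y * Z e j
      else if i = e then -y * Z b j + x * Z e j else Z i j := by
  have hentry : ∀ k, rotation P b e x y i k = if i = b then (if k = b then x else if k = e then y else 0)
      else if i = e then (if k = b then -y else if k = e then x else 0)
      else if i = k then 1 else 0 := fun _ => rfl
  rw [mul_entry]
  by_cases hi : i = b ∨ i = e
  · rw [Finset.sum_eq_add b e hbe]
    · have hib : P.block i = P.block b := by
        rcases hi with rfl | rfl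
        · rfl
        · exact hbl.symm
      rw [hentry, hentry, windCoeff_of_block_eq_left hib,
        windCoeff_of_block_eq_left (hib.trans hbl)]
      rcases hi with rfl | rfl
      · simp [hbe.symm]
      · simp [hbe.symm]
    · intro k _ hk
      rw [hentry, if_neg hk.1, if_neg hk.2, if_neg hk.1, if_neg hk.2]
      rcases hi with h | h
      · rw [if_pos h, zero_mul, mul_zero]
      · rw [if_neg (h ▸ hbe.symm), if_pos h, zero_mul, mul_zero]
    · exact fun h => absurd (Finset.mem_univ _) h
    · exact fun h => absurd (Finset.mem_univ _) h
  · push Not at hi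
    rw [if_neg hi.1, if_neg hi.2, Finset.sum_eq_single i]
    · rw [hentry, if_neg hi.1, if_neg hi.2, if_pos rfl, windCoeff_left, one_mul, one_mul]
    · intro k _ hk
      rw [hentry, if_neg hi.1, if_neg hi.2, if_neg hk.symm, zero_mul, mul_zero]
    · exact fun h => absurd (Finset.mem_univ _) h

/-- Rotations multiply like numbers `x + y√-1`, so the inverse is the conjugate divided by `x² +
y²`. -/
theorem isUnit_rotation {x y : F} (hxy : x * x + y * y ≠ 0) : IsUnit (rotation P b e x y) := by
  have key : ∀ x y x' y' : F, x * x' - y * y' = 1 → x * y' + y * x' = 0 →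
      rotation P b e x y * rotation P b e x' y' = 1 := by
    intro x y x' y' h1 h3
    ext i j
    have hentry : ∀ i k, rotation P b e x' y' i k =
      if i = b then (if k = b then x' else if k = e then y' else 0)
      else if i = e then (if k = b then -y' else if k = e then x' else 0)
      else if i = k then 1 else 0 := fun _ _ => rfl
    rw [rotation_mul_entry hbe hbl, one_entry, hentry b, hentry e, hentry i, if_pos rfl,
      if_neg hbe.symm, if_pos rfl]
    by_cases hi : i = b
    · subst hi
      rw [if_pos rfl]
      by_cases hj : j = i
      · subst hj
        simp only [if_true]
        linear_combination h1
      · by_cases hj' : j = e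
        · subst hj'
          simp only [hj, if_true, if_false, Ne.symm hj]
          linear_combination h3
        · simp [hj, hj', Ne.symm hj]
    · rw [if_neg hi]
      by_cases hi' : i = e
      · subst hi'
        rw [if_pos rfl]
        by_cases hj : j = b
        · subst hj
          simp only [if_true, hi, if_false]
          linear_combination -h3
        · by_cases hj' : j = i
          · subst hj'
            simp only [hj, if_true, if_false]
            linear_combination h1
          · simp [hj, hj', Ne.symm hj']
      · simp only [hi, hi', if_false]
  set s := x * x + y * y with hs
  have h1 : x * (x / s) - y * (-y / s) = 1 := by
    have : x * (x / s) - y * (-y / s) = (x * x + y * y) / s := by ring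
    rw [this, ← hs, div_self hxy]
  refine ⟨⟨_, rotation P b e (x / s) (-y / s), key _ _ _ _ h1 ?_, key _ _ _ _ ?_ ?_⟩, rfl⟩
  · ring
  · linear_combination h1
  · ring

theorem mul_star_rotation_entry (hs : sgn F b = sgn F e) (x y : F) (Z : ContractionAlgebra P F)
    (i j : Idx T n) :
    (Z * star (rotation P b e x y)) i j = if j = -b then x * Z i (-b) + y * Z i (-e)
      else if j = -e then -y * Z i (-b) + x * Z i (-e) else Z i j := by
  have h1 : Z * star (rotation P b e x y) = star (rotation P b e x y * star Z) := by
    rw [star_mul, star_star]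
  rw [h1, star_entry, rotation_mul_entry hbe hbl]
  have hi := sgn_mul_self (F := F) i
  have hj := sgn_mul_self (F := F) j
  have key : ∀ k : Idx T n, sgn F i * sgn F (-k) * (sgn F k * sgn F (-i)) = 1 := by
    intro k
    have h3 := sgn_neg_mul_sgn_neg (F := F) i k
    have h4 := sgn_mul_self (F := F) k
    linear_combination sgn F i * sgn F k * h3 + sgn F k * sgn F k * hi + h4
  have e1 : ∀ k : Idx T n, -j = k ↔ j = -k := fun k => neg_eq_iff_eq_neg
  rw [if_congr (e1 b) rfl rfl, if_congr (e1 e) rfl rfl]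
  rw [star_entry, star_entry, star_entry, neg_neg, neg_neg]
  split_ifs with hjb hje
  · rw [hjb, ← hs]
    linear_combination (x * Z i (-b) + y * Z i (-e)) * key b
  · rw [hje, hs]
    linear_combination (-y * Z i (-b) + x * Z i (-e)) * key e
  · rw [sgn_neg_mul_sgn_neg]
    linear_combination Z i j * sgn F j * sgn F j * hi + Z i j * hj

end Rotation

/-- By symmetry and monotonicity all labels of a block other than `I_0` have the same sign. -/
theorem sgn_eq_of_block_eq {a b : Idx T n} (h : P.block a = P.block b) (h0 : P.block a ≠ 0) :
    sgn F a = sgn F b := by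
  have key : ∀ x : Idx T n, (x.1 < 0 → P.block x ≤ 0) ∧ (¬x.1 < 0 → 0 ≤ P.block x) := by
    intro x
    have hn := P.block_neg x
    refine ⟨fun hx => ?_, fun hx => ?_⟩
    · have := P.mono (show x ≤ -x from Subtype.coe_le_coe.1 (by rw [coe_neg]; omega))
      omega
    · have := P.mono (show -x ≤ x from Subtype.coe_le_coe.1 (by rw [coe_neg]; omega))
      omega
  have ha := key a
  have hb := key b
  have : a.1 < 0 ↔ b.1 < 0 := by
    constructor
    · intro h1
      by_contra h3
      have := ha.1 h1
      have := hb.2 h3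
      omega
    · intro h1
      by_contra h3
      have := hb.1 h1
      have := ha.2 h3
      omega
  unfold sgn
  split_ifs <;> first | rfl | tauto

/-! ## Normal forms -/

/-- Monomial elements whose entries at roots are `κ`, apart from the antidiagonal ones, which are `1`
or `δ`. -/
structure IsNormalized (P : SymPartition T n) (δ κ : F) (Y : ContractionAlgebra P F) : Prop where
  monomial : PartialMonomial P ∅ 0 Y
  entry : ∀ i j, IsRoot (i, j) → j ≠ -i → Y i j ≠ 0 → Y i j = κ
  anti : ∀ i, Y i (-i) ≠ 0 → Y i (-i) = 1 ∨ Y i (-i) = δ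

section Normalize

theorem IsRoot.not_conj {i j : Idx T n} (h : IsRoot (i, j)) (hij : j ≠ -i) : ¬IsRoot (-j, -i) :=
  fun h' => hij ((conjPair_eq_iff (i, j)).1 (h.conjPair_eq h'))

theorem PartialMonomial.of_entry_ne_zero {Y Z : ContractionAlgebra P F}
    (hY : PartialMonomial P ∅ 0 Y) (hZ : Z ∈ nilradical P F) (h : ∀ i j, Z i j ≠ 0 → Y i j ≠ 0) :
    PartialMonomial P ∅ 0 Z :=
  ⟨hZ, fun _ _ _ => by simp, fun a ha b b' hb hb' => hY.row a ha b b' (h _ _ hb) (h _ _ hb'),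
    fun hT a ha b hb hbl => hY.anti hT a ha b (h _ _ hb) hbl, fun a ha => by simp at ha⟩

variable [Finite F] (h2 : (2 : F) ≠ 0) {δ : F} (hδ : ¬IsSquare δ)

include hδ in
theorem exists_isNormalized {κ : F} (hκ : κ ≠ 0) {Y : ContractionAlgebra P F}
    (hY : PartialMonomial P ∅ 0 Y) :
    ∃ g : ContractionAlgebra P F, IsUnit g ∧ IsNormalized P δ κ (g * Y * star g) := by
  classical
  have hrow : ∀ a b b', Y a b ≠ 0 → Y a b' ≠ 0 → b = b' := fun a b b' =>
    hY.row a (Finset.notMem_empty a) b b'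
  -- The entry at `(i, j)` is scaled by `c i * c (-j)`. Off the antidiagonal only one of `(i, j)`
  -- and `(-j, -i)` is a root, so its row takes the whole factor `κ / Y i j` and the conjugate row
  -- the factor `1`.
  have hex : ∀ i, ∃ c : F, c ≠ 0 ∧
      (∀ j, IsRoot (i, j) → j ≠ -i → Y i j ≠ 0 → c * Y i j = κ) ∧
      (Y i (-i) ≠ 0 → c * c * Y i (-i) = 1 ∨ c * c * Y i (-i) = δ) ∧
      ((∀ j, IsRoot (i, j) → j ≠ -i → Y i j = 0) → Y i (-i) = 0 → c = 1) := by
    intro i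
    by_cases h1 : ∃ j, IsRoot (i, j) ∧ j ≠ -i ∧ Y i j ≠ 0
    · obtain ⟨j, hr, hj, hij⟩ := h1
      refine ⟨κ / Y i j, div_ne_zero hκ hij, fun j' _ _ hij' => ?_, fun h => ?_, fun h => ?_⟩
      · rw [hrow i j' j hij' hij, div_mul_cancel₀ _ hij]
      · exact absurd (hrow i j (-i) hij h) hj
      · exact absurd (h j hr hj) hij
    · push Not at h1
      by_cases h3 : Y i (-i) = 0
      · exact ⟨1, one_ne_zero, fun j hr hj hij => absurd (h1 j hr hj) hij,
          fun h => absurd h3 h, fun _ _ => rfl⟩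
      · obtain ⟨c, hc, hcc⟩ := exists_mul_self_mul_eq hδ h3
        exact ⟨c, hc, fun j hr hj hij => absurd (h1 j hr hj) hij, fun _ => hcc,
          fun _ h => absurd h h3⟩
  choose c hc hc1 hc2 hc3 using hex
  have hu := isUnit_diagonalElement (P := P) hc
  refine ⟨_, hu, hY.of_entry_ne_zero (mem_nilradical_conj hY.mem hu) fun i j h => ?_,
    fun i j hr hj h => ?_, fun i h => ?_⟩
  · rw [diagonalElement_conj_entry] at h
    exact right_ne_zero_of_mul h
  · rw [diagonalElement_conj_entry] at h ⊢
    have hij := right_ne_zero_of_mul h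
    have hne := (nilradical_entry_neg_ne_zero hY.mem.1).2 hij
    have h4 : c (-j) = 1 := by
      refine hc3 (-j) (fun j' hr' _ => ?_) ?_
      · by_contra h0
        rw [hrow _ _ _ h0 hne] at hr'
        exact hr.not_conj hj hr'
      · by_contra h0
        refine hj ?_
        rw [← hrow _ _ _ h0 hne, neg_neg]
    rw [h4, mul_one]
    exact hc1 i j hr hj hij
  · rw [diagonalElement_conj_entry, neg_neg] at h ⊢
    exact hc2 i (right_ne_zero_of_mul h)

include h2 hδ in
-- Two antidiagonal entries `δ` in one block are rotated into two entries `1`; the number of entries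
-- `δ` decreases.
theorem IsNormalized.exists_unique (k : ℕ) : ∀ {κ : F} {Y : ContractionAlgebra P F},
    IsNormalized P δ κ Y → Nat.card {i // Y i (-i) = δ} = k →
    ∃ g : ContractionAlgebra P F, IsUnit g ∧ IsNormalized P δ κ (g * Y * star g) ∧
      ∀ i j, P.block i = P.block j → (g * Y * star g : ContractionAlgebra P F) i (-i) = δ →
        (g * Y * star g : ContractionAlgebra P F) j (-j) = δ → i = j := by
  classical
  induction k using Nat.strong_induction_on with
  | _ k ih =>
    intro κ Y hY hk
    by_cases huniq : ∀ i j, P.block i = P.block j → Y i (-i) = δ → Y j (-j) = δ → i = j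
    · exact ⟨1, isUnit_one, by rwa [star_one, one_mul, mul_one], by
        rwa [star_one, one_mul, mul_one]⟩
    push Not at huniq
    obtain ⟨b, e, hbl, hb, he, hbe⟩ := huniq
    have hδ0 : δ ≠ 0 := fun h => hδ (h ▸ IsSquare.zero)
    have hδ1 : δ ≠ 1 := fun h => hδ (h ▸ IsSquare.one)
    have hrow : ∀ a b b', Y a b ≠ 0 → Y a b' ≠ 0 → b = b' := fun a b b' =>
      hY.monomial.row a (Finset.notMem_empty a) b b'
    have hrow0 : ∀ x, Y x (-x) = δ → ∀ j, j ≠ -x → Y x j = 0 := fun x hx j hj => by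
      by_contra h0
      exact hj (hrow x j (-x) h0 (hx ▸ hδ0))
    have hcol0 : ∀ x, Y x (-x) = δ → ∀ i, i ≠ x → Y i (-x) = 0 := fun x hx i hi => by
      by_contra h0
      have h1 := (nilradical_entry_neg_ne_zero hY.monomial.mem.1).2 h0
      rw [neg_neg] at h1
      exact hi (neg_injective (hrow x (-i) (-x) h1 (hx ▸ hδ0)))
    -- The rotation carries the diagonal `(δ, δ)` to `δ (x² + y²) = 1` twice, and the mixed terms
    -- cancel.
    obtain ⟨x, y, hxy⟩ := exists_mul_self_add_mul_self h2 (δ⁻¹)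
    have hxy' : x * x + y * y ≠ 0 := hxy ▸ inv_ne_zero hδ0
    have hu := isUnit_rotation (F := F) hbe hbl hxy'
    have hbl0 : P.block b ≠ 0 := fun h0 => by
      have := hY.monomial.mem.2 b (-b) (by rw [P.block_neg, h0, neg_zero])
      exact hδ0 (hb.symm.trans this)
    have hs : sgn F b = sgn F e := sgn_eq_of_block_eq hbl hbl0
    set g := rotation P b e x y with hg
    have hentry : ∀ i j, (g * Y * star g : ContractionAlgebra P F) i j =
        if (i = b ∧ j = -b) ∨ (i = e ∧ j = -e) then 1 else Y i j := by
      intro i j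
      have hδxy : δ * (x * x + y * y) = 1 := by rw [hxy, mul_inv_cancel₀ hδ0]
      rw [hg, mul_star_rotation_entry hbe hbl hs, rotation_mul_entry hbe hbl,
        rotation_mul_entry hbe hbl, rotation_mul_entry hbe hbl]
      have n1 : -b ≠ -e := fun h => hbe (neg_injective h)
      have r1 := hrow0 b hb (-e) n1.symm
      have r2 := hrow0 e he (-b) n1
      by_cases hib : i = b
      · subst hib
        by_cases hjb : j = -i
        · subst hjb
          simp only [if_true, true_and, true_or, hb, he, r1, r2]
          linear_combination hδxy
        · by_cases hje : j = -e
          · subst hje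
            simp only [if_true, hjb, if_false, and_false, hbe, false_and, or_false, hb, he, r1, r2]
            ring
          · simp [hjb, hje, hbe, hrow0 i hb j hjb, hrow0 e he j hje]
      · by_cases hie : i = e
        · subst hie
          by_cases hjb : j = -b
          · subst hjb
            simp only [if_true, hib, if_false, false_and, n1, and_false, or_false, hb, he, r1, r2]
            ring
          · by_cases hje : j = -i
            · subst hje
              simp only [if_true, hjb, if_false, hib, false_and, true_and, or_true, hb, he, r1, r2]
              linear_combination hδxy
            · simp [hjb, hje, hib, hrow0 b hb j hjb, hrow0 i he j hje]
        · simp only [hib, hie, if_false, false_and, or_false]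
          have c1 := hcol0 b hb i hib
          have c2 := hcol0 e he i hie
          split_ifs with h1 h3
          · rw [c1, c2, h1, c1]
            ring
          · rw [c1, c2, h3, c2]
            ring
          · rfl
    have hbne : ∀ i j, ((i = b ∧ j = -b) ∨ (i = e ∧ j = -e)) → Y i j = δ ∧ j = -i := by
      rintro i j (⟨rfl, rfl⟩ | ⟨rfl, rfl⟩)
      · exact ⟨hb, rfl⟩
      · exact ⟨he, rfl⟩
    have hY' : IsNormalized P δ κ (g * Y * star g) := by
      refine ⟨hY.monomial.of_entry_ne_zero (mem_nilradical_conj hY.monomial.mem hu)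
        fun i j h => ?_, fun i j hr hj h => ?_, fun i h => ?_⟩
      · rw [hentry] at h
        split_ifs at h with h1
        · rw [(hbne i j h1).1]
          exact hδ0
        · exact h
      · rw [hentry] at h ⊢
        split_ifs at h ⊢ with h1
        · exact absurd (hbne i j h1).2 hj
        · exact hY.entry i j hr hj h
      · rw [hentry] at h ⊢
        split_ifs at h ⊢ with h1
        · exact Or.inl rfl
        · exact hY.anti i h
    have hlt : Nat.card {i // (g * Y * star g : ContractionAlgebra P F) i (-i) = δ} < k := by
      rw [← hk, Nat.card_eq_fintype_card, Nat.card_eq_fintype_card]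
      refine Fintype.card_lt_of_injective_of_notMem
        (fun i => ⟨i.1, ?_⟩) (fun i j h => Subtype.ext (congrArg (fun z => z.1) h)) (b := ⟨b, hb⟩) ?_
      · have := i.2
        rw [hentry] at this
        split_ifs at this with h1
        · exact absurd this.symm hδ1
        · exact this
      · rintro ⟨i, hi⟩
        have hib : i.1 = b := congrArg Subtype.val hi
        have := i.2
        rw [hentry, hib, if_pos (Or.inl ⟨rfl, rfl⟩)] at this
        exact hδ1 this.symm
    obtain ⟨g', hg', h3, h4⟩ := ih _ hlt hY' rfl
    exact ⟨g' * g, hg'.mul hu, by rwa [conj_mul], by rwa [conj_mul]⟩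

include h2 hδ in
/-- Every element of `u^a` is congruent to a normalized one, with at most one entry `δ` in every
block. -/
theorem exists_isNormalized_unique {κ : F} (hκ : κ ≠ 0) {X : ContractionAlgebra P F}
    (hX : X ∈ nilradical P F) :
    ∃ g : ContractionAlgebra P F, IsUnit g ∧ IsNormalized P δ κ (g * X * star g) ∧
      ∀ i j, P.block i = P.block j → (g * X * star g : ContractionAlgebra P F) i (-i) = δ →
        (g * X * star g : ContractionAlgebra P F) j (-j) = δ → i = j := by
  obtain ⟨g, hg, hgX⟩ := exists_monomial h2 hX
  obtain ⟨k, hk, hkX⟩ := exists_isNormalized hδ hκ hgX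
  obtain ⟨l, hl, hlX, hu⟩ := hkX.exists_unique h2 hδ _ rfl
  exact ⟨l * (k * g), hl.mul (hk.mul hg), by rwa [conj_mul, conj_mul],
    by rwa [conj_mul, conj_mul]⟩

end Normalize

end ParabolicContraction

end

noncomputable section

namespace ParabolicContraction

variable {T : ClassicalType} {n : ℕ} {P : SymPartition T n} {F : Type*} [Field F]

/-! ## Basic elements and basic forms -/

/-- The patterns of entries that give rise to basic pairs. -/
structure IsBasicPattern (P : SymPartition T n) (δ : F) (f : Idx T n → Idx T n → F) : Prop where
  block_ne : ∀ i j, f i j ≠ 0 → P.block i ≠ P.block j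
  conj : ∀ i j, f (-j) (-i) ≠ 0 ↔ f i j ≠ 0
  row : ∀ i j j', f i j ≠ 0 → f i j' ≠ 0 → j = j'
  anti_of_block : T = ClassicalType.C → ∀ i j, f i j ≠ 0 → P.block j = -P.block i → j = -i
  anti : ∀ i, f i (-i) ≠ 0 → f i (-i) = 1 ∨ f i (-i) = δ
  unique : ∀ i j, P.block i = P.block j → f i (-i) = δ → f j (-j) = δ → i = j

namespace IsBasicPattern

variable {δ : F} {f : Idx T n → Idx T n → F}

/-- The trace form reads an element at transposed positions, so patterns of linear forms are
transposes of patterns of elements. -/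
theorem transpose (hf : IsBasicPattern P δ f) : IsBasicPattern P δ fun i j => f j i where
  block_ne i j h := (hf.block_ne j i h).symm
  conj i j := hf.conj j i
  row i j j' h h' := neg_injective (hf.row _ _ _ ((hf.conj j i).2 h) ((hf.conj j' i).2 h'))
  anti_of_block hT i j h hbl := by
    rw [hf.anti_of_block hT j i h (by omega), neg_neg]
  anti i h := by
    have := hf.anti (-i)
    rw [neg_neg] at this
    exact this h
  unique i j hbl h h' := by
    refine neg_injective (hf.unique (-i) (-j) ?_ ?_ ?_)
    · rw [P.block_neg, P.block_neg, hbl]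
    · rwa [neg_neg]
    · rwa [neg_neg]

open Classical in
/-- The roots at which a pattern has nonzero entries. -/
def support (f : Idx T n → Idx T n → F) : Finset (Idx T n × Idx T n) :=
  Finset.univ.filter fun γ => IsRoot γ ∧ f γ.1 γ.2 ≠ 0

theorem mem_support {γ : Idx T n × Idx T n} : γ ∈ support f ↔ IsRoot γ ∧ f γ.1 γ.2 ≠ 0 := by
  simp [support]

open Classical in
/-- The coefficients of the basic pair of a pattern. -/
def coeff (f : Idx T n → Idx T n → F) (γ : support f) : Fˣ :=
  if γ.1.2 = -γ.1.1 then Units.mk0 (f γ.1.1 γ.1.2) (mem_support.1 γ.2).2 else 1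

theorem coeff_of_eq {γ : support f} (h : γ.1.2 = -γ.1.1) :
    (coeff f γ : F) = f γ.1.1 (-γ.1.1) := by
  rw [coeff, if_pos h, Units.val_mk0, h]

theorem coeff_of_ne {γ : support f} (h : γ.1.2 ≠ -γ.1.1) : (coeff f γ : F) = 1 := by
  rw [coeff, if_neg h, Units.val_one]

theorem isBasicPair (hf : IsBasicPattern P δ f) (hδ : ¬IsSquare δ) :
    IsBasicPair P δ (support f) (coeff f) := by
  have hδ1 : δ ≠ 1 := fun h => hδ (h ▸ IsSquare.one)
  have hne : ∀ α : Idx T n × Idx T n, (α ∈ support f ∨ conjPair α ∈ support f) → f α.1 α.2 ≠ 0 := by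
    rintro α (h | h)
    · exact (mem_support.1 h).2
    · exact (hf.conj _ _).1 (mem_support.1 h).2
  have hself : ∀ γ : support f, (coeff f γ : F) = δ → γ.1.2 = -γ.1.1 := by
    intro γ h
    by_contra h'
    rw [coeff_of_ne h'] at h
    exact hδ1 h.symm
  refine ⟨⟨fun γ hγ => ⟨(mem_support.1 hγ).1, hf.block_ne _ _ (mem_support.1 hγ).2⟩, ?_⟩, ?_, ?_⟩
  · intro α β hα hβ h
    rcases h with h | h
    · exact Prod.ext h (hf.row _ _ _ (hne α hα) (by rw [h]; exact hne β hβ))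
    · exact Prod.ext (hf.transpose.row _ _ _ (hne α hα) (by rw [h]; exact hne β hβ)) h
  · intro hT γ
    refine if_neg fun h => hT ((mem_support.1 γ.2).1.eq_C h)
  · intro hT
    refine ⟨fun γ => ?_, hself, fun γ h => ?_, fun γ γ' h h' hbl hδγ hδγ' => ?_⟩
    · by_cases h : γ.1.2 = -γ.1.1
      · rw [coeff_of_eq h]
        refine hf.anti _ ?_
        rw [← h]
        exact (mem_support.1 γ.2).2
      · exact Or.inl (coeff_of_ne h)
    · exact hf.anti_of_block hT _ _ (mem_support.1 γ.2).2 h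
    · have e := hself γ hδγ
      have e' := hself γ' hδγ'
      rw [coeff_of_eq e] at hδγ
      rw [coeff_of_eq e'] at hδγ'
      have h1 := hf.unique _ _ hbl hδγ hδγ'
      exact Subtype.ext (Prod.ext h1 (by rw [e, e', h1]))

end IsBasicPattern

theorem IsNormalized.isBasicPattern {δ κ : F} {Y : ContractionAlgebra P F}
    (hY : IsNormalized P δ κ Y) (hu : ∀ i j, P.block i = P.block j → Y i (-i) = δ →
      Y j (-j) = δ → i = j) : IsBasicPattern P δ fun i j => Y i j where
  block_ne i j h hbl := h (hY.monomial.mem.2 i j hbl)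
  conj _ _ := nilradical_entry_neg_ne_zero hY.monomial.mem.1
  row i j j' := hY.monomial.row i (Finset.notMem_empty i) j j'
  anti_of_block hT i j := hY.monomial.anti hT i (Finset.notMem_empty i) j
  anti := hY.anti
  unique := hu

section RootVectors

/-- The only off-diagonal positions not covered by roots and their conjugates are the antidiagonal
ones in the orthogonal types, where skew matrices vanish. -/
theorem isRoot_or (a b : Idx T n) (hab : a ≠ b) (hT : T ≠ ClassicalType.C → b ≠ -a) :
    IsRoot (a, b) ∨ IsRoot (-b, -a) := by
  have hab' : a.1 ≠ b.1 := fun h => hab (Subtype.ext h)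
  have hT' : T = ClassicalType.C ∨ b.1 ≠ -a.1 := by
    by_cases h : T = ClassicalType.C
    · exact Or.inl h
    · exact Or.inr fun h' => hT h (Subtype.ext h')
  simp only [IsRoot, IsPositiveRoot, Prod.fst_swap, Prod.snd_swap, Subtype.ext_iff, coe_neg]
  rcases hT' with h | h
  · simp only [h, true_and]
    omega
  · omega

theorem IsRoot.swap {γ : Idx T n × Idx T n} (h : IsRoot γ) : IsRoot γ.swap :=
  Or.symm h

theorem eq_zero_of_root_entries (h2 : (2 : F) ≠ 0) {Z : ContractionAlgebra P F}
    (hZ : Z ∈ nilradical P F)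
    (h : ∀ γ, IsRoot γ → P.block γ.1 ≠ P.block γ.2 → Z γ.1 γ.2 = 0) : Z = 0 := by
  ext a b
  change Z a b = 0
  by_cases hbl : P.block a = P.block b
  · exact hZ.2 a b hbl
  by_cases hT : T ≠ ClassicalType.C ∧ b = -a
  · obtain ⟨hT, rfl⟩ := hT
    have := nilradical_entry hZ.1 a (-a)
    rw [neg_neg, sgn_of_ne_C hT, sgn_of_ne_C hT, one_mul, one_mul] at this
    have h3 : 2 * Z a (-a) = 0 := by linear_combination this
    exact (mul_eq_zero.1 h3).resolve_left h2
  · rcases isRoot_or a b (fun h => hbl (by rw [h])) (fun h h' => hT ⟨h, h'⟩) with hr | hr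
    · exact h _ hr hbl
    · by_contra h0
      refine (nilradical_entry_neg_ne_zero hZ.1).2 h0 (h _ hr ?_)
      change P.block (-b) ≠ P.block (-a)
      rw [P.block_neg, P.block_neg]
      omega

theorem basicElement_mem (h2 : (2 : F) ≠ 0) {D : Finset (Idx T n × Idx T n)} (φ : D → Fˣ)
    (hD : IsRookPlacement P D) : basicElement P D φ ∈ nilradical P F :=
  Submodule.sum_mem _ fun γ _ => Submodule.smul_mem _ _
    (rootVector_mem h2 (hD.1 γ.1 γ.2).1 (hD.1 γ.1 γ.2).2)

theorem sum_entry {ι : Type*} (s : Finset ι) (X : ι → ContractionAlgebra P F) (i j : Idx T n) :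
    (∑ k ∈ s, X k : ContractionAlgebra P F) i j = ∑ k ∈ s, X k i j := by
  classical
  induction s using Finset.induction_on with
  | empty => rfl
  | insert a s ha ih => rw [Finset.sum_insert ha, Finset.sum_insert ha, add_entry, ih]

variable (h2 : (2 : F) ≠ 0) {δ : F}

include h2 in
theorem basicElement_of_isNormalized (hδ : ¬IsSquare δ) {Y : ContractionAlgebra P F}
    (hY : IsNormalized P δ 1 Y) (hu : ∀ i j, P.block i = P.block j → Y i (-i) = δ →
      Y j (-j) = δ → i = j) :
    basicElement P (IsBasicPattern.support fun i j => Y i j)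
      (IsBasicPattern.coeff fun i j => Y i j) = Y := by
  have hD := ((hY.isBasicPattern hu).isBasicPair hδ).1
  refine sub_eq_zero.1 (eq_zero_of_root_entries h2
    (Submodule.sub_mem _ (basicElement_mem h2 _ hD) hY.monomial.mem) fun γ hγ _ => ?_)
  rw [sub_entry, basicElement, sum_entry]
  have hterm : ∀ γ' : IsBasicPattern.support fun i j => Y i j,
      ((IsBasicPattern.coeff (fun i j => Y i j) γ' : F) • rootVector P γ'.1) γ.1 γ.2 =
        if γ = γ'.1 then (IsBasicPattern.coeff (fun i j => Y i j) γ' : F) else 0 := by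
    intro γ'
    rw [smul_entry, rootVector_entry_of_isRoot (IsBasicPattern.mem_support.1 γ'.2).1 hγ, mul_ite,
      mul_one, mul_zero]
  rw [Finset.sum_congr rfl fun γ' _ => hterm γ']
  by_cases h0 : Y γ.1 γ.2 = 0
  · rw [h0, Finset.sum_eq_zero, sub_zero]
    intro γ' _
    refine if_neg ?_
    rintro rfl
    exact (IsBasicPattern.mem_support.1 γ'.2).2 h0
  · rw [Finset.sum_eq_single ⟨γ, IsBasicPattern.mem_support.2 ⟨hγ, h0⟩⟩, if_pos rfl, sub_eq_zero]
    · by_cases hs : γ.2 = -γ.1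
      · rw [IsBasicPattern.coeff_of_eq hs]
        exact congrArg (fun x => Y γ.1 x) hs.symm
      · rw [IsBasicPattern.coeff_of_ne hs]
        exact (hY.entry γ.1 γ.2 hγ hs h0).symm
    · intro γ' _ hne
      exact if_neg fun h => hne (Subtype.ext h.symm)
    · exact fun h => absurd (Finset.mem_univ _) h

include h2 in
theorem exists_basicElement [Finite F] (hδ : ¬IsSquare δ) {X : ContractionAlgebra P F}
    (hX : X ∈ nilradical P F) :
    ∃ (D : Finset (Idx T n × Idx T n)) (φ : D → Fˣ), IsBasicPair P δ D φ ∧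
      ∃ g : (ContractionAlgebra P F)ˣ, g.1 * X * star g.1 = basicElement P D φ := by
  obtain ⟨g, ⟨g, rfl⟩, hg, hu⟩ := exists_isNormalized_unique h2 hδ (one_ne_zero (α := F)) hX
  exact ⟨_, _, (hg.isBasicPattern hu).isBasicPair hδ, g,
    (basicElement_of_isNormalized h2 hδ hg hu).symm⟩

end RootVectors

/-! ### The trace form identifies `u^a` with its dual. -/

section TracePairing

/-- The trace form. -/
def traceForm (X Y : ContractionAlgebra P F) : F := ∑ i, ∑ j, X i j * Y j i

theorem traceForm_comm (X Y : ContractionAlgebra P F) : traceForm X Y = traceForm Y X := by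
  rw [traceForm, traceForm, Finset.sum_comm]
  exact Finset.sum_congr rfl fun i _ => Finset.sum_congr rfl fun j _ => mul_comm _ _

/-- The coefficient `windCoeff` is invariant under cyclic shifts of its arguments as soon as the two
factors from the radical join different blocks. -/
theorem traceForm_mul_left {X Y : ContractionAlgebra P F} (hX : X ∈ radical P F)
    (hY : Y ∈ radical P F) (g : ContractionAlgebra P F) :
    traceForm (g * X) Y = traceForm X (Y * g) := by
  have h1 : traceForm (g * X) Y =
      ∑ i, ∑ j, ∑ k, windCoeff P F i k j * (g i k * X k j) * Y j i :=
    Finset.sum_congr rfl fun i _ => Finset.sum_congr rfl fun j _ => by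
      rw [mul_entry, Finset.sum_mul]
  have h3 : traceForm X (Y * g) =
      ∑ k, ∑ j, ∑ i, X k j * (windCoeff P F j i k * (Y j i * g i k)) :=
    Finset.sum_congr rfl fun k _ => Finset.sum_congr rfl fun j _ => by
      rw [mul_entry, Finset.mul_sum]
  rw [h1, h3]
  have h4 : ∀ f : Idx T n → Idx T n → Idx T n → F,
      ∑ i, ∑ j, ∑ k, f i j k = ∑ k, ∑ j, ∑ i, f i j k := by
    intro f
    rw [Finset.sum_comm]
    have : ∀ j, ∑ i, ∑ k, f i j k = ∑ k, ∑ i, f i j k := fun j => Finset.sum_comm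
    rw [Finset.sum_congr rfl fun j _ => this j, Finset.sum_comm]
  rw [h4]
  refine Finset.sum_congr rfl fun k _ => Finset.sum_congr rfl fun j _ =>
    Finset.sum_congr rfl fun i _ => ?_
  by_cases hkj : P.block k = P.block j
  · rw [hX k j hkj]
    ring
  by_cases hji : P.block j = P.block i
  · rw [hY j i hji]
    ring
  have hw : windCoeff P F i k j = windCoeff P F j i k := by
    unfold windCoeff wind
    split_ifs <;> first | omega | contradiction | rfl
  rw [hw]
  ring

theorem traceForm_mul_right {X Y : ContractionAlgebra P F} (hX : X ∈ radical P F)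
    (hY : Y ∈ radical P F) (g : ContractionAlgebra P F) :
    traceForm (X * g) Y = traceForm X (g * Y) := by
  rw [traceForm_comm, ← traceForm_mul_left hY hX, traceForm_comm]

/-- The linear form on `u^a` given by an element of `u^a` through the trace form. -/
def traceDual (P : SymPartition T n) (F : Type*) [Field F] :
    nilradical P F →ₗ[F] Module.Dual F (nilradical P F) :=
  LinearMap.mk₂ F (fun Y X => traceForm Y.1 X.1)
    (fun Y Y' X => by
      simp only [traceForm, ← Finset.sum_add_distrib, ← add_mul]
      rfl)
    (fun c Y X => by
      simp only [traceForm, smul_eq_mul, Finset.mul_sum, ← mul_assoc]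
      rfl)
    (fun Y X X' => by
      simp only [traceForm, ← Finset.sum_add_distrib, ← mul_add]
      rfl)
    (fun c Y X => by
      simp only [traceForm, smul_eq_mul, Finset.mul_sum]
      refine Finset.sum_congr rfl fun i _ => Finset.sum_congr rfl fun j _ => ?_
      rw [mul_left_comm]
      rfl)

theorem traceDual_apply (Y X : nilradical P F) : traceDual P F Y X = traceForm Y.1 X.1 := rfl

theorem traceForm_matrixUnit (Y : ContractionAlgebra P F) (a b : Idx T n) :
    traceForm Y (matrixUnit P (a, b)) = Y b a := by
  rw [traceForm, Finset.sum_eq_single b, Finset.sum_eq_single a]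
  · rw [matrixUnit_entry, if_pos ⟨rfl, rfl⟩, mul_one]
  · intro j _ hj
    rw [matrixUnit_entry, if_neg fun h => hj h.1, mul_zero]
  · exact fun h => absurd (Finset.mem_univ _) h
  · intro i _ hi
    refine Finset.sum_eq_zero fun j _ => ?_
    rw [matrixUnit_entry, if_neg fun h => hi h.2, mul_zero]
  · exact fun h => absurd (Finset.mem_univ _) h

theorem traceForm_star (X Y : ContractionAlgebra P F) :
    traceForm (star X) (star Y) = traceForm X Y := by
  rw [traceForm, ← Equiv.sum_comp (Equiv.neg (Idx T n)), traceForm_comm]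
  refine Finset.sum_congr rfl fun i _ => ?_
  rw [← Equiv.sum_comp (Equiv.neg (Idx T n))]
  refine Finset.sum_congr rfl fun j _ => ?_
  change star X (-i) (-j) * star Y (-j) (-i) = _
  rw [star_entry, star_entry, neg_neg, neg_neg,
    sgn_neg_mul_sgn_neg, sgn_neg_mul_sgn_neg]
  linear_combination (Y i j * X j i * sgn F j * sgn F j) * sgn_mul_self (F := F) i +
    Y i j * X j i * sgn_mul_self (F := F) j

theorem traceForm_skewUnit {Y : ContractionAlgebra P F} (hY : star Y = -Y) (a b : Idx T n) :
    traceForm Y (skewUnit P F a b) = 2 * Y b a := by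
  have h1 : traceForm Y (skewUnit P F a b) = traceForm Y (matrixUnit P (a, b)) -
      traceForm Y (star (matrixUnit P (a, b))) := by
    simp only [traceForm, ← Finset.sum_sub_distrib, ← mul_sub]
    rfl
  have h3 : traceForm Y (star (matrixUnit P (a, b))) = -traceForm Y (matrixUnit P (a, b)) := by
    have h4 : traceForm (star Y) (star (matrixUnit P (a, b))) =
        -traceForm Y (star (matrixUnit P (a, b))) := by
      rw [hY]
      simp only [traceForm, ← Finset.sum_neg_distrib, ← neg_mul]
      rfl
    rw [traceForm_star] at h4
    rw [h4, neg_neg]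
  rw [h1, h3, traceForm_matrixUnit]
  ring

variable (h2 : (2 : F) ≠ 0)

include h2 in
-- Pairing with skew units recovers twice each entry, so the form is nondegenerate, and the
-- dimensions agree.
theorem traceDual_surjective [Finite F] : Function.Surjective (traceDual P F) := by
  have : Module.Finite F (ContractionAlgebra P F) := Module.Finite.of_finite
  have : Module.Finite F (nilradical P F) := Module.Finite.of_finite
  refine (LinearMap.injective_iff_surjective_of_finrank_eq_finrank
    (Subspace.dual_finrank_eq (K := F) (V := nilradical P F)).symm).1 ?_
  rw [← LinearMap.ker_eq_bot, LinearMap.ker_eq_bot']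
  intro Y hY
  refine Subtype.ext ?_
  ext a b
  change Y.1 a b = 0
  by_cases hbl : P.block a = P.block b
  · exact Y.2.2 a b hbl
  have h1 := congrArg (fun l => l ⟨_, skewUnit_mem (Ne.symm hbl)⟩) hY
  change traceForm Y.1 (skewUnit P F b a) = 0 at h1
  rw [traceForm_skewUnit Y.2.1] at h1
  exact (mul_eq_zero.1 h1).resolve_left h2

theorem traceDual_act (g : (ContractionAlgebra P F)ˣ) (Y X : nilradical P F) :
    traceDual P F (act P g Y) X = traceDual P F Y (act P (star g) X) := by
  change traceForm (g.1 * Y.1 * star g.1) X.1 = traceForm Y.1 (star g.1 * X.1 * star (star g.1))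
  rw [traceForm_mul_right (mul_mem_radical_right _ Y.2.2) X.2.2,
    traceForm_mul_left Y.2.2 (mul_mem_radical_right _ X.2.2), star_star]

theorem sum_smul_skewUnit {X : ContractionAlgebra P F} (hX : star X = -X) :
    ∑ a, ∑ b, X a b • skewUnit P F a b = (2 : F) • X := by
  ext i j
  rw [sum_entry, smul_entry]
  have h1 : ∀ a, (∑ b, X a b • skewUnit P F a b : ContractionAlgebra P F) i j =
      (if a = i then X i j else 0) - if a = -j then sgn F i * sgn F j * X (-j) (-i) else 0 := by
    intro a
    rw [sum_entry]
    simp only [smul_entry, skewUnit_entry, mul_sub, Finset.sum_sub_distrib]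
    congr 1
    · by_cases h : a = i
      · rw [if_pos h, Finset.sum_eq_single j]
        · rw [h, if_pos ⟨rfl, rfl⟩, mul_one]
        · intro b _ hb
          rw [if_neg fun h' => hb h'.2.symm, mul_zero]
        · exact fun h => absurd (Finset.mem_univ _) h
      · rw [if_neg h]
        exact Finset.sum_eq_zero fun b _ => by rw [if_neg fun h' => h h'.1.symm, mul_zero]
    · by_cases h : a = -j
      · rw [if_pos h, Finset.sum_eq_single (-i)]
        · rw [h, neg_neg, neg_neg, if_pos ⟨rfl, rfl⟩, mul_one, sgn_neg_mul_sgn_neg]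
          ring
        · intro b _ hb
          rw [if_neg fun h' => hb (by rw [h'.1, neg_neg]), mul_zero, mul_zero]
        · exact fun h => absurd (Finset.mem_univ _) h
      · rw [if_neg h]
        exact Finset.sum_eq_zero fun b _ => by
          rw [if_neg fun h' => h (by rw [h'.2, neg_neg]), mul_zero, mul_zero]
  rw [Finset.sum_congr rfl fun a _ => h1 a, Finset.sum_sub_distrib, Finset.sum_ite_eq' Finset.univ,
    Finset.sum_ite_eq' Finset.univ, if_pos (Finset.mem_univ _), if_pos (Finset.mem_univ _),
    nilradical_entry hX]
  have hi := sgn_mul_self (F := F) i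
  have hj := sgn_mul_self (F := F) j
  linear_combination (X i j * sgn F j * sgn F j) * hi + X i j * hj

include h2 in
theorem dual_eq_zero_of_rootVector (ν : Module.Dual F (nilradical P F))
    (h : ∀ γ (hr : IsRoot γ) (hb : P.block γ.1 ≠ P.block γ.2),
      ν ⟨rootVector P γ, rootVector_mem h2 hr hb⟩ = 0) : ν = 0 := by
  set V : Submodule F (ContractionAlgebra P F) :=
    (LinearMap.ker ν).map (nilradical P F).subtype with hV
  have hroot : ∀ γ, IsRoot γ → P.block γ.1 ≠ P.block γ.2 → skewUnit P F γ.1 γ.2 ∈ V := by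
    intro γ hr hb
    rw [← rootVector_mem_iff h2 hr]
    exact coe_mem_map_subtype (X := ⟨rootVector P γ, rootVector_mem h2 hr hb⟩) |>.2 (h γ hr hb)
  have hskew : ∀ a b, P.block a ≠ P.block b → skewUnit P F a b ∈ V := by
    intro a b hbl
    by_cases hT : T ≠ ClassicalType.C ∧ b = -a
    · obtain ⟨hT, rfl⟩ := hT
      have : skewUnit P F a (-a) = 0 := by
        ext x y
        rw [skewUnit_entry, sgn_of_ne_C hT, sgn_of_ne_C hT, neg_neg, one_mul, one_mul]
        exact sub_self _
      rw [this]
      exact V.zero_mem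
    · rcases isRoot_or a b (fun h => hbl (by rw [h])) (fun h h' => hT ⟨h, h'⟩) with hr | hr
      · exact hroot _ hr hbl
      · rw [← skewUnit_neg_mem_iff]
        refine hroot _ hr ?_
        change P.block (-b) ≠ P.block (-a)
        rw [P.block_neg, P.block_neg]
        omega
  ext X
  have hX : X.1 ∈ V := by
    rw [← V.smul_mem_iff h2, ← sum_smul_skewUnit X.2.1]
    refine Submodule.sum_mem _ fun a _ => Submodule.sum_mem _ fun b _ => ?_
    by_cases hbl : P.block a = P.block b
    · rw [X.2.2 a b hbl, zero_smul]
      exact V.zero_mem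
    · exact V.smul_mem _ (hskew a b hbl)
  exact coe_mem_map_subtype.1 hX

include h2 in
-- A root vector off the antidiagonal has two entries with equal contributions. This factor `2` is
-- the reason for `κ = 2⁻¹` in the normal form of linear forms.
theorem traceForm_rootVector {Y : ContractionAlgebra P F} (hY : star Y = -Y)
    {γ : Idx T n × Idx T n} (hr : IsRoot γ) :
    traceForm Y (rootVector P γ) = if γ.2 = -γ.1 then Y γ.2 γ.1 else 2 * Y γ.2 γ.1 := by
  split_ifs with h
  · have h1 := traceForm_skewUnit hY γ.1 γ.2
    rw [← two_smul_rootVector_of_eq (hr.eq_C h) h] at h1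
    have h3 : traceForm Y ((2 : F) • rootVector P γ) = 2 * traceForm Y (rootVector P γ) := by
      simp only [traceForm, Finset.mul_sum, smul_entry]
      exact Finset.sum_congr rfl fun i _ => Finset.sum_congr rfl fun j _ => by ring
    rw [h3] at h1
    exact mul_left_cancel₀ h2 h1
  · rw [rootVector_of_ne h, traceForm_skewUnit hY]

variable {δ : F}

include h2 in
theorem basicForm_of_isNormalized (hδ : ¬IsSquare δ) {Y : nilradical P F}
    (hY : IsNormalized P δ 2⁻¹ Y.1) (hu : ∀ i j, P.block i = P.block j → Y.1 i (-i) = δ →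
      Y.1 j (-j) = δ → i = j) :
    basicForm P (IsBasicPattern.support fun i j => Y.1 j i)
      (IsBasicPattern.coeff fun i j => Y.1 j i) = traceDual P F Y := by
  set f : Idx T n → Idx T n → F := fun i j => Y.1 j i with hf
  have hD := ((hY.isBasicPattern hu).transpose.isBasicPair hδ).1
  refine sub_eq_zero.1 (dual_eq_zero_of_rootVector h2 _ fun γ hr hb => ?_)
  rw [LinearMap.sub_apply, traceDual_apply, basicForm_apply, traceForm_rootVector h2 Y.2.1 hr]
  have hterm : ∀ γ' : IsBasicPattern.support f, (IsBasicPattern.coeff f γ' : F) *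
      rootVector P γ γ'.1.1 γ'.1.2 = if γ'.1 = γ then (IsBasicPattern.coeff f γ' : F) else 0 := by
    intro γ'
    rw [rootVector_entry_of_isRoot hr (IsBasicPattern.mem_support.1 γ'.2).1, mul_ite,
      mul_one, mul_zero]
  refine Eq.trans (congrArg (· - _) (Finset.sum_congr rfl fun γ' _ => hterm γ')) ?_
  by_cases h0 : Y.1 γ.2 γ.1 = 0
  · rw [h0, Finset.sum_eq_zero, mul_zero, ite_self, sub_zero]
    intro γ' _
    refine if_neg ?_
    rintro rfl
    exact (IsBasicPattern.mem_support.1 γ'.2).2 h0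
  · have h0' : f γ.1 γ.2 ≠ 0 := h0
    rw [Finset.sum_eq_single ⟨γ, IsBasicPattern.mem_support.2 ⟨hr, h0'⟩⟩, if_pos rfl, sub_eq_zero]
    · by_cases hs : γ.2 = -γ.1
      · rw [IsBasicPattern.coeff_of_eq hs, if_pos hs]
        exact congrArg (fun x => Y.1 x γ.1) hs.symm
      · rw [IsBasicPattern.coeff_of_ne hs, if_neg hs,
          hY.entry γ.2 γ.1 hr.swap (fun h => hs (by rw [h, neg_neg])) h0, mul_inv_cancel₀ h2]
    · intro γ' _ hne
      exact if_neg fun h => hne (Subtype.ext h)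
    · exact fun h => absurd (Finset.mem_univ _) h

include h2 in
-- The trace form intertwines the actions on `u^a` and on its dual, so the normal form of an
-- element, taken with `κ = 2⁻¹`, gives the one of a linear form.
theorem exists_basicForm [Finite F] (hδ : ¬IsSquare δ) (μ : Module.Dual F (nilradical P F)) :
    ∃ (D : Finset (Idx T n × Idx T n)) (φ : D → Fˣ), IsBasicPair P δ D φ ∧
      dualOrbit P (basicForm P D φ) = dualOrbit P μ := by
  obtain ⟨Y, rfl⟩ := traceDual_surjective h2 μ
  obtain ⟨g, ⟨g, rfl⟩, hg, hu⟩ := exists_isNormalized_unique h2 hδ (inv_ne_zero h2) Y.2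
  have hgY : IsNormalized P δ 2⁻¹ (act P g Y).1 := hg
  refine ⟨_, _, (hgY.isBasicPattern hu).transpose.isBasicPair hδ, ?_⟩
  rw [basicForm_of_isNormalized h2 hδ hgY hu]
  refine dualOrbit_eq_of_mem ⟨g, ?_⟩
  ext X
  exact traceDual_act g Y X

end TracePairing

end ParabolicContraction

end

noncomputable section

namespace ParabolicContraction

variable {T : ClassicalType} {n : ℕ} {P : SymPartition T n} {F : Type*} [Field F]

/-! ## Superclasses -/

section Superclasses

/-- `y` is obtained from `x` by conjugating the component in `L`, and applying the action of the units
to the component in `U^a` modulo the ideal attached to the component in `L`. -/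
def IsSuperConj (x y : ContractionGroup P F) : Prop :=
  (∃ l ∈ leviSubgroup P F, leviHom P F y = l * leviHom P F x * l⁻¹) ∧
    ∃ g : (ContractionAlgebra P F)ˣ,
      cayley P (unipotentPart P y) - act P g (cayley P (unipotentPart P x)) ∈
        idealOf P (leviHom P F x)

/-- The difference for `l h l⁻¹` at `X` is the image under `l` of the difference for `h` at `l⁻¹ ·
X`, and the ideal is invariant. -/
theorem idealOf_conj_le (h2 : (2 : F) ≠ 0) (l h : ContractionGroup P F) :
    idealOf P (l * h * l⁻¹) ≤ idealOf P h := by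
  refine idealOf_le h2 (fun g X hX => act_mem_idealOf g hX) fun X => ?_
  have : act P (Unitary.toUnits (l * h * l⁻¹)) X - X =
      act P (Unitary.toUnits l) (act P (Unitary.toUnits h) (act P (Unitary.toUnits l⁻¹) X) -
        act P (Unitary.toUnits l⁻¹) X) := by
    rw [map_sub, act_toUnits_act_inv, act_toUnits_mul, act_toUnits_mul]
  rw [this]
  exact act_mem_idealOf _ (act_sub_mem_idealOf _ _)

theorem idealOf_conj (h2 : (2 : F) ≠ 0) (l h : ContractionGroup P F) :
    idealOf P (l * h * l⁻¹) = idealOf P h := by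
  refine le_antisymm (idealOf_conj_le h2 l h) ?_
  have := idealOf_conj_le h2 l⁻¹ (l * h * l⁻¹)
  rwa [show l⁻¹ * (l * h * l⁻¹) * l⁻¹⁻¹ = h by group] at this

theorem idealOf_one (h2 : (2 : F) ≠ 0) : idealOf P (1 : ContractionGroup P F) = ⊥ := by
  refine le_bot_iff.1 (idealOf_le h2 (fun g X hX => ?_) fun X => ?_)
  · rw [(Submodule.mem_bot F).1 hX, map_zero]
    exact Submodule.zero_mem _
  · rw [map_one, act_one, sub_self]
    exact Submodule.zero_mem _

theorem IsSuperConj.symm (h2 : (2 : F) ≠ 0) {x y : ContractionGroup P F} (h : IsSuperConj x y) :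
    IsSuperConj y x := by
  obtain ⟨⟨l, hl, hxy⟩, g, hg⟩ := h
  refine ⟨⟨l⁻¹, inv_mem hl, by rw [hxy]; group⟩, g⁻¹, ?_⟩
  rw [hxy, idealOf_conj h2]
  have h1 := Submodule.neg_mem _ (act_mem_idealOf g⁻¹ hg)
  rwa [map_sub, ← act_mul, inv_mul_cancel, act_one, neg_sub] at h1

theorem IsSuperConj.trans (h2 : (2 : F) ≠ 0) {x y z : ContractionGroup P F} (h : IsSuperConj x y)
    (h' : IsSuperConj y z) : IsSuperConj x z := by
  obtain ⟨⟨l, hl, hxy⟩, g, hg⟩ := h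
  obtain ⟨⟨l', hl', hyz⟩, g', hg'⟩ := h'
  refine ⟨⟨l' * l, mul_mem hl' hl, by rw [hyz, hxy]; group⟩, g' * g, ?_⟩
  rw [hxy, idealOf_conj h2] at hg'
  have h1 := Submodule.add_mem _ hg' (act_mem_idealOf g' hg)
  rwa [map_sub, ← act_mul, sub_add_sub_cancel] at h1

theorem cayley_sub_mem_idealOf_iff (h2 : (2 : F) ≠ 0) (h : ContractionGroup P F)
    (u v : unipotentSubgroup P F) :
    cayley P u - cayley P v ∈ idealOf P h ↔ cayley P (v⁻¹ * u) ∈ idealOf P h := by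
  have hV := isInvariant_map (W := idealOf P h) fun g X hX => act_mem_idealOf g hX
  have h1 := cayley_mul_sub_mem_iff h2 hV v (v⁻¹ * u)
  rw [mul_inv_cancel_left] at h1
  exact coe_mem_map_subtype.symm.trans (h1.trans coe_mem_map_subtype)

/-- Cosets of the group of the ideal become additive cosets under the Cayley map, so a superclass is
a full class of `IsSuperConj`. -/
theorem superclass_eq (h2 : (2 : F) ≠ 0) {D : Finset (Idx T n × Idx T n)} {φ : D → Fˣ}
    {h : ContractionGroup P F} (hh : h ∈ leviSubgroup P F) {v : unipotentSubgroup P F}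
    (hv : (cayley P v).1 = basicElement P D φ) :
    superclass P D φ h = {y | IsSuperConj (h * v.1) y} := by
  ext y
  change _ ↔ (∃ l ∈ _, _) ∧ ∃ g, _
  rw [leviHom_levi_mul hh, unipotentPart_levi_mul hh]
  constructor
  · rintro ⟨l, hl, u, ⟨w, ⟨g, hg⟩, hw⟩, rfl⟩
    have hlh := mul_mem (mul_mem hl hh) (inv_mem hl)
    rw [leviHom_levi_mul hlh, unipotentPart_levi_mul hlh]
    refine ⟨⟨l, hl, rfl⟩, g, ?_⟩
    have hw' : cayley P w = act P g (cayley P v) := by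
      refine Subtype.ext ?_
      rw [hg, ← hv]
      rfl
    rwa [← hw', cayley_sub_mem_idealOf_iff h2]
  · rintro ⟨⟨l, hl, hy⟩, g, hg⟩
    obtain ⟨w, hw⟩ := cayley_surjective h2 (act P g (cayley P v))
    refine ⟨l, hl, unipotentPart P y, ⟨w, ⟨g, ?_⟩, ?_⟩, ?_⟩
    · rw [hw, ← hv]
      rfl
    · rwa [← cayley_sub_mem_idealOf_iff h2, hw]
    · rw [← hy, mul_unipotentPart]

theorem exists_cayley_eq_basicElement (h2 : (2 : F) ≠ 0) {D : Finset (Idx T n × Idx T n)}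
    (φ : D → Fˣ) (hD : IsRookPlacement P D) :
    ∃ v : unipotentSubgroup P F, (cayley P v).1 = basicElement P D φ := by
  obtain ⟨v, hv⟩ := cayley_surjective h2 ⟨_, basicElement_mem h2 φ hD⟩
  exact ⟨v, congrArg Subtype.val hv⟩

theorem exists_superclass_eq (h2 : (2 : F) ≠ 0) {δ : F} {D : Finset (Idx T n × Idx T n)}
    {φ : D → Fˣ} (hD : IsBasicPair P δ D φ) {h : ContractionGroup P F}
    (hh : h ∈ rookSubgroup P F D) :
    ∃ x, superclass P D φ h = {y | IsSuperConj x y} := by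
  obtain ⟨v, hv⟩ := exists_cayley_eq_basicElement h2 φ hD.1
  exact ⟨_, superclass_eq h2 (mem_rookSubgroup_iff.1 hh).1 hv⟩

theorem IsBasicPair.mono {δ : F} {D D' : Finset (Idx T n × Idx T n)} {φ : D → Fˣ}
    (hD : IsBasicPair P δ D φ) (h : D' ⊆ D) :
    IsBasicPair P δ D' fun γ => φ ⟨γ.1, h γ.2⟩ := by
  obtain ⟨⟨h1, h2⟩, h3, h4⟩ := hD
  refine ⟨⟨fun γ hγ => h1 γ (h hγ), fun α β hα hβ => h2 α β (hα.imp (@h _) (@h _))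
    (hβ.imp (@h _) (@h _))⟩, fun hT γ => h3 hT _, fun hT => ?_⟩
  obtain ⟨h5, h6, h7, h8⟩ := h4 hT
  exact ⟨fun γ => h5 _, fun γ => h6 _, fun γ => h7 ⟨γ.1, h γ.2⟩, fun γ γ' a b c d e =>
    Subtype.ext (congrArg (fun x => x.1) (h8 ⟨γ.1, h γ.2⟩ ⟨γ'.1, h γ'.2⟩ a b c d e))⟩

theorem basicElement_sub_mem {D D' : Finset (Idx T n × Idx T n)} (φ : D → Fˣ) (h : D' ⊆ D)
    {V : Submodule F (ContractionAlgebra P F)}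
    (hV : ∀ γ ∈ D, γ ∉ D' → rootVector P γ ∈ V) :
    basicElement P D φ - basicElement P D' (fun γ => φ ⟨γ.1, h γ.2⟩) ∈ V := by
  classical
  set f : Idx T n × Idx T n → ContractionAlgebra P F := fun γ =>
    if hγ : γ ∈ D then (φ ⟨γ, hγ⟩ : F) • rootVector P γ else 0 with hf
  have h1 : basicElement P D φ = ∑ γ ∈ D, f γ := by
    rw [← Finset.sum_coe_sort D f]
    exact Finset.sum_congr rfl fun γ _ => by simp only [hf]; rw [dif_pos γ.2]
  have h2 : basicElement P D' (fun γ => φ ⟨γ.1, h γ.2⟩) = ∑ γ ∈ D', f γ := by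
    rw [← Finset.sum_coe_sort D' f]
    exact Finset.sum_congr rfl fun γ _ => by simp only [hf]; rw [dif_pos (h γ.2)]
  rw [h1, h2, ← Finset.sum_sdiff h, add_sub_cancel_right]
  refine Submodule.sum_mem _ fun γ hγ => ?_
  obtain ⟨hγ, hγ'⟩ := Finset.mem_sdiff.1 hγ
  rw [hf]
  dsimp only
  rw [dif_pos hγ]
  exact V.smul_mem _ (hV γ hγ hγ')

variable [Finite F]

/-- The unipotent part is congruent to a basic element. Discarding the roots whose vectors lie in
the ideal of `h` does not change the class, and each remaining root forces `h ∈ H_γ`, as `h` acts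
trivially modulo the ideal. -/
theorem exists_mem_superclass (h2 : (2 : F) ≠ 0) (hP : P.Admissible) {δ : F} (hδ : ¬IsSquare δ)
    (x : ContractionGroup P F) :
    ∃ (D : Finset (Idx T n × Idx T n)) (φ : D → Fˣ), IsBasicPair P δ D φ ∧
      leviHom P F x ∈ rookSubgroup P F D ∧ x ∈ superclass P D φ (leviHom P F x) := by
  classical
  set h := leviHom P F x with hh
  have hV := isInvariant_map (W := idealOf P h) fun g X hX => act_mem_idealOf g hX
  set V := (idealOf P h).map (nilradical P F).subtype with hVdef
  obtain ⟨D, φ, hD, g, hg⟩ := exists_basicElement h2 hδ (cayley P (unipotentPart P x)).2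
  set D' := D.filter fun γ => rootVector P γ ∉ V with hD'
  have hsub : D' ⊆ D := Finset.filter_subset _ _
  have hD0 := hD.mono hsub
  have hL : h ∈ leviSubgroup P F := leviHom_mem x
  refine ⟨D', _, hD0, mem_rookSubgroup_iff.2 ⟨hL, fun γ hγ => ?_⟩, ?_⟩
  · obtain ⟨hr, hb⟩ := hD0.1.1 γ hγ
    refine mem_rootSubgroup_of_fixes h2 hV hL (fun X hX => ?_) hP hb ?_
    · exact coe_mem_map_subtype.2 (act_sub_mem_idealOf h ⟨X, hX⟩)
    · rw [← rootVector_mem_iff h2 hr]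
      exact (Finset.mem_filter.1 hγ).2
  · obtain ⟨v, hv⟩ := exists_cayley_eq_basicElement h2 _ hD0.1
    rw [superclass_eq h2 hL hv]
    refine IsSuperConj.symm h2 ⟨⟨1, one_mem _, ?_⟩, g, ?_⟩
    · rw [leviHom_levi_mul hL, one_mul, inv_one, mul_one]
    · rw [unipotentPart_levi_mul hL, ← coe_mem_map_subtype, ← Submodule.neg_mem_iff]
      have h3 := basicElement_sub_mem (P := P) φ hsub (V := V) fun γ hγ hγ' => by
        by_contra h'
        exact hγ' (Finset.mem_filter.2 ⟨hγ, h'⟩)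
      rw [← hv, ← hg] at h3
      rw [Submodule.coe_sub, neg_sub]
      exact h3

end Superclasses

/-! ## The supercharacter theory -/

/-! ### Functions constant on the superclasses. -/

section Constancy

variable [Finite F] {ε : AddChar F ℂ} (h2 : (2 : F) ≠ 0)

theorem conjugateSum_conj {μ : Module.Dual F (nilradical P F)} (θ : orbitFixer μ → ℂ)
    {l : ContractionGroup P F} (hl : l ∈ leviSubgroup P F) (h : ContractionGroup P F) :
    conjugateSum (orbitFixer μ) θ (l * h * l⁻¹) = conjugateSum (orbitFixer μ) θ h := by
  by_cases hh : h ∈ orbitFixer μ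
  · have h1 := conjugateSum_eq θ ⟨h, hh⟩
    have h3 := conjugateSum_eq θ ⟨_, conj_mem_orbitFixer hl hh⟩
    refine h3.trans (Eq.trans ?_ h1.symm)
    congr 1
    rw [← Equiv.sum_comp (Equiv.mulRight l) fun x => θ (conjOrbitFixer μ x ⟨h, hh⟩)]
    refine Finset.sum_congr rfl fun x _ => congrArg θ (Subtype.ext ?_)
    change leviHom P F x * (l * h * l⁻¹) * (leviHom P F x)⁻¹ =
      leviHom P F (x * l) * h * (leviHom P F (x * l))⁻¹
    rw [map_mul, leviHom_of_mem hl]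
    group
  · rw [conjugateSum_eq_zero _ hh,
      conjugateSum_eq_zero _ (mt (conj_mem_orbitFixer_iff hl).1 hh)]

include h2 in
-- If the Levi part lies in the fixer, its ideal is annihilated by the orbit and the orbit sum is
-- unchanged. Otherwise both values are zero.
theorem formSupercharacter_eq_of_isSuperConj {μ : Module.Dual F (nilradical P F)}
    {H : Subgroup (ContractionGroup P F)} (hH : H = orbitFixer μ) (θ : H → ℂ)
    {x y : ContractionGroup P F} (h : IsSuperConj x y) :
    formSupercharacter ε μ H θ x = formSupercharacter ε μ H θ y := by
  subst hH
  obtain ⟨⟨l, hl, hxy⟩, g, hg⟩ := h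
  rw [formSupercharacter_apply h2 rfl, formSupercharacter_apply h2 rfl, hxy,
    conjugateSum_conj θ hl]
  by_cases hx : leviHom P F x ∈ orbitFixer μ
  · have h3 := idealOf_le h2 (fun g X hX => act_mem_orbitAnnihilator g hX) hx.2 hg
    rw [← orbitSum_act μ g, ← orbitSum_add_of_annihilated _ h3, add_sub_cancel]
  · rw [conjugateSum_eq_zero _ hx, zero_mul, zero_mul]

omit [Finite F] in
include h2 in
theorem isSuperInvariant_of_isSuperConj {ψ : ContractionGroup P F → ℂ}
    (hψ : ∀ x y, IsSuperConj x y → ψ x = ψ y) : IsSuperInvariant ψ where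
  conj_eq l hl h hh u := by
    refine (hψ _ _ ⟨⟨l, hl, ?_⟩, 1, ?_⟩).symm
    · rw [leviHom_levi_mul (mul_mem (mul_mem hl hh) (inv_mem hl)), leviHom_levi_mul hh]
    · rw [unipotentPart_levi_mul (mul_mem (mul_mem hl hh) (inv_mem hl)),
        unipotentPart_levi_mul hh, act_one, sub_self]
      exact Submodule.zero_mem _
  act_eq h hh g u v huv := by
    refine (hψ _ _ ⟨⟨1, one_mem _, ?_⟩, g, ?_⟩).symm
    · rw [leviHom_levi_mul hh, leviHom_levi_mul hh, one_mul, inv_one, mul_one]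
    · rw [unipotentPart_levi_mul hh, unipotentPart_levi_mul hh, huv, sub_self]
      exact Submodule.zero_mem _
  mul_eq h hh u k hk := by
    refine (hψ _ _ ⟨⟨1, one_mem _, ?_⟩, 1, ?_⟩).symm
    · rw [leviHom_levi_mul hh, leviHom_levi_mul hh, one_mul, inv_one, mul_one]
    · rw [unipotentPart_levi_mul hh, unipotentPart_levi_mul hh, act_one,
        cayley_sub_mem_idealOf_iff h2, inv_mul_cancel_left, leviHom_levi_mul hh]
      exact hk

end Constancy

/-! ### Assembly of the supercharacter theory. -/

section Theory

/-- The set of the supercharacters. -/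
def supercharacterSet (P : SymPartition T n) (δ : F) [Finite F] (ε : AddChar F ℂ) :
    Set (ContractionGroup P F → ℂ) :=
  {χ | ∃ (D : Finset (Idx T n × Idx T n)) (φ : D → Fˣ)
    (θ : rookSubgroup P F D → ℂ), IsBasicPair P δ D φ ∧ IsIrreducibleCharacter θ ∧
      χ = supercharacter P ε D φ θ}

/-- The set of the superclasses. -/
def superclassSet (P : SymPartition T n) (δ : F) : Set (Set (ContractionGroup P F)) :=
  {k | ∃ (D : Finset (Idx T n × Idx T n)) (φ : D → Fˣ)
    (h : ContractionGroup P F), IsBasicPair P δ D φ ∧ h ∈ rookSubgroup P F D ∧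
      k = superclass P D φ h}

variable [Finite F] {ε : AddChar F ℂ} {δ : F}

omit [Finite F] in
theorem mem_superclassSet_isSuperConj (h2 : (2 : F) ≠ 0) {k : Set (ContractionGroup P F)}
    (hk : k ∈ superclassSet P δ) : ∃ x, k = {y | IsSuperConj x y} := by
  obtain ⟨D, φ, h, hD, hh, rfl⟩ := hk
  exact exists_superclass_eq h2 hD hh

theorem isPartition_superclassSet (h2 : (2 : F) ≠ 0) (hP : P.Admissible) (hδ : ¬IsSquare δ) :
    Setoid.IsPartition (superclassSet (F := F) P δ) := by
  refine ⟨fun h => ?_, fun y => ?_⟩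
  · obtain ⟨D, φ, h, hD, hh, hk⟩ := h
    obtain ⟨v, hv⟩ := exists_cayley_eq_basicElement h2 φ hD.1
    have hL := (mem_rookSubgroup_iff.1 hh).1
    rw [superclass_eq h2 hL hv] at hk
    have : h * v.1 ∈ (∅ : Set (ContractionGroup P F)) := by
      rw [hk]
      refine ⟨⟨1, one_mem _, by group⟩, 1, ?_⟩
      rw [act_one, sub_self]
      exact Submodule.zero_mem _
    exact this
  · obtain ⟨D, φ, hD, hh, hy⟩ := exists_mem_superclass h2 hP hδ y
    refine ⟨_, ⟨⟨D, φ, _, hD, hh, rfl⟩, hy⟩, ?_⟩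
    rintro k ⟨hk, hyk⟩
    obtain ⟨x, hx⟩ := exists_superclass_eq h2 hD hh
    obtain ⟨x', rfl⟩ := mem_superclassSet_isSuperConj h2 hk
    rw [hx] at hy ⊢
    have hxy : IsSuperConj x y := hy
    have hxy' : IsSuperConj x' y := hyk
    ext z
    exact ⟨fun hz => (hxy.trans h2 (hxy'.symm h2)).trans h2 hz,
      fun hz => (hxy'.trans h2 (hxy.symm h2)).trans h2 hz⟩

theorem supercharacter_eq_of_mem_superclassSet (h2 : (2 : F) ≠ 0) (hP : P.Admissible)
    {χ : ContractionGroup P F → ℂ} (hχ : χ ∈ supercharacterSet P δ ε)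
    {k : Set (ContractionGroup P F)} (hk : k ∈ superclassSet P δ) {x y : ContractionGroup P F}
    (hx : x ∈ k) (hy : y ∈ k) : χ x = χ y := by
  obtain ⟨z, rfl⟩ := mem_superclassSet_isSuperConj h2 hk
  obtain ⟨D, φ, θ, hD, -, rfl⟩ := hχ
  exact formSupercharacter_eq_of_isSuperConj h2 (rookSubgroup_eq_orbitFixer h2 hP φ hD.1) θ
    ((IsSuperConj.symm h2 hx).trans h2 hy)

theorem pairwise_charInner_eq_zero (hε : ε ≠ 1) (h2 : (2 : F) ≠ 0) (hP : P.Admissible) :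
    (supercharacterSet P δ ε).Pairwise fun χ χ' => charInner χ χ' = 0 := by
  rintro _ ⟨D, φ, θ, hD, hθ, rfl⟩ _ ⟨D', φ', θ', hD', hθ', rfl⟩ hne
  exact (formSupercharacter_eq_or_charInner_eq_zero hε h2
    (rookSubgroup_eq_orbitFixer h2 hP φ hD.1)
    (rookSubgroup_eq_orbitFixer h2 hP φ' hD'.1) hθ hθ').resolve_left hne

theorem isCharacter_of_mem_supercharacterSet (hε : ε ≠ 1) (h2 : (2 : F) ≠ 0) (hP : P.Admissible)
    {χ : ContractionGroup P F → ℂ} (hχ : χ ∈ supercharacterSet P δ ε) : IsCharacter χ := by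
  obtain ⟨D, φ, θ, hD, hθ, rfl⟩ := hχ
  exact isCharacter_formSupercharacter hε h2 (rookSubgroup_eq_orbitFixer h2 hP φ hD.1) hθ

theorem ne_zero_of_mem_supercharacterSet (h2 : (2 : F) ≠ 0) (hP : P.Admissible)
    {χ : ContractionGroup P F → ℂ} (hχ : χ ∈ supercharacterSet P δ ε) : χ ≠ 0 := by
  obtain ⟨D, φ, θ, hD, hθ, rfl⟩ := hχ
  exact fun h => formSupercharacter_one_ne_zero h2
    (rookSubgroup_eq_orbitFixer h2 hP φ hD.1) hθ (congrFun h 1)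

omit [Finite F] in
-- The triple with empty `D` and `h = 1` is used: the ideal of `1` is zero, so nothing is added to
-- the identity.
theorem singleton_one_mem_superclassSet (h2 : (2 : F) ≠ 0) :
    {1} ∈ superclassSet (F := F) P δ := by
  have h0 : ∀ γ : (∅ : Finset (Idx T n × Idx T n)), False := fun γ => Finset.notMem_empty _ γ.2
  refine ⟨∅, fun γ => (h0 γ).elim, 1, ⟨⟨fun γ hγ => absurd hγ (Finset.notMem_empty _),
    fun α β hα => absurd hα (by simp)⟩, fun _ γ => (h0 γ).elim, fun _ => ⟨fun γ => (h0 γ).elim,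
    fun γ => (h0 γ).elim, fun γ => (h0 γ).elim, fun γ => (h0 γ).elim⟩⟩, one_mem _, ?_⟩
  rw [superclass_eq h2 (one_mem _) (v := 1)]
  swap
  · rw [cayley_one]
    exact (Finset.sum_of_isEmpty (ι := (∅ : Finset (Idx T n × Idx T n))) _).symm
  have hu : unipotentPart P (1 : ContractionGroup P F) = 1 := by
    have := unipotentPart_levi_mul (one_mem (leviSubgroup P F)) 1
    rwa [OneMemClass.coe_one, mul_one] at this
  ext y
  change y = 1 ↔ (∃ l ∈ _, _) ∧ ∃ g, _
  rw [OneMemClass.coe_one, mul_one, map_one, idealOf_one h2, hu, cayley_one]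
  constructor
  · rintro rfl
    refine ⟨⟨1, one_mem _, by rw [map_one]; group⟩, 1, ?_⟩
    rw [hu, cayley_one, map_zero, sub_zero]
    exact Submodule.zero_mem _
  · rintro ⟨⟨l, -, hy⟩, g, hg⟩
    rw [map_zero, sub_zero, Submodule.mem_bot, ← cayley_one] at hg
    rw [← mul_unipotentPart y, hy, cayley_injective h2 hg]
    simp

/-- Every linear form lies in the orbit of a basic form, so the hypothesis covers all orbits and all
irreducible characters of their fixers. -/
theorem eq_zero_of_orthogonal_supercharacterSet (hε : ε ≠ 1) (h2 : (2 : F) ≠ 0)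
    (hP : P.Admissible) (hδ : ¬IsSquare δ) {ψ : ContractionGroup P F → ℂ}
    (hψ : ∀ k ∈ superclassSet P δ, ∀ x ∈ k, ∀ y ∈ k, ψ x = ψ y)
    (h0 : ∀ χ ∈ supercharacterSet P δ ε, charInner ψ χ = 0) : ψ = 0 := by
  have hinv : IsSuperInvariant ψ := isSuperInvariant_of_isSuperConj h2 fun x y hxy => by
    obtain ⟨D, φ, hD, hh, hx⟩ := exists_mem_superclass h2 hP hδ x
    obtain ⟨z, hz⟩ := exists_superclass_eq h2 hD hh
    refine hψ _ ⟨D, φ, _, hD, hh, rfl⟩ x hx y ?_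
    rw [hz] at hx ⊢
    exact IsSuperConj.trans h2 hx hxy
  refine hinv.eq_zero hε h2 fun μ h hh => ?_
  refine hinv.sum_mul_star_orbitSum_eq_zero h2 μ (fun θ hθ => ?_) hh
  obtain ⟨D, φ, hD, hμ⟩ := exists_basicForm h2 hδ μ
  have hH : rookSubgroup P F D = orbitFixer μ :=
    (rookSubgroup_eq_orbitFixer h2 hP φ hD.1).trans (orbitFixer_congr hμ)
  rw [← formSupercharacter_congr hμ]
  -- The type of `θ` depends on the fixer, so `θ` has to be generalised before the fixer is
  -- rewritten as `H_D`.
  clear hh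
  revert θ
  rw [← hH]
  exact fun θ hθ => h0 _ ⟨D, φ, θ, hD, hθ, rfl⟩

theorem isSupercharacterTheory (hε : ε ≠ 1) (h2 : (2 : F) ≠ 0) (hP : P.Admissible)
    (hδ : ¬IsSquare δ) :
    IsSupercharacterTheory (supercharacterSet P δ ε) (superclassSet P δ) where
  isCharacter _ := isCharacter_of_mem_supercharacterSet hε h2 hP
  disjoint _ hχ _ hχ' hne := disjointCharacters_of_charInner_eq_zero
    (isCharacter_of_mem_supercharacterSet hε h2 hP hχ)
    (isCharacter_of_mem_supercharacterSet hε h2 hP hχ')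
    (pairwise_charInner_eq_zero hε h2 hP hχ hχ' hne)
  isPartition := isPartition_superclassSet h2 hP hδ
  encard_eq := encard_eq_of_orthogonal (isPartition_superclassSet h2 hP hδ)
    (fun _ => ne_zero_of_mem_supercharacterSet h2 hP) (pairwise_charInner_eq_zero hε h2 hP)
    (fun _ hχ _ hk _ hx _ hy => supercharacter_eq_of_mem_superclassSet h2 hP hχ hk hx hy)
    (fun _ => eq_zero_of_orthogonal_supercharacterSet hε h2 hP hδ)
  constant _ hχ _ hk _ hx _ hy := supercharacter_eq_of_mem_superclassSet h2 hP hχ hk hx hy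
  one_mem := singleton_one_mem_superclassSet h2

end Theory

end ParabolicContraction

end

open ParabolicContraction in
theorem mainTheorem9 (T : ClassicalType) (n : ℕ) (P : SymPartition T n) (hP : P.Admissible)
    (F : Type*) [Field F] [Finite F] (hF : ringChar F ≠ 2) (δ : F) (hδ : ¬ IsSquare δ)
    (ε : AddChar F ℂ) (hε : ε ≠ 1) :
    IsSupercharacterTheory
      {χ : ContractionGroup P F → ℂ | ∃ (D : Finset (Idx T n × Idx T n)) (φ : D → Fˣ)
        (θ : rookSubgroup P F D → ℂ), IsBasicPair P δ D φ ∧ IsIrreducibleCharacter θ ∧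
          χ = supercharacter P ε D φ θ}
      {k : Set (ContractionGroup P F) | ∃ (D : Finset (Idx T n × Idx T n)) (φ : D → Fˣ)
        (h : ContractionGroup P F), IsBasicPair P δ D φ ∧ h ∈ rookSubgroup P F D ∧
          k = superclass P D φ h} :=
  isSupercharacterTheory hε (Ring.two_ne_zero hF) hP hδ
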